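/- Let $d\in\{2,3\}$, let $\Omega\subset\mathbb R^d$ be a bounded polygonal ($d=2$) or polyhedral ($d=3$) Lipschitz domain, and let $k\in\mathbb N_0$, $p\in(1,\infty)$ and $\omega_0>0$. For $\delta\ge 0$ put $\varphi'(t)=(\delta+t)^{p-2}t$, define the shifted N-functions $\varphi_a(t)=\int_0^t\varphi'(a+s)\,\frac{s}{a+s}\,\mathrm ds$ for $a,t\ge 0$, and put $F(A)=(\delta+|A^{\rm sym}|)^{(p-2)/2}A^{\rm sym}$ for $A\in\mathbb R^{d\times d}$, where $A^{\rm sym}=\frac12(A+A^\top)$ and $|\cdot|$ is the Frobenius norm. Then there is a constant $c>0$, depending only on $k$, $\omega_0$, $p$ and $\Omega$ (in particular not on $\delta$ or $h$), such that the following holds for every $\delta\ge0$. Let $\mathcal T_h$ be a conforming triangulation of $\Omega$ into $d$-simplices with maximal diameter $h\le 1$, whose simplices all have chunkiness (diameter divided by inradius) at most $\omega_0$ and at most one face on $\partial\Omega$. Let $z\in (W^{1,p}_0(\Omega))^d$, and let $A\in (L^p(\Omega))^{d\times d}\cap (W^{1,1}(\Omega))^{d\times d}$ be symmetric almost everywhere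 in $\Omega$ with $F(A)\in (W^{1,2}(\Omega))^{d\times d}$. Then $$M_{\varphi_{|A|},h}(\Pi_h^k z)\;\le\; c\int_\Omega \varphi_{|A|}(|\nabla z|)\,\mathrm dx + c\,h^2\,\|\nabla F(A)\|_{L^2(\Omega)}^2 .$$ Here $\Pi_h^k z$ is the $L^2$-projection of $z$ into the space $V_h^k$ of vector fields on $\Omega$ whose restriction to each $K\in\mathcal T_h$ is polynomial of degree at most $k$, that is, $\Pi_h^kz\in V_h^k$ and $\int_\Omega \Pi_h^k z\cdot v\,\mathrm dx=\int_\Omega z\cdot v\,\mathrm dx$ for all $v\in V_h^k$. For $w\in V_h^k$, $$M_{\varphi_{|A|},h}(w)=\int_\Omega\varphi_{|A|}(|\nabla_h w|)\,\mathrm dx + h\int_{\Gamma_h}\varphi_{|A|}\big(h^{-1}|[\![ w\otimes n]\!]|\big)\,\mathrm ds ,$$ where $\nabla_h$ is the elementwise gradient, $\Gamma_h$ is the union of all interior and boundary faces of $\mathcal T_h$, on which $A$ is understood in the sense of traces, and $[\![ w\otimes n]\!]$ is the sum, over the (one or two) elements $K$ adjacent to a face, of the trace of $w|_K$ tensor the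 unit normal pointing out of $K$. -/

import Mathlib

open MeasureTheory Filter Topology
open scoped ENNReal ContDiff

noncomputable section

namespace LDG

/-- Euclidean space `ℝᵈ`. -/
abbrev Eu (d : ℕ) : Type := EuclideanSpace ℝ (Fin d)

/-- Real `d × d` tensors. -/
abbrev Ten (d : ℕ) : Type := Matrix (Fin d) (Fin d) ℝ

/-! ### Tensors -/

/-- The Frobenius norm `|A| = (∑ᵢⱼ Aᵢⱼ²)^(1/2)`. -/
def frob {d : ℕ} (A : Ten d) : ℝ := Real.sqrt (∑ i, ∑ j, A i j ^ 2)

/-- The symmetric part `(A + Aᵀ) / 2`. -/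
def symPart {d : ℕ} (A : Ten d) : Ten d := (1 / 2 : ℝ) • (A + A.transpose)

/-- `F(A) = (δ + |A^sym|)^((p - 2) / 2) A^sym`. -/
def F {d : ℕ} (p δ : ℝ) (A : Ten d) : Ten d :=
  (δ + frob (symPart A)) ^ ((p - 2) / 2) • symPart A

/-! ### The special N-function and its shifts -/

/-- The derivative `φ'(t) = (δ + t)^(p - 2) t` of the special N-function. -/
def phiDeriv (p δ t : ℝ) : ℝ := (δ + t) ^ (p - 2) * t

/-- The shifted N-function `φ_a(t) = ∫₀ᵗ φ'(a + s) s / (a + s) ds`, for `a, t ≥ 0`. -/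
def phiShift (p δ a t : ℝ) : ℝ := ∫ s in (0 : ℝ)..t, phiDeriv p δ (a + s) * (s / (a + s))

/-! ### Sobolev functions and traces -/

/-- `g` is the weak partial derivative `∂ⱼ u` on the open set `Ω`. -/
def HasWeakPartial {d : ℕ} (Ω : Set (Eu d)) (u : Eu d → ℝ) (j : Fin d) (g : Eu d → ℝ) : Prop :=
  ∀ η : Eu d → ℝ, ContDiff ℝ ∞ η → HasCompactSupport η → tsupport η ⊆ Ω →
    ∫ x in Ω, u x * fderiv ℝ η x (EuclideanSpace.single j 1) = -∫ x in Ω, g x * η x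

/-- `u ∈ W^{1,q}(Ω)`, with weak gradient `Du`. -/
def MemW1 {d : ℕ} (Ω : Set (Eu d)) (q : ℝ≥0∞) (u : Eu d → ℝ) (Du : Eu d → Fin d → ℝ) : Prop :=
  MemLp u q (volume.restrict Ω) ∧
    ∀ j, MemLp (fun x => Du x j) q (volume.restrict Ω) ∧
      HasWeakPartial Ω u j (fun x => Du x j)

/-- Let `u ∈ W^{1,1}(Ω)` with weak gradient `Du`, and let `S ⊆ closure Ω` be a
`(d-1)`-dimensional set. `tr ∈ L¹(S)` is the trace of `u` on `S`: the trace operator is the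
continuous extension of the restriction `g ↦ g|_S` of smooth functions, i.e. there are
`gₙ ∈ C^∞(ℝᵈ)` with `gₙ → u` in `W^{1,1}(Ω)` and `gₙ|_S → tr` in `L¹(S)`. The surface measure is
the `(d-1)`-dimensional Hausdorff measure, normalised as usual. -/
def HasTraceOn {d : ℕ} (Ω S : Set (Eu d)) (u : Eu d → ℝ) (Du : Eu d → Fin d → ℝ)
    (tr : Eu d → ℝ) : Prop :=
  IntegrableOn tr S (μHE[d - 1]) ∧
    ∃ g : ℕ → Eu d → ℝ, (∀ n, ContDiff ℝ ∞ (g n)) ∧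
      Tendsto (fun n => ∫⁻ x in Ω, ‖g n x - u x‖ₑ) atTop (𝓝 0) ∧
      (∀ j, Tendsto (fun n => ∫⁻ x in Ω,
        ‖fderiv ℝ (g n) x (EuclideanSpace.single j 1) - Du x j‖ₑ) atTop (𝓝 0)) ∧
      Tendsto (fun n => ∫⁻ x in S, ‖g n x - tr x‖ₑ ∂(μHE[d - 1])) atTop (𝓝 0)

/-- `z ∈ (W^{1,q}_0(Ω))ᵈ`, with weak gradient `(Dz)ᵢⱼ = ∂ⱼ zᵢ`: the components of `z` belong to
`W^{1,q}(Ω)` and their traces vanish on `∂Ω`. -/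
def MemW10 {d : ℕ} (Ω : Set (Eu d)) (q : ℝ≥0∞) (z : Eu d → Eu d) (Dz : Eu d → Ten d) : Prop :=
  ∀ i, MemW1 Ω q (fun x => z x i) (fun x => Dz x i) ∧
    HasTraceOn Ω (frontier Ω) (fun x => z x i) (fun x => Dz x i) (fun _ => 0)

/-! ### Domains and triangulations -/

/-- The (closed) simplex with the given vertices. -/
def simplex {d : ℕ} (K : Finset (Eu d)) : Set (Eu d) := convexHull ℝ (K : Set (Eu d))

/-- `K` is the vertex set of a nondegenerate `d`-dimensional simplex. -/
def IsCell {d : ℕ} (K : Finset (Eu d)) : Prop :=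
  K.card = d + 1 ∧ AffineIndependent ℝ ((↑) : K → Eu d)

/-- Near each of its boundary points, `Ω` is the strict epigraph of a Lipschitz function `g` over
the hyperplane orthogonal to some unit vector `e`. -/
def HasLipschitzBoundary {d : ℕ} (Ω : Set (Eu d)) : Prop :=
  ∀ x ∈ frontier Ω, ∃ e : Eu d, ‖e‖ = 1 ∧ ∃ r > 0, ∃ L : NNReal, ∃ g : Eu d → ℝ,
    LipschitzWith L g ∧ ∀ y ∈ Metric.ball x r, (y ∈ Ω ↔ g (y - inner ℝ e y • e) < inner ℝ e y)

/-- A bounded polygonal (`d = 2`) or polyhedral (`d = 3`) Lipschitz domain. -/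
structure IsPolyhedralLipschitzDomain {d : ℕ} (Ω : Set (Eu d)) : Prop where
  isOpen : IsOpen Ω
  isConnected : IsConnected Ω
  isBounded : Bornology.IsBounded Ω
  lipschitz : HasLipschitzBoundary Ω
  polyhedral : ∃ P : Finset (Finset (Eu d)), (∀ K ∈ P, IsCell K) ∧ closure Ω = ⋃ K ∈ P, simplex K

/-- A conforming triangulation of `Ω` into closed `d`-dimensional simplices (given by their vertex
sets), each of which has at most one face on the boundary of `Ω`. -/
structure Triangulation {d : ℕ} (Ω : Set (Eu d)) where
  cells : Finset (Finset (Eu d))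
  isCell : ∀ K ∈ cells, IsCell K
  cover : ⋃ K ∈ cells, simplex K = closure Ω
  conforming : ∀ K ∈ cells, ∀ K' ∈ cells,
    simplex K ∩ simplex K' = convexHull ℝ ((K : Set (Eu d)) ∩ (K' : Set (Eu d)))
  boundary_face : ∀ K ∈ cells, ∀ γ ⊆ K, ∀ γ' ⊆ K, γ.card = d → γ'.card = d →
    simplex γ ⊆ frontier Ω → simplex γ' ⊆ frontier Ω → γ = γ'

/-- The radius of the largest ball contained in the simplex `K`. -/
def inradius {d : ℕ} (K : Finset (Eu d)) : ℝ :=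
  sSup {r : ℝ | ∃ x, Metric.ball x r ⊆ simplex K}

/-- The chunkiness of the simplex `K`: the ratio of its diameter and its inradius. -/
def chunkiness {d : ℕ} (K : Finset (Eu d)) : ℝ := Metric.diam (simplex K) / inradius K

namespace Triangulation

variable {d : ℕ} {Ω : Set (Eu d)} (T : Triangulation Ω)

/-- The maximal mesh-size `h`. -/
def meshSize : ℝ := ⨆ K : T.cells, Metric.diam (simplex (K : Finset (Eu d)))

open scoped Classical in
/-- The vertex sets of all (interior and boundary) faces of the triangulation. -/
def faces : Finset (Finset (Eu d)) := T.cells.biUnion fun K => K.powersetCard d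

/-- The union `Γ_h` of all faces. -/
def skeleton : Set (Eu d) := ⋃ γ ∈ T.faces, simplex γ

/-! A broken field is a family `w` of fields, one for each element: `w K` represents its restriction
to the element `K` (extended to `ℝᵈ`), so that the trace from inside `K` of a broken field
that is continuous on each element is the restriction of `w K` to the faces of `K`. -/

/-- The broken polynomial space `V_h^k`. -/
def IsBrokenPoly (k : ℕ) (w : Finset (Eu d) → Eu d → Eu d) : Prop :=
  ∀ K ∈ T.cells, ∀ i, ∃ P : MvPolynomial (Fin d) ℝ, P.totalDegree ≤ k ∧
    ∀ x, w K x i = MvPolynomial.eval (fun j => x j) P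

/-- `w = Π_h^k z` is the (local) `L²`-projection of `z ∈ (L¹(Ω))ᵈ` into `V_h^k`: `w ∈ V_h^k` and
`(w, v)_Ω = (z, v)_Ω` for all `v ∈ V_h^k`. -/
def IsL2Projection (k : ℕ) (z : Eu d → Eu d) (w : Finset (Eu d) → Eu d → Eu d) : Prop :=
  T.IsBrokenPoly k w ∧ ∀ v, T.IsBrokenPoly k v →
    ∑ K ∈ T.cells, ∫ x in simplex K, inner ℝ (w K x) (v K x) =
      ∑ K ∈ T.cells, ∫ x in simplex K, inner ℝ (z x) (v K x)

end Triangulation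

/-- The gradient `(∇v)ᵢⱼ = ∂ⱼ vᵢ` of a smooth vector field. -/
def jac {d : ℕ} (v : Eu d → Eu d) (x : Eu d) : Ten d :=
  fun i j => fderiv ℝ v x (EuclideanSpace.single j 1) i

/-- `n` is the unit normal to the face `γ` of the simplex `K` that points out of `K`. -/
def IsOuterNormal {d : ℕ} (K γ : Finset (Eu d)) (n : Eu d) : Prop :=
  ‖n‖ = 1 ∧ (∀ a ∈ γ, ∀ b ∈ γ, inner ℝ n (a - b) = 0) ∧
    ∀ a ∈ γ, ∀ v ∈ K, v ∉ γ → 0 < inner ℝ n (a - v)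

/-- The outer unit normal (it exists and is unique for a face of a nondegenerate simplex). -/
def outerNormal {d : ℕ} (K γ : Finset (Eu d)) : Eu d := Classical.epsilon (IsOuterNormal K γ)

namespace Triangulation

variable {d : ℕ} {Ω : Set (Eu d)} (T : Triangulation Ω)

open scoped Classical in
/-- The normal jump `⟦w ⊗ n⟧` on the face `γ`: the sum of `w_K ⊗ n_K` over the elements `K` that
contain `γ`, that is, over two elements for an interior and one for a boundary face. -/
def jump (w : Finset (Eu d) → Eu d → Eu d) (γ : Finset (Eu d)) (x : Eu d) : Ten d :=
  ∑ K ∈ T.cells.filter (fun K => γ ⊆ K), Matrix.vecMulVec (fun i => w K x i) (outerNormal K γ)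

/-- `m_{ψ,h}(w) = h ∫_{Γ_h} ψ(x, |h⁻¹ ⟦w ⊗ n⟧|) ds`, for a function `ψ` on `Γ_h × [0,∞)`. -/
def jumpModular (ψ : Eu d → ℝ → ℝ) (w : Finset (Eu d) → Eu d → Eu d) : ℝ≥0∞ :=
  ENNReal.ofReal T.meshSize * ∑ γ ∈ T.faces, ∫⁻ x in simplex γ,
    ENNReal.ofReal (ψ x (frob (T.meshSize⁻¹ • T.jump w γ x))) ∂(μHE[d - 1])

/-- `M_{ψ,h}(w) = ∫_Ω ψ(x, |∇_h w|) dx + m_{ψ,h}(w)`. Here `ψΩ` and `ψΓ` are the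
values of `ψ` on `Ω` and (in the sense of traces) on `Γ_h`. -/
def dgModular (ψΩ ψΓ : Eu d → ℝ → ℝ) (w : Finset (Eu d) → Eu d → Eu d) : ℝ≥0∞ :=
  (∑ K ∈ T.cells, ∫⁻ x in simplex K, ENNReal.ofReal (ψΩ x (frob (jac (w K) x)))) +
    T.jumpModular ψΓ w

end Triangulation

end LDG

end

noncomputable section

namespace LDG

/-! ### The special N-function -/

/-! The estimate is local. Let `m_K` be the mean of `|∇z|` over a cell `K`, and `h_K` its diameter.

Projection. The projection acts cell by cell and component by component, and it reproduces
constants, so `w_K - c` is the projection of `z - c` for every constant `c`. Equivalence of norms on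
polynomials and scaling bound `|w_K - c|` and `h_K |∇w_K|` on `K` by the mean of `|z - c|`. For each
face `γ` a constant `c_γ` is taken as a limit of averages over `γ` of smooth approximations of `z`
(`exists_face_mean`). It is the same for both adjacent cells, vanishes if `γ` lies on the boundary,
and satisfies an `L¹` Poincaré inequality on the adjacent cells. Hence `|∇w_K| ≤ C m_K` and `|w_K -
c_γ| ≤ C h_K m_K` (`exists_projection_le_average`). Since the two normals of an interior face cancel
and `c_γ = 0` on the boundary, `c_γ` may be subtracted inside the jump, so the jump is bounded by
the sum of `C h_K m_K` over the adjacent cells.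

Shifts. It remains to bound integrals of `φ_{|A|}(C m_K)` over `K` and over its faces. By the change
of shift (`phiDeriv_shift_le`), replacing the shift `|A(x)|` by a constant `|A(y)|` costs a multiple
of `|F(A(x)) - F(A(y))|²`. With a constant shift Jensen's inequality removes the mean, and a second
change of shift returns to `|A|`. A suitable `y` makes the total cost on `K` at most a multiple of
`h_K² ‖∇F(A)‖²` on `K` (`exists_poincare_point`).

Faces. Only `A` has a prescribed trace, whereas the bound comes from `F(A)`. Both are evaluated on
copies of the face contracted towards an interior point. Integrals over these copies are controlled
by volume integrals (`lintegral_measure_shrink_preimage_le`); on suitable copies approaching the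
face, `A` converges almost everywhere to its trace, and continuity of `frobF` with Fatou's lemma
transfers the `F(A)` bound to the face (`lintegral_frobF_trace_le`). This avoids any trace theory
for `F(A)`.

The two local estimates are `ConeFace.exists_lintegral_phiShift_le`. Their constants depend on a
cell only through the ratio of its diameter to the radius of a ball inside it. They are summed using
`h_K ≤ h` and the fact that a cell has `d + 1` faces. -/

lemma phiDeriv_nonneg {p b t : ℝ} (hb : 0 ≤ b) (ht : 0 ≤ t) : 0 ≤ phiDeriv p b t :=
  mul_nonneg (Real.rpow_nonneg (by linarith) _) ht

/-- Writing `(b + t)^(p-2) t = (b + t)^(p-1) · t/(b + t)` exhibits two increasing factors, also when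
`p < 2`. -/
lemma phiDeriv_mono {p b s t : ℝ} (hp : 1 < p) (hb : 0 ≤ b) (hs : 0 ≤ s) (hst : s ≤ t) :
    phiDeriv p b s ≤ phiDeriv p b t := by
  unfold phiDeriv
  rcases hs.eq_or_lt with rfl | hs'
  · simpa [phiDeriv] using phiDeriv_nonneg (p := p) hb hst
  have h1 : ∀ u, 0 < u → (b + u) ^ (p - 2) * u = (b + u) ^ (p - 1) * (u / (b + u)) := by
    intro u hu
    have : (b + u) ^ (p - 1) = (b + u) ^ (p - 2) * (b + u) := by
      rw [← Real.rpow_add_one (by positivity)]; ring_nf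
    rw [this]; field_simp
  rw [h1 s hs', h1 t (hs'.trans_le hst)]
  have ht : 0 < t := hs'.trans_le hst
  gcongr ?_ * ?_
  · exact Real.rpow_le_rpow (by positivity) (by linarith) (by linarith)
  · rw [div_le_div_iff₀ (by positivity) (by positivity)]
    nlinarith

/-- The doubling property, uniform in `b`. For `p ≥ 2` it follows from `b + l t ≤ l (b + t)`, and
for `p ≤ 2` from the power being decreasing. -/
lemma phiDeriv_mul_le {p b t l : ℝ} (hp : 1 < p) (hb : 0 ≤ b) (ht : 0 ≤ t) (hl : 1 ≤ l) :
    phiDeriv p b (l * t) ≤ l ^ p * phiDeriv p b t := by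
  unfold phiDeriv
  rcases ht.eq_or_lt with rfl | ht
  · simp
  have hl0 : 0 < l := by linarith
  have hlp : l ^ p = l ^ (p - 1) * l := by
    rw [← Real.rpow_add_one (by positivity)]; ring_nf
  have h1 : 1 ≤ l ^ (p - 1) := Real.one_le_rpow hl (by linarith)
  have key : (b + l * t) ^ (p - 2) ≤ l ^ (p - 1) * (b + t) ^ (p - 2) := by
    rcases le_total 2 p with h | h
    · calc (b + l * t) ^ (p - 2) ≤ (l * (b + t)) ^ (p - 2) :=
            Real.rpow_le_rpow (by positivity) (by nlinarith) (by linarith)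
        _ = l ^ (p - 2) * (b + t) ^ (p - 2) := Real.mul_rpow (by positivity) (by positivity)
        _ ≤ _ := mul_le_mul_of_nonneg_right
            (Real.rpow_le_rpow_of_exponent_le hl (by linarith)) (by positivity)
    · calc (b + l * t) ^ (p - 2) ≤ (b + t) ^ (p - 2) :=
            Real.rpow_le_rpow_of_nonpos (by positivity) (by nlinarith) (by linarith)
        _ ≤ _ := le_mul_of_one_le_left (by positivity) h1
  calc (b + l * t) ^ (p - 2) * (l * t) ≤ (l ^ (p - 1) * (b + t) ^ (p - 2)) * (l * t) := by gcongr
    _ = _ := by rw [hlp]; ring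

/-- The factor `a + s` cancels, so shifting by `a` amounts to replacing `δ` by `δ + a`. All later
bounds are therefore stated for `phiDeriv p b` with `b = δ + a`. -/
lemma phiShift_eq {p δ a t : ℝ} (ha : 0 ≤ a) (ht : 0 ≤ t) :
    phiShift p δ a t = ∫ s in (0 : ℝ)..t, phiDeriv p (δ + a) s := by
  unfold phiShift
  refine intervalIntegral.integral_congr_ae (Eventually.of_forall fun s hs => ?_)
  rw [Set.uIoc_of_le ht] at hs
  have : 0 < a + s := by linarith [hs.1]
  unfold phiDeriv
  rw [← add_assoc]
  field_simp

lemma phiDeriv_intervalIntegrable {p b s t : ℝ} (hp : 1 < p) (hb : 0 ≤ b) (hs : 0 ≤ s)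
    (ht : 0 ≤ t) : IntervalIntegrable (phiDeriv p b) volume s t := by
  refine MonotoneOn.intervalIntegrable fun x hx y _ hxy => phiDeriv_mono hp hb ?_ hxy
  exact (le_min hs ht).trans hx.1

lemma phiShift_le {p δ a t : ℝ} (hp : 1 < p) (hδ : 0 ≤ δ) (ha : 0 ≤ a) (ht : 0 ≤ t) :
    phiShift p δ a t ≤ phiDeriv p (δ + a) t * t := by
  rw [phiShift_eq ha ht]
  calc ∫ s in (0 : ℝ)..t, phiDeriv p (δ + a) s ≤ ∫ _ in (0 : ℝ)..t, phiDeriv p (δ + a) t :=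
        intervalIntegral.integral_mono_on ht
          (phiDeriv_intervalIntegrable hp (by positivity) le_rfl ht) (by simp)
          fun s hs => phiDeriv_mono hp (by positivity) hs.1 hs.2
    _ = _ := by simp [mul_comm]

/-- Only the half `[t/2, t]` of the interval is kept. There the integrand is at least its value at
`t/2`, which doubling compares with its value at `t`. -/
lemma le_phiShift {p δ a t : ℝ} (hp : 1 < p) (hδ : 0 ≤ δ) (ha : 0 ≤ a) (ht : 0 ≤ t) :
    phiDeriv p (δ + a) t * t ≤ 2 ^ (p + 1) * phiShift p δ a t := by
  rw [phiShift_eq ha ht]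
  have hb : 0 ≤ δ + a := by positivity
  have h2 : 0 ≤ t / 2 := by positivity
  have e : ∫ s in (0 : ℝ)..t, phiDeriv p (δ + a) s =
      (∫ s in (0 : ℝ)..(t / 2), phiDeriv p (δ + a) s) + ∫ s in (t / 2)..t, phiDeriv p (δ + a) s :=
    (intervalIntegral.integral_add_adjacent_intervals
      (phiDeriv_intervalIntegrable hp hb le_rfl h2) (phiDeriv_intervalIntegrable hp hb h2 ht)).symm
  have h0 : 0 ≤ ∫ s in (0 : ℝ)..(t / 2), phiDeriv p (δ + a) s :=
    intervalIntegral.integral_nonneg h2 fun s hs => phiDeriv_nonneg hb hs.1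
  have h1 : ∫ _ in (t / 2)..t, phiDeriv p (δ + a) (t / 2) ≤
      ∫ s in (t / 2)..t, phiDeriv p (δ + a) s :=
    intervalIntegral.integral_mono_on (by linarith) (by simp)
      (phiDeriv_intervalIntegrable hp hb h2 ht) fun s hs => phiDeriv_mono hp hb h2 hs.1
  have h3 := phiDeriv_mul_le hp hb h2 (one_le_two : (1 : ℝ) ≤ 2)
  rw [mul_div_cancel₀ t two_ne_zero] at h3
  simp only [intervalIntegral.integral_const, smul_eq_mul] at h1
  rw [Real.rpow_add_one two_ne_zero, e]
  have h4 : (0 : ℝ) < 2 ^ p := by positivity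
  calc phiDeriv p (δ + a) t * t ≤ (2 ^ p * phiDeriv p (δ + a) (t / 2)) * t := by gcongr
    _ = 2 ^ p * 2 * ((t - t / 2) * phiDeriv p (δ + a) (t / 2)) := by ring
    _ ≤ _ := by gcongr; linarith

/-- The scalar function with `|F(A)| = frobF p δ |A|` for symmetric `A`. -/
def frobF (p δ a : ℝ) : ℝ := (δ + a) ^ ((p - 2) / 2) * a

/-- When the gap `D = M - m` is at least a third of `δ + M`, the difference of the values of `frobF`
is of order at least `D^(p/2)`. This is the regime in which a shift cannot be exchanged for free. -/
lemma frobF_sub_sq_ge {p δ m M : ℝ} (hp : 1 < p) (hδ : 0 ≤ δ) (hm : 0 ≤ m) (hmM : m < M)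
    (hM : δ + M ≤ 3 * (M - m)) :
    (M - m) ^ (p - 2) * (M - m) ^ 2 ≤ 36 * (frobF p δ M - frobF p δ m) ^ 2 := by
  set D := M - m with hD
  have hD0 : 0 < D := by linarith
  have e : D ^ (p - 2) = (D ^ ((p - 2) / 2)) ^ 2 := by
    rw [← Real.rpow_natCast, ← Real.rpow_mul hD0.le]; norm_num
  suffices h : D ^ ((p - 2) / 2) * D ≤ 6 * (frobF p δ M - frobF p δ m) by
    rw [e]
    have h0 : 0 ≤ D ^ ((p - 2) / 2) * D := by positivity
    nlinarith
  unfold frobF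
  set q := (p - 2) / 2 with hq
  have hX : 0 < δ + M := by linarith
  rcases le_total 2 p with h | h
  · have hq0 : 0 ≤ q := by rw [hq]; linarith
    have h1 : (δ + m) ^ q ≤ (δ + M) ^ q := Real.rpow_le_rpow (by positivity) (by linarith) hq0
    have h2 : D ^ q ≤ (δ + M) ^ q := Real.rpow_le_rpow hD0.le (by linarith) hq0
    have h3 : (δ + m) ^ q * m ≤ (δ + M) ^ q * m := by gcongr
    have h4 : D ^ q * D ≤ (δ + M) ^ q * D := by gcongr
    have h5 : (δ + M) ^ q * D = (δ + M) ^ q * M - (δ + M) ^ q * m := by rw [hD]; ring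
    have h6 : 0 ≤ D ^ q * D := by positivity
    linarith
  · have hq0 : q ≤ 0 := by rw [hq]; linarith
    have hq1 : 1 / 2 ≤ q + 1 := by rw [hq]; linarith
    set X := δ + M with hXd
    have h3 : D ^ q ≤ 3 * X ^ q := by
      have : (3 * D) ^ q ≤ X ^ q := Real.rpow_le_rpow_of_nonpos hX hM hq0
      rw [Real.mul_rpow (by norm_num) hD0.le] at this
      have h33 : (1 / 3 : ℝ) ≤ 3 ^ q := by
        calc (1 / 3 : ℝ) = 3 ^ (-1 : ℝ) := by rw [Real.rpow_neg_one]; norm_num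
          _ ≤ 3 ^ q := Real.rpow_le_rpow_of_exponent_le (by norm_num) (by linarith)
      have h34 : 0 ≤ D ^ q := by positivity
      nlinarith
    -- With `ρ = Y/X ≤ 1` and `q + 1 = p/2 ≥ 1/2`, one has `ρ^(q+1) ≤ √ρ ≤ (1 + ρ)/2`. This gives
    -- half of the gap; the factor 3 in `h3` and this 2 produce 6, whose square is 36.
    have h4 : (δ + m) ^ q * m ≤ X ^ q * M - X ^ q * D / 2 := by
      rcases hm.eq_or_lt with rfl | hm'
      · have : 0 ≤ X ^ q * D := by positivity
        rw [hD] at *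
        simp only [mul_zero, sub_zero] at *
        linarith
      have hY : 0 < δ + m := by linarith
      set Y := δ + m with hYd
      have hYX : Y ≤ X := by linarith
      have h5 : X ^ q ≤ Y ^ q := Real.rpow_le_rpow_of_nonpos hY hYX hq0
      have hρ : Y ^ q * Y ≤ X ^ q * ((X + Y) / 2) := by
        have hr : (Y / X) ^ (q + 1) ≤ (1 + Y / X) / 2 := by
          calc (Y / X) ^ (q + 1) ≤ (Y / X) ^ (1 / 2 : ℝ) :=
                Real.rpow_le_rpow_of_exponent_ge (by positivity)
                  ((div_le_one hX).2 hYX) hq1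
            _ = √(Y / X) := (Real.sqrt_eq_rpow _).symm
            _ ≤ _ := by
                have := Real.sq_sqrt (show 0 ≤ Y / X by positivity)
                nlinarith [sq_nonneg (√(Y / X) - 1)]
        rw [Real.div_rpow hY.le hX.le, Real.rpow_add_one hY.ne', Real.rpow_add_one hX.ne',
          div_le_iff₀ (by positivity)] at hr
        calc Y ^ q * Y ≤ _ := hr
          _ = _ := by field_simp
      have h6 : δ * X ^ q ≤ δ * Y ^ q := by gcongr
      have e1 : m = Y - δ := by rw [hYd]; ring
      have e2 : M = X - δ := by rw [hXd]; ring
      have e3 : D = X - Y := by rw [hXd, hYd, hD]; ring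
      rw [e3, e1, e2]
      nlinarith
    have h7 : D ^ q * D ≤ 3 * X ^ q * D := by gcongr
    nlinarith

/-- The change of shift. -/
lemma phiDeriv_shift_le {p δ a a' t : ℝ} (hp : 1 < p) (hδ : 0 ≤ δ) (ha : 0 ≤ a) (ha' : 0 ≤ a')
    (ht : 0 ≤ t) :
    phiDeriv p (δ + a) t * t ≤ (144 * 5 ^ p) * (phiDeriv p (δ + a') t * t) +
      (144 * 5 ^ p) * (frobF p δ a - frobF p δ a') ^ 2 := by
  rcases ht.eq_or_lt with rfl | ht
  · simp only [phiDeriv, mul_zero, zero_add]; positivity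
  have h5 : (1 : ℝ) ≤ 5 ^ p := Real.one_le_rpow (by norm_num) (by linarith)
  -- If the shifts are close relative to `δ + a' + t`, the two weights are comparable and no error
  -- term is needed. Otherwise `t ≤ 2D` and `δ + a' ≤ 2D` with `D = |a - a'|`, so the left side is
  -- at most a multiple of `D^p`, which the difference of `frobF` controls.
  rcases le_or_gt |a - a'| ((δ + a' + t) / 2) with h | h
  · have hl := (abs_le.1 h)
    have h1 : (δ + a + t) ^ (p - 2) ≤ 5 ^ p * (δ + a' + t) ^ (p - 2) := by
      rcases le_total 2 p with h2 | h2
      · calc (δ + a + t) ^ (p - 2) ≤ (5 * (δ + a' + t)) ^ (p - 2) :=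
              Real.rpow_le_rpow (by positivity) (by linarith) (by linarith)
          _ = 5 ^ (p - 2) * (δ + a' + t) ^ (p - 2) := Real.mul_rpow (by norm_num) (by positivity)
          _ ≤ _ := by gcongr <;> norm_num
      · calc (δ + a + t) ^ (p - 2) ≤ (5⁻¹ * (δ + a' + t)) ^ (p - 2) :=
              Real.rpow_le_rpow_of_nonpos (by positivity) (by linarith) (by linarith)
          _ = 5 ^ (2 - p) * (δ + a' + t) ^ (p - 2) := by
              rw [Real.mul_rpow (by norm_num) (by positivity), Real.inv_rpow (by norm_num),
                ← Real.rpow_neg (by norm_num)]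
              ring_nf
          _ ≤ _ := by
              gcongr
              · norm_num
              · linarith
    have h2 : 0 ≤ (δ + a' + t) ^ (p - 2) * t * t := by positivity
    unfold phiDeriv
    calc (δ + a + t) ^ (p - 2) * t * t ≤ (5 ^ p * (δ + a' + t) ^ (p - 2)) * t * t := by gcongr
      _ = 5 ^ p * ((δ + a' + t) ^ (p - 2) * t * t) := by ring
      _ ≤ (144 * 5 ^ p) * ((δ + a' + t) ^ (p - 2) * t * t) := by gcongr; linarith
      _ ≤ _ := le_add_of_nonneg_right (by positivity)
  · set D := |a - a'| with hD
    have hD0 : 0 < D := by linarith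
    have hab : a ≤ a' + D := by have := le_abs_self (a - a'); linarith
    have key : D ^ (p - 2) * D ^ 2 ≤ 36 * (frobF p δ a - frobF p δ a') ^ 2 := by
      rcases lt_or_ge a' a with h1 | h1
      · have e : D = a - a' := abs_of_pos (by linarith)
        rw [e] at h ⊢
        exact frobF_sub_sq_ge hp hδ ha' h1 (by linarith)
      · have e : D = a' - a := by rw [hD, abs_of_nonpos (by linarith)]; ring
        have h2 : a < a' := by linarith
        rw [e] at h ⊢
        have := frobF_sub_sq_ge hp hδ ha h2 (by linarith)
        linarith [sq_abs (frobF p δ a - frobF p δ a'), neg_sq (frobF p δ a - frobF p δ a'),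
          neg_sub (frobF p δ a) (frobF p δ a'), this,
          show (frobF p δ a' - frobF p δ a) ^ 2 = (frobF p δ a - frobF p δ a') ^ 2 by ring]
    have h1 : phiDeriv p (δ + a) t * t ≤ phiDeriv p (δ + a) (2 * D) * (2 * D) := by
      have := phiDeriv_mono hp (b := δ + a) (by positivity) ht.le (show t ≤ 2 * D by linarith)
      have h0 := phiDeriv_nonneg (p := p) (b := δ + a) (by positivity) ht.le
      gcongr
      · exact h0.trans this
      · linarith
    have h2 : (δ + a + 2 * D) ^ (p - 2) ≤ 5 ^ p * D ^ (p - 2) := by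
      rcases le_total 2 p with h2 | h2
      · calc (δ + a + 2 * D) ^ (p - 2) ≤ (5 * D) ^ (p - 2) :=
              Real.rpow_le_rpow (by positivity) (by linarith) (by linarith)
          _ = 5 ^ (p - 2) * D ^ (p - 2) := Real.mul_rpow (by norm_num) (by positivity)
          _ ≤ _ := by gcongr <;> norm_num
      · calc (δ + a + 2 * D) ^ (p - 2) ≤ D ^ (p - 2) :=
              Real.rpow_le_rpow_of_nonpos (by positivity) (by linarith) (by linarith)
          _ ≤ _ := le_mul_of_one_le_left (by positivity) h5
    have h3 : 0 ≤ phiDeriv p (δ + a') t * t :=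
      mul_nonneg (phiDeriv_nonneg (by positivity) ht.le) ht.le
    calc phiDeriv p (δ + a) t * t ≤ _ := h1
      _ = (δ + a + 2 * D) ^ (p - 2) * (4 * D ^ 2) := by unfold phiDeriv; ring
      _ ≤ (5 ^ p * D ^ (p - 2)) * (4 * D ^ 2) := by gcongr
      _ = 4 * 5 ^ p * (D ^ (p - 2) * D ^ 2) := by ring
      _ ≤ 4 * 5 ^ p * (36 * (frobF p δ a - frobF p δ a') ^ 2) := by gcongr
      _ = (144 * 5 ^ p) * (frobF p δ a - frobF p δ a') ^ 2 := by ring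
      _ ≤ _ := le_add_of_nonneg_left (by positivity)

/-- For `δ = 0` and `p < 2` the power is singular at zero, but the product is `a^(p/2)`. Continuity
up to zero is what allows passing to the trace of `A`. -/
lemma continuousOn_frobF {p δ : ℝ} (hp : 1 < p) (hδ : 0 ≤ δ) :
    ContinuousOn (frobF p δ) (Set.Ici 0) := by
  rcases hδ.eq_or_lt with rfl | hδ
  · have : ContinuousOn (fun a : ℝ => a ^ (p / 2)) (Set.Ici 0) :=
      (Real.continuous_rpow_const (by linarith)).continuousOn
    refine this.congr fun a ha => ?_
    rcases (show (0 : ℝ) ≤ a from ha).eq_or_lt with rfl | ha'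
    · simp [frobF, Real.zero_rpow (show p / 2 ≠ 0 by linarith)]
    · simp only [frobF, zero_add]
      rw [← Real.rpow_add_one ha'.ne']; ring_nf
  · unfold frobF
    refine ContinuousOn.mul (ContinuousOn.rpow_const (by fun_prop) fun a ha => ?_) (by fun_prop)
    left
    have : (0 : ℝ) ≤ a := ha
    positivity

/-! ### Norm equivalence for polynomials -/

/-- Every linear functional on a finite-dimensional space is bounded for the norm of any inner
product. -/
lemma linearFunctional_sq_le {V : Type*} [AddCommGroup V] [Module ℝ V] [FiniteDimensional ℝ V]
    (c : InnerProductSpace.Core ℝ V) (l : V →ₗ[ℝ] ℝ) :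
    ∃ C : ℝ, 0 ≤ C ∧ ∀ v, l v ^ 2 ≤ C * c.inner v v := by
  let : NormedAddCommGroup V := c.toNormedAddCommGroup
  let : InnerProductSpace ℝ V := InnerProductSpace.ofCore c.toCore
  refine ⟨‖LinearMap.toContinuousLinearMap l‖ ^ 2, by positivity, fun v => ?_⟩
  have h1 := (LinearMap.toContinuousLinearMap l).le_opNorm v
  have h2 : c.inner v v = ‖v‖ ^ 2 := (real_inner_self_eq_norm_sq v)
  rw [h2, ← mul_pow, ← sq_abs]
  exact pow_le_pow_left₀ (abs_nonneg _) h1 2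

/-- The polynomial function on `ℝᵈ` given by `P`. -/
def peval {d : ℕ} (P : MvPolynomial (Fin d) ℝ) (x : Eu d) : ℝ :=
  MvPolynomial.eval (fun j => x j) P

lemma contDiff_peval {d : ℕ} (P : MvPolynomial (Fin d) ℝ) : ContDiff ℝ ∞ (peval P) := by
  have e : peval P = fun x => ∑ m ∈ P.support, P.coeff m * ∏ i, x i ^ m i :=
    funext fun x => MvPolynomial.eval_eq' _ _
  rw [e]
  fun_prop

/-- The polynomial vanishes on the ball by continuity, hence on a product of intervals, and a
polynomial vanishing on a product of infinite sets is zero. This makes the `L²` form on the unit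
ball definite. -/
lemma eq_zero_of_integral_peval_sq {d : ℕ} (P : MvPolynomial (Fin d) ℝ)
    (h : ∫ x in Metric.ball (0 : Eu d) 1, peval P x * peval P x = 0) : P = 0 := by
  have hc : Continuous (peval P) := (contDiff_peval P).continuous
  have hint : IntegrableOn (fun x => peval P x * peval P x) (Metric.ball (0 : Eu d) 1) :=
    ((hc.mul hc).continuousOn.integrableOn_compact (isCompact_closedBall 0 1)).mono_set
      Metric.ball_subset_closedBall
  have h0 : ∀ x ∈ Metric.ball (0 : Eu d) 1, peval P x * peval P x = 0 := by
    have h1 := (setIntegral_eq_zero_iff_of_nonneg_ae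
      (Eventually.of_forall fun x => mul_self_nonneg _) hint).1 h
    have h2 : Set.EqOn (fun x => peval P x * peval P x) (fun _ => 0) (Metric.ball (0 : Eu d) 1) :=
      Measure.eqOn_open_of_ae_eq h1 Metric.isOpen_ball (hc.mul hc).continuousOn continuousOn_const
    exact h2
  obtain ⟨ε, hε, hball⟩ : ∃ ε > 0, ∀ v : Fin d → ℝ, (∀ i, v i ∈ Set.Ioo (-ε) ε) →
      WithLp.toLp 2 v ∈ Metric.ball (0 : Eu d) 1 := by
    have hopen : IsOpen ((fun v : Fin d → ℝ => (WithLp.toLp 2 v : Eu d)) ⁻¹'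
        Metric.ball (0 : Eu d) 1) :=
      Metric.isOpen_ball.preimage (PiLp.continuous_toLp 2 _)
    obtain ⟨ε, hε, h⟩ := Metric.isOpen_iff.1 hopen 0 (by simp)
    refine ⟨ε, hε, fun v hv => h ?_⟩
    rw [mem_ball_zero_iff, pi_norm_lt_iff hε]
    exact fun i => abs_lt.2 (hv i)
  refine MvPolynomial.funext_set (fun _ => Set.Ioo (-ε) ε)
    (fun _ => Set.Ioo_infinite (by linarith)) fun x hx => ?_
  have := h0 _ (hball x fun i => hx i trivial)
  simpa [peval] using this

/-- In a basis of the polynomials of degree at most `k`, the coordinates are functionals bounded by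
the `L²` norm on the unit ball, while the basis elements and their derivatives are bounded on the
compact ball of radius `R`. -/
lemma peval_sq_le_unit (d k : ℕ) (R : ℝ) : ∃ C : ℝ, 0 ≤ C ∧ ∀ P : MvPolynomial (Fin d) ℝ,
    P.totalDegree ≤ k → ∀ x ∈ Metric.closedBall (0 : Eu d) R,
      peval P x ^ 2 ≤ C * ∫ y in Metric.ball (0 : Eu d) 1, peval P y ^ 2 ∧
      ∀ j, fderiv ℝ (peval P) x (EuclideanSpace.single j 1) ^ 2 ≤
        C * ∫ y in Metric.ball (0 : Eu d) 1, peval P y ^ 2 := by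
  set V := MvPolynomial.restrictTotalDegree (Fin d) ℝ k with hV
  have hcont (P : MvPolynomial (Fin d) ℝ) : Continuous (peval P) := (contDiff_peval P).continuous
  have hint (P Q : MvPolynomial (Fin d) ℝ) :
      IntegrableOn (fun x => peval P x * peval Q x) (Metric.ball (0 : Eu d) 1) :=
    (((hcont P).mul (hcont Q)).continuousOn.integrableOn_compact (isCompact_closedBall 0 1)).mono_set
      Metric.ball_subset_closedBall
  let core : InnerProductSpace.Core ℝ V :=
    { inner := fun P Q => ∫ x in Metric.ball (0 : Eu d) 1, peval P.1 x * peval Q.1 x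
      conj_inner_symm := fun P Q => by simp [mul_comm]
      re_inner_nonneg := fun P => integral_nonneg fun x => mul_self_nonneg _
      add_left := fun P Q S => by
        rw [← integral_add (hint _ _) (hint _ _)]
        simp [peval, add_mul]
      smul_left := fun P Q r => by
        simp only [conj_trivial]
        rw [← integral_const_mul]
        simp [peval, mul_assoc]
      definite := fun P h => Subtype.ext (eq_zero_of_integral_peval_sq P.1 h) }
  let b := Module.finBasis ℝ V
  choose c hc0 hc using fun i => linearFunctional_sq_le core (b.coord i)
  have hM (f : Eu d → ℝ) (hf : Continuous f) :
      ∃ M : ℝ, ∀ x ∈ Metric.closedBall (0 : Eu d) R, f x ^ 2 ≤ M := by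
    obtain ⟨M, hM⟩ := ((isCompact_closedBall (0 : Eu d) R).image (hf.pow 2)).bddAbove
    exact ⟨M, fun x hx => hM ⟨x, hx, rfl⟩⟩
  have hdc (P : MvPolynomial (Fin d) ℝ) (j : Fin d) :
      Continuous fun x => fderiv ℝ (peval P) x (EuclideanSpace.single j 1) :=
    ((contDiff_peval P).continuous_fderiv (by simp)).clm_apply continuous_const
  choose M hM1 using fun i => hM _ (hcont (b i).1)
  choose N hN1 using fun i j => hM _ (hdc (b i).1 j)
  have gen (P : V) (m : Fin (Module.finrank ℝ V) → ℝ) :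
      (∑ i, b.coord i P * m i) ^ 2 ≤ ((∑ i, c i) * ∑ i, m i ^ 2) * core.inner P P := by
    calc (∑ i, b.coord i P * m i) ^ 2 ≤ (∑ i, (b.coord i P) ^ 2) * ∑ i, m i ^ 2 :=
          Finset.sum_mul_sq_le_sq_mul_sq _ _ _
      _ ≤ (∑ i, c i * core.inner P P) * ∑ i, m i ^ 2 := by
          gcongr with i
          exact hc i P
      _ = _ := by rw [← Finset.sum_mul]; ring
  have hrep (P : V) : P.1 = ∑ i, b.coord i P • (b i).1 := by
    exact (congrArg V.subtype (b.sum_repr P)).symm.trans (by rw [map_sum]; rfl)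
  have hev (P : V) : peval P.1 = fun x => ∑ i, b.coord i P * peval (b i).1 x := by
    ext x
    conv_lhs => rw [hrep P]
    simp [peval]
  have hfd (P : V) (x : Eu d) (v : Eu d) :
      fderiv ℝ (peval P.1) x v = ∑ i, b.coord i P * fderiv ℝ (peval (b i).1) x v := by
    rw [hev P]
    have : HasFDerivAt (fun x => ∑ i, b.coord i P * peval (b i).1 x)
        (∑ i, b.coord i P • fderiv ℝ (peval (b i).1) x) x :=
      HasFDerivAt.fun_sum fun i _ =>
        (((contDiff_peval (b i).1).differentiable (by simp)) x).hasFDerivAt.const_mul _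
    rw [this.fderiv]
    simp
  have hin (P : V) : core.inner P P = ∫ y in Metric.ball (0 : Eu d) 1, peval P.1 y ^ 2 := by
    simp only [pow_two]
    rfl
  have hin0 (P : V) : 0 ≤ core.inner P P := by
    rw [hin]; exact integral_nonneg fun _ => sq_nonneg _
  have hc' : 0 ≤ ∑ i, c i := Finset.sum_nonneg fun i _ => hc0 i
  refine ⟨(∑ i, c i) * (∑ i, |M i| + ∑ j, ∑ i, |N i j|), by positivity, fun P hP x hx => ?_⟩
  have hPV : P ∈ V := (MvPolynomial.mem_restrictTotalDegree _ _ _).2 hP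
  have h0 := hin0 ⟨P, hPV⟩
  rw [← hin ⟨P, hPV⟩]
  constructor
  · rw [show peval P x = _ from congrFun (hev ⟨P, hPV⟩) x]
    refine (gen _ _).trans ?_
    gcongr
    calc ∑ i, peval (b i).1 x ^ 2 ≤ ∑ i, |M i| :=
          Finset.sum_le_sum fun i _ => (hM1 i x hx).trans (le_abs_self _)
      _ ≤ _ := le_add_of_nonneg_right (by positivity)
  · intro j
    rw [hfd ⟨P, hPV⟩]
    refine (gen _ _).trans ?_
    gcongr
    calc ∑ i, fderiv ℝ (peval (b i).1) x (EuclideanSpace.single j 1) ^ 2 ≤ ∑ i, |N i j| :=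
          Finset.sum_le_sum fun i _ => (hN1 i j x hx).trans (le_abs_self _)
      _ ≤ ∑ j, ∑ i, |N i j| :=
          Finset.single_le_sum (f := fun j => ∑ i, |N i j|) (fun j _ => by positivity)
            (Finset.mem_univ j)
      _ ≤ _ := le_add_of_nonneg_left (by positivity)

/-- The polynomial `y ↦ P (x₀ + r y)`. -/
def polyRescale {d : ℕ} (x₀ : Eu d) (r : ℝ) (P : MvPolynomial (Fin d) ℝ) :
    MvPolynomial (Fin d) ℝ :=
  MvPolynomial.bind₁ (fun i => MvPolynomial.C (x₀ i) + MvPolynomial.C r * MvPolynomial.X i) P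

lemma peval_polyRescale {d : ℕ} (x₀ : Eu d) (r : ℝ) (P : MvPolynomial (Fin d) ℝ) (y : Eu d) :
    peval (polyRescale x₀ r P) y = peval P (x₀ + r • y) := by
  unfold peval polyRescale
  induction P using MvPolynomial.induction_on with
  | C a => simp
  | add p q hp hq => simp only [map_add, hp, hq]
  | mul_X p i hp => simp only [map_mul, hp, MvPolynomial.bind₁_X_right]; simp

lemma totalDegree_polyRescale_le {d : ℕ} (x₀ : Eu d) (r : ℝ) (P : MvPolynomial (Fin d) ℝ) :
    (polyRescale x₀ r P).totalDegree ≤ P.totalDegree := by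
  unfold polyRescale
  conv_lhs => rw [P.as_sum, map_sum]
  refine MvPolynomial.totalDegree_finsetSum_le fun m hm => ?_
  rw [MvPolynomial.bind₁_monomial]
  refine (MvPolynomial.totalDegree_mul _ _).trans ?_
  rw [MvPolynomial.totalDegree_C, zero_add]
  refine (MvPolynomial.totalDegree_finsetProd _ _).trans ?_
  refine le_trans ?_ (MvPolynomial.le_totalDegree hm)
  refine Finset.sum_le_sum fun i _ => (MvPolynomial.totalDegree_pow _ _).trans ?_
  refine (Nat.mul_le_mul_left _ ?_).trans (mul_one _).le
  refine (MvPolynomial.totalDegree_add _ _).trans (max_le (by simp) ?_)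
  exact (MvPolynomial.totalDegree_mul _ _).trans (by simp)

/-- A polynomial on a ball is controlled by its mean square on a comparable ball. -/
lemma peval_sq_le (d k : ℕ) (R : ℝ) : ∃ C : ℝ, 0 ≤ C ∧ ∀ P : MvPolynomial (Fin d) ℝ,
    P.totalDegree ≤ k → ∀ (x₀ : Eu d) (r : ℝ), 0 < r → ∀ x ∈ Metric.closedBall x₀ (R * r),
      peval P x ^ 2 ≤ C * (r ^ d)⁻¹ * ∫ y in Metric.ball x₀ r, peval P y ^ 2 ∧
      ∀ j, r ^ 2 * fderiv ℝ (peval P) x (EuclideanSpace.single j 1) ^ 2 ≤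
        C * (r ^ d)⁻¹ * ∫ y in Metric.ball x₀ r, peval P y ^ 2 := by
  obtain ⟨C, hC0, hC⟩ := peval_sq_le_unit d k R
  refine ⟨C, hC0, fun P hP x₀ r hr x hx => ?_⟩
  -- The affine map from the unit ball contributes `r^(-d)` here, and by the chain rule the factor
  -- `r` to each derivative below.
  have hint : ∫ y in Metric.ball (0 : Eu d) 1, peval (polyRescale x₀ r P) y ^ 2 =
      (r ^ d)⁻¹ * ∫ y in Metric.ball x₀ r, peval P y ^ 2 := by
    simp_rw [peval_polyRescale]
    have h1 := Measure.setIntegral_comp_smul_of_pos (volume : Measure (Eu d))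
      (fun y => peval P (x₀ + y) ^ 2) (Metric.ball (0 : Eu d) 1) hr
    rw [h1, smul_eq_mul, finrank_euclideanSpace_fin, smul_unitBall_of_pos hr]
    congr 1
    have h2 := (measurePreserving_add_left (volume : Measure (Eu d)) x₀).setIntegral_preimage_emb
      (MeasurableEquiv.addLeft x₀).measurableEmbedding (fun y => peval P y ^ 2) (Metric.ball x₀ r)
    rw [← h2]
    congr 2
    ext y
    simp
  set y := r⁻¹ • (x - x₀) with hy
  have hxy : x = x₀ + r • y := by rw [hy, smul_inv_smul₀ hr.ne']; abel
  have hyR : y ∈ Metric.closedBall (0 : Eu d) R := by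
    rw [mem_closedBall_zero_iff, hy, norm_smul, norm_inv, Real.norm_of_nonneg hr.le,
      inv_mul_le_iff₀ hr, mul_comm, ← dist_eq_norm]
    exact hx
  have h := hC _ ((totalDegree_polyRescale_le x₀ r P).trans hP) y hyR
  rw [hint, peval_polyRescale, ← hxy, ← mul_assoc] at h
  refine ⟨h.1, fun j => ?_⟩
  have h2 := h.2 j
  have : HasFDerivAt (peval (polyRescale x₀ r P))
      ((fderiv ℝ (peval P) x).comp (r • ContinuousLinearMap.id ℝ (Eu d))) y := by
    have e : peval (polyRescale x₀ r P) = fun y => peval P (x₀ + r • y) :=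
      funext fun y => peval_polyRescale x₀ r P y
    rw [e]
    have h3 : HasFDerivAt (fun y : Eu d => x₀ + r • y) (r • ContinuousLinearMap.id ℝ (Eu d)) y :=
      HasFDerivAt.const_add x₀ ((hasFDerivAt_id (𝕜 := ℝ) y).const_smul r)
    have h4 : HasFDerivAt (peval P) (fderiv ℝ (peval P) x) (x₀ + r • y) := by
      rw [← hxy]
      exact ((contDiff_peval P).differentiable (by simp) x).hasFDerivAt
    exact h4.comp y h3
  rw [this.fderiv] at h2
  simpa [mul_pow] using h2

/-! ### Slices by hyperplanes and cones -/

/-- The contraction towards `y₀` with ratio `1 - t`. -/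
def shrink {d : ℕ} (y₀ : Eu d) (t : ℝ) (x : Eu d) : Eu d := y₀ + (1 - t) • (x - y₀)

lemma shrink_eq_homothety {d : ℕ} (y₀ : Eu d) (t : ℝ) :
    shrink y₀ t = AffineMap.homothety y₀ (1 - t) := by
  ext1 x
  simp [shrink, AffineMap.homothety_apply, add_comm]

@[fun_prop]
lemma continuous_shrink_uncurry {d : ℕ} (y₀ : Eu d) :
    Continuous fun q : Eu d × ℝ => shrink y₀ q.2 q.1 := by
  unfold shrink; fun_prop

@[fun_prop]
lemma continuous_shrink {d : ℕ} (y₀ : Eu d) (t : ℝ) : Continuous (shrink y₀ t) := by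
  unfold shrink; fun_prop

lemma shrink_mem {d : ℕ} {S : Set (Eu d)} (hS : Convex ℝ S) {y₀ x : Eu d} (hy : y₀ ∈ S)
    (hx : x ∈ S) {t : ℝ} (h0 : 0 ≤ t) (h1 : t ≤ 1) : shrink y₀ t x ∈ S := by
  have := hS hy hx h0 (sub_nonneg.2 h1) (by ring)
  convert this using 1
  unfold shrink; module

/-- Cavalieri's principle in direction `n`. It serves both to compare faces with volumes and to
bound the volume of a simplex. -/
lemma volume_eq_lintegral_slices {d : ℕ} {n : Eu d} (hn : ‖n‖ = 1) {E : Set (Eu d)}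
    (hE : MeasurableSet E) :
    volume E = ∫⁻ s : ℝ, μHE[d - 1] (E ∩ {x | inner ℝ n x = s}) := by
  have hn0 : n ≠ 0 := by rintro rfl; simp at hn
  have h := EuclideanGeometry.euclideanHausdorffMeasure_eq_lintegral (0 : Eu d) hn0 hE
  have hne : ‖n‖ₑ = 1 := by rw [← ofReal_norm, hn]; simp
  rw [InnerProductSpace.euclideanHausdorffMeasure_eq_volume, finrank_euclideanSpace_fin, hne,
    one_mul] at h
  rw [h]
  congr 1 with s
  congr 2
  ext x
  have hnn : inner ℝ n n = (1 : ℝ) := by rw [real_inner_self_eq_norm_sq, hn]; norm_num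
  simp only [vadd_eq_add, add_zero, SetLike.mem_coe, AffineSubspace.mem_mk', vsub_eq_sub,
    Submodule.mem_orthogonal_singleton_iff_inner_right, inner_sub_right, inner_smul_right, hnn,
    mul_one, sub_eq_zero, Set.mem_ofPred_eq]

/-- The hyperplane is an isometric copy of the orthogonal complement of `n`, where this Hausdorff
measure is the Lebesgue measure. -/
lemma hausdorff_lt_top_of_compact {d : ℕ} {n : Eu d} (hn : ‖n‖ = 1) {α : ℝ} {G : Set (Eu d)}
    (hG : IsCompact G) (h : ∀ x ∈ G, inner ℝ n x = α) : μHE[d - 1] G < ⊤ := by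
  rcases G.eq_empty_or_nonempty with rfl | ⟨x₀, hx₀⟩
  · simp
  have hn0 : n ≠ 0 := by rintro rfl; simp at hn
  set U := (ℝ ∙ n)ᗮ
  have hr : Module.finrank ℝ U = d - 1 := by
    have h1 : _ + Module.finrank ℝ U = _ := (ℝ ∙ n).finrank_add_finrank_orthogonal
    rw [finrank_span_singleton hn0, finrank_euclideanSpace_fin] at h1
    omega
  let f : U → Eu d := fun u => u + x₀
  have hf : Isometry f := (isometry_add_right x₀).comp isometry_subtype_coe
  have hGf : f '' (f ⁻¹' G) = G := by
    refine Set.image_preimage_eq_of_subset fun x hx => ⟨⟨x - x₀, ?_⟩, by simp [f]⟩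
    rw [Submodule.mem_orthogonal_singleton_iff_inner_right, inner_sub_right, h x hx, h x₀ hx₀,
      sub_self]
  have hc : IsCompact (f ⁻¹' G) := hf.isClosedEmbedding.isCompact_preimage hG
  rw [← hGf, hf.euclideanHausdorffMeasure_image, ← hr,
    InnerProductSpace.euclideanHausdorffMeasure_eq_volume]
  exact hc.measure_lt_top

/-- A compact convex set `S` with a flat face `G`, in the hyperplane `⟨n, x⟩ = α`, containing a
ball around `y₀` of radius `r`, and of diameter at most `h`. -/
structure ConeFace {d : ℕ} (S G : Set (Eu d)) (n y₀ : Eu d) (α r h : ℝ) : Prop where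
  compS : IsCompact S
  convS : Convex ℝ S
  compG : IsCompact G
  sub : G ⊆ S
  norm_n : ‖n‖ = 1
  onG : ∀ x ∈ G, inner ℝ n x = α
  onS : ∀ x ∈ S, inner ℝ n x ≤ α
  ball : Metric.ball y₀ r ⊆ S
  r_pos : 0 < r
  dist_le : ∀ x ∈ S, ∀ y ∈ S, dist x y ≤ h
  vol_le : volume S ≤ ENNReal.ofReal h * μHE[d - 1] G

namespace ConeFace

variable {d : ℕ} {S G : Set (Eu d)} {n y₀ : Eu d} {α r h : ℝ}

lemma center_mem (H : ConeFace S G n y₀ α r h) : y₀ ∈ S := H.ball (Metric.mem_ball_self H.r_pos)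

/-- The ball around `y₀` reaches up to distance `r` in direction `n` and must stay below the
hyperplane of the face. -/
lemma le_height (H : ConeFace S G n y₀ α r h) : r ≤ α - inner ℝ n y₀ := by
  refine le_of_forall_lt fun ρ hρ => ?_
  obtain ⟨ρ', h1, h2⟩ := exists_between (max_lt hρ H.r_pos)
  have h3 : y₀ + ρ' • n ∈ S := H.ball (by
    rw [mem_ball_iff_norm, add_sub_cancel_left, norm_smul, H.norm_n, mul_one,
      Real.norm_of_nonneg ((le_max_right _ _).trans h1.le)]
    exact h2)
  have h4 := H.onS _ h3
  rw [inner_add_right, inner_smul_right, real_inner_self_eq_norm_sq, H.norm_n] at h4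
  have := (le_max_left ρ 0).trans_lt h1
  linarith

lemma r_le_h (H : ConeFace S G n y₀ α r h) : r ≤ h := by
  refine le_of_forall_lt fun ρ hρ => ?_
  obtain ⟨ρ', h1, h2⟩ := exists_between (max_lt hρ H.r_pos)
  have h3 : y₀ + ρ' • n ∈ S := H.ball (by
    rw [mem_ball_iff_norm, add_sub_cancel_left, norm_smul, H.norm_n, mul_one,
      Real.norm_of_nonneg ((le_max_right _ _).trans h1.le)]
    exact h2)
  have h4 := H.dist_le _ h3 _ H.center_mem
  rw [dist_eq_norm, add_sub_cancel_left, norm_smul, H.norm_n, mul_one,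
      Real.norm_of_nonneg ((le_max_right _ _).trans h1.le)] at h4
  exact ((le_max_left ρ 0).trans_lt h1).trans_le h4

lemma h_pos (H : ConeFace S G n y₀ α r h) : 0 < h := H.r_pos.trans_le H.r_le_h

lemma hausdorff_lt_top (H : ConeFace S G n y₀ α r h) : μHE[d - 1] G < ⊤ :=
  hausdorff_lt_top_of_compact H.norm_n H.compG H.onG

lemma isFiniteMeasure (H : ConeFace S G n y₀ α r h) :
    IsFiniteMeasure ((μHE[d - 1] : Measure (Eu d)).restrict G) :=
  ⟨by rw [Measure.restrict_apply_univ]; exact H.hausdorff_lt_top⟩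

lemma volume_pos (H : ConeFace S G n y₀ α r h) : 0 < volume S :=
  (Metric.measure_ball_pos volume y₀ H.r_pos).trans_le (measure_mono H.ball)

lemma hausdorff_pos (H : ConeFace S G n y₀ α r h) : 0 < μHE[d - 1] G := by
  rw [pos_iff_ne_zero]
  intro h0
  have := H.vol_le
  rw [h0, mul_zero] at this
  exact H.volume_pos.not_ge this

/-- The contraction by `t` moves `G` to the level `α - η t`, where `η ≥ r` is the height of the face
above `y₀`, and reduces its measure by at most the factor `2^(d-1)` as `t < 1/2`. Integration over
the levels is Cavalieri's principle, with Jacobian `η⁻¹ ≤ r⁻¹`. Every passage from face integrals to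
volume integrals rests on this. -/
lemma lintegral_measure_shrink_preimage_le (H : ConeFace S G n y₀ α r h) {E : Set (Eu d)}
    (hE : MeasurableSet E) :
    ∫⁻ t in Set.Ioo (0 : ℝ) (1 / 2), μHE[d - 1] (G ∩ shrink y₀ t ⁻¹' E) ≤
      ENNReal.ofReal (2 ^ (d - 1) / r) * volume (E ∩ S) := by
  set η := α - inner ℝ n y₀ with hη
  have hη0 : 0 < η := H.r_pos.trans_le H.le_height
  set f : ℝ → ℝ≥0∞ := fun s => μHE[d - 1] ((E ∩ S) ∩ {x | inner ℝ n x = s}) with hf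
  have h1 : ∀ t ∈ Set.Ioo (0 : ℝ) (1 / 2), μHE[d - 1] (G ∩ shrink y₀ t ⁻¹' E) ≤
      2 ^ (d - 1) * f (α + (-η) * t) := by
    intro t ht
    have ht1 : (1 - t) ≠ 0 := by linarith [ht.2]
    have hsub : G ∩ shrink y₀ t ⁻¹' E ⊆
        shrink y₀ t ⁻¹' ((E ∩ S) ∩ {x | inner ℝ n x = α + (-η) * t}) := by
      rintro x ⟨hxG, hxE⟩
      refine ⟨⟨hxE, shrink_mem H.convS H.center_mem (H.sub hxG) ht.1.le (by linarith [ht.2])⟩, ?_⟩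
      simp only [shrink, Set.mem_ofPred_eq, inner_add_right, inner_smul_right, inner_sub_right,
        H.onG x hxG]
      rw [hη]; ring
    refine (measure_mono hsub).trans ?_
    rw [shrink_eq_homothety, euclideanHausdorffMeasure_homothety_preimage _ _ ht1,
      ENNReal.smul_def, smul_eq_mul]
    gcongr
    rw [ENNReal.coe_pow]
    gcongr
    have : ‖1 - t‖₊⁻¹ ≤ 2 := by
      rw [inv_le_comm₀ (by simpa using ht1) (by norm_num), ← NNReal.coe_le_coe, coe_nnnorm,
        Real.norm_of_nonneg (by linarith [ht.2])]
      simp only [NNReal.coe_inv, NNReal.coe_ofNat]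
      linarith [ht.2]
    exact_mod_cast this
  calc ∫⁻ t in Set.Ioo (0 : ℝ) (1 / 2), μHE[d - 1] (G ∩ shrink y₀ t ⁻¹' E)
      ≤ ∫⁻ t in Set.Ioo (0 : ℝ) (1 / 2), 2 ^ (d - 1) * f (α + (-η) * t) :=
        setLIntegral_mono' measurableSet_Ioo h1
    _ ≤ ∫⁻ t, 2 ^ (d - 1) * f (α + (-η) * t) := setLIntegral_le_lintegral _ _
    _ = 2 ^ (d - 1) * ∫⁻ t, f (α + (-η) * t) := lintegral_const_mul' _ _ (by simp)
    _ = 2 ^ (d - 1) * (ENNReal.ofReal η⁻¹ * ∫⁻ s, f s) := by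
        congr 1
        have e1 : ∫⁻ t, f (α + (-η) * t) = ∫⁻ s, f (α + s) ∂(Measure.map ((-η) * ·) volume) := by
          have hemb : MeasurableEmbedding (fun t : ℝ => (-η) * t) :=
            (Homeomorph.mulLeft₀ (-η) (by linarith)).measurableEmbedding
          rw [hemb.lintegral_map]
        rw [e1, Real.map_volume_mul_left (by linarith), lintegral_smul_measure,
          lintegral_add_left_eq_self, abs_inv, abs_neg, abs_of_pos hη0, smul_eq_mul]
    _ = 2 ^ (d - 1) * ENNReal.ofReal η⁻¹ * volume (E ∩ S) := by
        rw [volume_eq_lintegral_slices H.norm_n (hE.inter H.compS.measurableSet), mul_assoc]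
    _ ≤ _ := by
        gcongr
        have : (2 : ℝ≥0∞) ^ (d - 1) = ENNReal.ofReal (2 ^ (d - 1)) := by
          rw [ENNReal.ofReal_pow (by norm_num)]; simp
        rw [this, ← ENNReal.ofReal_mul (by positivity), div_eq_mul_inv]
        gcongr
        · exact H.r_pos
        · exact H.le_height

/-- The constant in the cone inequality. -/
def coneConst (d : ℕ) (r : ℝ) : ℝ≥0∞ := ENNReal.ofReal (2 ^ (d - 1) / r)

/-- The same bound as an inequality of measures, so that it can be applied to functions. -/
lemma map_shrink_le (H : ConeFace S G n y₀ α r h) :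
    Measure.map (fun q : Eu d × ℝ => shrink y₀ q.2 q.1)
      (((μHE[d - 1] : Measure (Eu d)).restrict G).prod (volume.restrict (Set.Ioo 0 (1 / 2)))) ≤
      coneConst d r • volume.restrict S := by
  have := H.isFiniteMeasure
  refine Measure.le_iff.2 fun E hE => ?_
  have hm : Measurable fun q : Eu d × ℝ => shrink y₀ q.2 q.1 :=
    (continuous_shrink_uncurry y₀).measurable
  rw [Measure.map_apply hm hE, Measure.prod_apply_symm (hm hE), Measure.smul_apply,
    Measure.restrict_apply hE, smul_eq_mul]
  refine le_trans (lintegral_mono fun t => ?_) (H.lintegral_measure_shrink_preimage_le hE)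
  rw [Measure.restrict_apply ((by fun_prop : Measurable fun x : Eu d => (x, t)) (hm hE)),
    Set.inter_comm]
  rfl

lemma lintegral_shrink_le (H : ConeFace S G n y₀ α r h) {f : Eu d → ℝ≥0∞} (hf : Measurable f) :
    ∫⁻ t in Set.Ioo (0 : ℝ) (1 / 2), ∫⁻ x in G, f (shrink y₀ t x) ∂μHE[d - 1] ≤
      coneConst d r * ∫⁻ x in S, f x := by
  have := H.isFiniteMeasure
  have hm : Measurable fun q : Eu d × ℝ => shrink y₀ q.2 q.1 :=
    (continuous_shrink_uncurry y₀).measurable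
  have h1 := lintegral_mono' H.map_shrink_le (le_refl f)
  rw [lintegral_map hf hm, lintegral_smul_measure, smul_eq_mul,
    lintegral_prod_symm' (fun q : Eu d × ℝ => f (shrink y₀ q.2 q.1)) (hf.comp hm)] at h1
  exact h1

/-- Almost every contracted copy of the face meets a given null set in a null set. This gives a
meaning to almost everywhere defined functions on these copies. -/
lemma ae_ae_shrink (H : ConeFace S G n y₀ α r h) {P : Eu d → Prop}
    (hP : ∀ᵐ x ∂(volume.restrict S), P x) :
    ∀ᵐ t ∂(volume.restrict (Set.Ioo (0 : ℝ) (1 / 2))),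
      ∀ᵐ x ∂((μHE[d - 1] : Measure (Eu d)).restrict G), P (shrink y₀ t x) := by
  have := H.isFiniteMeasure
  have hm : Measurable fun q : Eu d × ℝ => shrink y₀ q.2 q.1 :=
    (continuous_shrink_uncurry y₀).measurable
  obtain ⟨N, hN, hNm, hN0⟩ := exists_measurable_superset_of_null (ae_iff.1 hP)
  have h1 := H.lintegral_shrink_le (f := N.indicator 1) (measurable_one.indicator hNm)
  rw [lintegral_indicator_one hNm, hN0, mul_zero, nonpos_iff_eq_zero] at h1
  have hmeas : Measurable fun t : ℝ =>
      ∫⁻ x in G, N.indicator (1 : Eu d → ℝ≥0∞) (shrink y₀ t x) ∂μHE[d - 1] :=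
    Measurable.lintegral_prod_left' ((measurable_one.indicator hNm).comp hm)
  rw [lintegral_eq_zero_iff hmeas] at h1
  filter_upwards [h1] with t ht
  replace ht := (lintegral_eq_zero_iff (f := fun x => N.indicator 1 (shrink y₀ t x))
    ((measurable_one.indicator hNm).comp (continuous_shrink y₀ t).measurable)).1 ht
  filter_upwards [ht] with x hx
  by_contra hc
  have : shrink y₀ t x ∈ N := hN hc
  simp [this] at hx

lemma hausdorff_le (H : ConeFace S G n y₀ α r h) :
    μHE[d - 1] G ≤ 2 * coneConst d r * volume S := by
  have h1 := H.lintegral_shrink_le (f := fun _ => 1) measurable_const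
  simp only [lintegral_const, one_mul, Measure.restrict_apply_univ, Real.volume_Ioo, sub_zero] at h1
  calc μHE[d - 1] G = 2 * (μHE[d - 1] G * ENNReal.ofReal (1 / 2)) := by
        have : (2 : ℝ≥0∞) * ENNReal.ofReal (1 / 2) = 1 := by
          rw [← ENNReal.ofReal_ofNat 2, ← ENNReal.ofReal_mul (by norm_num)]
          norm_num
        rw [mul_comm (μHE[d - 1] G), ← mul_assoc, this, one_mul]
    _ ≤ _ := by rw [mul_assoc]; gcongr

end ConeFace

/-! ### Poincaré type inequalities for smooth functions -/

/-- Hölder's inequality against the constant one; total mass at most one suffices. -/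
lemma rpow_lintegral_le {X : Type*} [MeasurableSpace X] {μ : Measure X} (hμ : μ Set.univ ≤ 1)
    {q : ℝ} (hq : 1 ≤ q) {f : X → ℝ≥0∞} (hf : AEMeasurable f μ) :
    (∫⁻ x, f x ∂μ) ^ q ≤ ∫⁻ x, f x ^ q ∂μ := by
  rcases hq.eq_or_lt with rfl | hq
  · simp
  have hc := Real.HolderConjugate.conjExponent hq
  have h := ENNReal.lintegral_mul_le_Lp_mul_Lq μ hc hf (aemeasurable_const (b := (1 : ℝ≥0∞)))
  have h1 : ((∫⁻ _, (1 : ℝ≥0∞) ^ q.conjExponent ∂μ)) ^ (1 / q.conjExponent) ≤ 1 := by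
    simp only [ENNReal.one_rpow, lintegral_const, one_mul]
    exact ENNReal.rpow_le_one hμ (by have := hc.symm.pos; positivity)
  have h2 : ∫⁻ x, f x ∂μ ≤ (∫⁻ x, f x ^ q ∂μ) ^ (1 / q) := by
    calc ∫⁻ x, f x ∂μ = ∫⁻ x, (f * (fun _ => 1 : X → ℝ≥0∞)) x ∂μ := by simp
      _ ≤ _ := h
      _ ≤ (∫⁻ x, f x ^ q ∂μ) ^ (1 / q) * 1 := by gcongr
      _ = _ := mul_one _
  calc (∫⁻ x, f x ∂μ) ^ q ≤ ((∫⁻ x, f x ^ q ∂μ) ^ (1 / q)) ^ q := by gcongr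
    _ = _ := by rw [← ENNReal.rpow_mul, one_div_mul_cancel (by linarith), ENNReal.rpow_one]

lemma enorm_sub_le_lintegral_deriv {f f' : ℝ → ℝ} (hf : ∀ s, HasDerivAt f (f' s) s)
    (hf' : Continuous f') {a b : ℝ} (hab : a ≤ b) :
    ‖f b - f a‖ₑ ≤ ∫⁻ s in Set.Ioo a b, ‖f' s‖ₑ := by
  rw [← intervalIntegral.integral_eq_sub_of_hasDerivAt (fun s _ => hf s)
    (hf'.intervalIntegrable a b), intervalIntegral.integral_of_le hab, integral_Ioc_eq_integral_Ioo]
  exact enorm_integral_le_lintegral_enorm _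

lemma lintegral_comp_add_smul_le {d : ℕ} {f : Eu d → ℝ≥0∞} (v : Eu d) {s : ℝ} (hs : 1 / 2 ≤ s) :
    ∫⁻ x, f (v + s • x) ≤ 2 ^ d * ∫⁻ x, f x := by
  have hs0 : 0 < s := by linarith
  have hemb : MeasurableEmbedding (fun x : Eu d => s • x) :=
    (Homeomorph.smulOfNeZero s hs0.ne').measurableEmbedding
  have e : ∫⁻ x, f (v + s • x) = ∫⁻ x, f (v + x) ∂(Measure.map (s • ·) volume) := by
    rw [hemb.lintegral_map]
  rw [e, Measure.map_addHaar_smul _ hs0.ne', lintegral_smul_measure, lintegral_add_left_eq_self,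
    finrank_euclideanSpace_fin, smul_eq_mul]
  gcongr
  rw [abs_of_pos (by positivity), show (2 : ℝ≥0∞) ^ d = ENNReal.ofReal (2 ^ d) by
    rw [ENNReal.ofReal_pow (by norm_num)]; simp, ← inv_pow]
  gcongr
  rw [inv_le_comm₀ hs0 (by norm_num)]
  linarith

lemma measurable_enorm_fderiv {d : ℕ} {g : Eu d → ℝ} (hg : ContDiff ℝ ∞ g) :
    Measurable fun x => ‖fderiv ℝ g x‖ₑ :=
  (hg.continuous_fderiv (by simp)).enorm.measurable

/-- The Poincaré inequality on a bounded convex set. -/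
lemma poincare_smooth {d : ℕ} {C : Set (Eu d)} (hC : Convex ℝ C) (hCm : MeasurableSet C) {h : ℝ}
    (hd : ∀ x ∈ C, ∀ y ∈ C, dist x y ≤ h) {q : ℝ} (hq : 1 ≤ q) {g : Eu d → ℝ}
    (hg : ContDiff ℝ ∞ g) :
    ∫⁻ x in C, ∫⁻ y in C, ‖g x - g y‖ₑ ^ q ≤
      ENNReal.ofReal h ^ q * (2 ^ d * (volume C * ∫⁻ x in C, ‖fderiv ℝ g x‖ₑ ^ q)) := by
  set Φ : Eu d → ℝ≥0∞ := C.indicator fun x => ‖fderiv ℝ g x‖ₑ ^ q with hΦ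
  have hΦm : Measurable Φ := ((measurable_enorm_fderiv hg).pow_const q).indicator hCm
  have hq0 : 0 ≤ q := by linarith
  have hpt : ∀ x ∈ C, ∀ y ∈ C, ‖g x - g y‖ₑ ^ q ≤
      ENNReal.ofReal h ^ q * ∫⁻ s in Set.Ioo (0 : ℝ) 1, Φ (y + s • (x - y)) := by
    intro x hx y hy
    have hder (s : ℝ) : HasDerivAt (fun s : ℝ => g (y + s • (x - y)))
        (fderiv ℝ g (y + s • (x - y)) (x - y)) s := by
      have h1 : HasDerivAt (fun s : ℝ => y + s • (x - y)) (x - y) s := by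
        simpa using HasDerivAt.const_add y ((hasDerivAt_id s).smul_const (x - y))
      exact ((hg.differentiable (by simp)) _).hasFDerivAt.comp_hasDerivAt s h1
    have hcont : Continuous fun s : ℝ => fderiv ℝ g (y + s • (x - y)) (x - y) :=
      ((hg.continuous_fderiv (by simp)).comp (by fun_prop)).clm_apply continuous_const
    have h1 := enorm_sub_le_lintegral_deriv hder hcont zero_le_one
    simp only [one_smul, zero_smul, add_zero, add_sub_cancel] at h1
    have hm : Measurable fun s : ℝ => ‖fderiv ℝ g (y + s • (x - y))‖ₑ :=
      (measurable_enorm_fderiv hg).comp (by fun_prop)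
    calc ‖g x - g y‖ₑ ^ q
        ≤ (∫⁻ s in Set.Ioo (0 : ℝ) 1, ENNReal.ofReal h * ‖fderiv ℝ g (y + s • (x - y))‖ₑ) ^ q := by
          gcongr
          refine h1.trans (lintegral_mono fun s => ?_)
          refine ((fderiv ℝ g _).le_opENorm _).trans ?_
          rw [mul_comm]
          gcongr
          rw [← ofReal_norm, ← dist_eq_norm]
          exact ENNReal.ofReal_le_ofReal (hd x hx y hy)
      _ = ENNReal.ofReal h ^ q *
          (∫⁻ s in Set.Ioo (0 : ℝ) 1, ‖fderiv ℝ g (y + s • (x - y))‖ₑ) ^ q := by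
          rw [lintegral_const_mul _ hm, ENNReal.mul_rpow_of_nonneg _ _ hq0]
      _ ≤ ENNReal.ofReal h ^ q *
          ∫⁻ s in Set.Ioo (0 : ℝ) 1, ‖fderiv ℝ g (y + s • (x - y))‖ₑ ^ q := by
          gcongr
          exact rpow_lintegral_le (by simp) hq hm.aemeasurable
      _ = _ := by
          congr 1
          refine setLIntegral_congr_fun measurableSet_Ioo fun s hs => ?_
          have : y + s • (x - y) ∈ C := hC.add_smul_sub_mem hy hx ⟨hs.1.le, hs.2.le⟩
          simp [hΦ, this]
  have hm3 : Measurable fun z : (Eu d × Eu d) × ℝ => Φ (z.1.2 + z.2 • (z.1.1 - z.1.2)) :=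
    hΦm.comp (by fun_prop)
  have hm2 : Measurable fun z : Eu d × Eu d =>
      ∫⁻ s in Set.Ioo (0 : ℝ) 1, Φ (z.2 + s • (z.1 - z.2)) := hm3.lintegral_prod_right'
  -- One of the weights `s` and `1 - s` in `y + s (x - y)` is at least `1/2`. The substitution is
  -- made in the variable carrying that weight, so that the Jacobian stays below `2^d`.
  have hJ : ∀ s ∈ Set.Ioo (0 : ℝ) 1, ∫⁻ x in C, ∫⁻ y in C, Φ (y + s • (x - y)) ≤
      2 ^ d * (volume C * ∫⁻ x in C, ‖fderiv ℝ g x‖ₑ ^ q) := by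
    intro s hs
    have hΦi : ∫⁻ x, Φ x = ∫⁻ x in C, ‖fderiv ℝ g x‖ₑ ^ q := lintegral_indicator hCm _
    have key : ∀ f : Eu d → Eu d → ℝ≥0∞, (∀ x, ∫⁻ y in C, f x y ≤ 2 ^ d * ∫⁻ x, Φ x) →
        ∫⁻ x in C, ∫⁻ y in C, f x y ≤
          2 ^ d * (volume C * ∫⁻ x in C, ‖fderiv ℝ g x‖ₑ ^ q) := by
      intro f hf
      refine (lintegral_mono hf).trans ?_
      rw [lintegral_const, Measure.restrict_apply_univ, hΦi]
      exact le_of_eq (by ring)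
    rcases le_total s (1 / 2) with h1 | h1
    · refine key _ fun x => (setLIntegral_le_lintegral _ _).trans ?_
      have e : ∀ y, y + s • (x - y) = s • x + (1 - s) • y := fun y => by module
      simp_rw [e]
      exact lintegral_comp_add_smul_le _ (by linarith)
    · rw [lintegral_lintegral_swap]
      · refine key (fun y x => Φ (y + s • (x - y))) fun y =>
          (setLIntegral_le_lintegral _ _).trans ?_
        have e : ∀ x, y + s • (x - y) = (1 - s) • y + s • x := fun x => by module
        simp_rw [e]
        exact lintegral_comp_add_smul_le _ h1
      · exact (hΦm.comp (by fun_prop :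
          Measurable fun z : Eu d × Eu d => z.2 + s • (z.1 - z.2))).aemeasurable
  calc ∫⁻ x in C, ∫⁻ y in C, ‖g x - g y‖ₑ ^ q
      ≤ ∫⁻ x in C, ∫⁻ y in C, ENNReal.ofReal h ^ q *
          ∫⁻ s in Set.Ioo (0 : ℝ) 1, Φ (y + s • (x - y)) :=
        setLIntegral_mono' hCm fun x hx => setLIntegral_mono' hCm fun y hy => hpt x hx y hy
    _ = ENNReal.ofReal h ^ q * ∫⁻ x in C, ∫⁻ y in C,
          ∫⁻ s in Set.Ioo (0 : ℝ) 1, Φ (y + s • (x - y)) := by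
        have hne : ENNReal.ofReal h ^ q ≠ ⊤ := ENNReal.rpow_ne_top_of_nonneg hq0 (by simp)
        rw [← lintegral_const_mul' _ _ hne]
        congr 1 with x
        rw [← lintegral_const_mul' _ _ hne]
    _ = ENNReal.ofReal h ^ q * ∫⁻ s in Set.Ioo (0 : ℝ) 1, ∫⁻ x in C, ∫⁻ y in C,
          Φ (y + s • (x - y)) := by
        congr 1
        have e1 : ∀ x, ∫⁻ y in C, ∫⁻ s in Set.Ioo (0 : ℝ) 1, Φ (y + s • (x - y)) =
            ∫⁻ s in Set.Ioo (0 : ℝ) 1, ∫⁻ y in C, Φ (y + s • (x - y)) := fun x =>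
          lintegral_lintegral_swap (hΦm.comp (by fun_prop :
            Measurable fun z : Eu d × ℝ => z.1 + z.2 • (x - z.1))).aemeasurable
        simp_rw [e1]
        refine lintegral_lintegral_swap (Measurable.aemeasurable ?_)
        exact Measurable.lintegral_prod_right'
          (f := fun z : (Eu d × ℝ) × Eu d => Φ (z.2 + z.1.2 • (z.1.1 - z.2)))
          (hΦm.comp (by fun_prop))
    _ ≤ ENNReal.ofReal h ^ q * ∫⁻ s in Set.Ioo (0 : ℝ) 1,
          2 ^ d * (volume C * ∫⁻ x in C, ‖fderiv ℝ g x‖ₑ ^ q) := by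
        exact mul_le_mul_right (setLIntegral_mono' measurableSet_Ioo hJ) _
    _ = _ := by simp

/-! ### Smooth functions on contracted copies of a face -/

namespace ConeFace

variable {d : ℕ} {S G : Set (Eu d)} {n y₀ : Eu d} {α r h : ℝ}

lemma shrink_image_subset (H : ConeFace S G n y₀ α r h) {σ τ : ℝ} (hτσ : τ ≤ σ)
    (hσ : σ < 1) : shrink y₀ σ '' S ⊆ shrink y₀ τ '' S := by
  rintro _ ⟨x, hx, rfl⟩
  have h1 : 0 < 1 - τ := by linarith
  refine ⟨shrink y₀ ((σ - τ) / (1 - τ)) x, shrink_mem H.convS H.center_mem hx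
    (div_nonneg (by linarith) h1.le) ((div_le_one h1).2 (by linarith)), ?_⟩
  unfold shrink
  rw [add_sub_cancel_left, smul_smul]
  congr 2
  field_simp
  ring

lemma measurableSet_shrink_image (H : ConeFace S G n y₀ α r h) (τ : ℝ) :
    MeasurableSet (shrink y₀ τ '' S) :=
  (H.compS.image (continuous_shrink y₀ τ)).measurableSet

/-- The fundamental theorem of calculus along the segment from `x` to `y₀`, whose velocity has
length at most `h`, followed by Jensen's inequality. -/
lemma enorm_sub_shrink_le (H : ConeFace S G n y₀ α r h) {q : ℝ} (hq : 1 ≤ q) {g : Eu d → ℝ}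
    (hg : ContDiff ℝ ∞ g) {τ t : ℝ} (hτ : 0 ≤ τ) (hτt : τ ≤ t) (ht : t ≤ 1) {x : Eu d}
    (hx : x ∈ S) :
    ‖g (shrink y₀ τ x) - g (shrink y₀ t x)‖ₑ ^ q ≤
      ENNReal.ofReal h ^ q * ∫⁻ s in Set.Ioo τ t, ‖fderiv ℝ g (shrink y₀ s x)‖ₑ ^ q := by
  have hq0 : 0 ≤ q := by linarith
  have hder (s : ℝ) : HasDerivAt (fun s : ℝ => g (shrink y₀ s x))
      (fderiv ℝ g (shrink y₀ s x) (-(x - y₀))) s := by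
    have h1 : HasDerivAt (fun s : ℝ => shrink y₀ s x) (-(x - y₀)) s := by
      unfold shrink
      simpa using HasDerivAt.const_add y₀
        (((hasDerivAt_id s).const_sub 1).smul_const (x - y₀))
    exact ((hg.differentiable (by simp)) _).hasFDerivAt.comp_hasDerivAt s h1
  have hsh : Continuous fun s : ℝ => shrink y₀ s x := by unfold shrink; fun_prop
  have hcont : Continuous fun s : ℝ => fderiv ℝ g (shrink y₀ s x) (-(x - y₀)) :=
    ((hg.continuous_fderiv (by simp)).comp hsh).clm_apply continuous_const
  have hm : Measurable fun s : ℝ => ‖fderiv ℝ g (shrink y₀ s x)‖ₑ :=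
    (measurable_enorm_fderiv hg).comp hsh.measurable
  have h1 := enorm_sub_le_lintegral_deriv hder hcont hτt
  calc ‖g (shrink y₀ τ x) - g (shrink y₀ t x)‖ₑ ^ q
      ≤ (∫⁻ s in Set.Ioo τ t, ENNReal.ofReal h * ‖fderiv ℝ g (shrink y₀ s x)‖ₑ) ^ q := by
        gcongr
        rw [enorm_sub_rev]
        refine h1.trans (lintegral_mono fun s => ?_)
        refine ((fderiv ℝ g _).le_opENorm _).trans ?_
        rw [mul_comm]
        gcongr
        rw [enorm_neg, ← ofReal_norm, ← dist_eq_norm]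
        exact ENNReal.ofReal_le_ofReal (H.dist_le x hx y₀ H.center_mem)
    _ = ENNReal.ofReal h ^ q * (∫⁻ s in Set.Ioo τ t, ‖fderiv ℝ g (shrink y₀ s x)‖ₑ) ^ q := by
        rw [lintegral_const_mul _ hm, ENNReal.mul_rpow_of_nonneg _ _ hq0]
    _ ≤ _ := by
        gcongr
        refine rpow_lintegral_le ?_ hq hm.aemeasurable
        rw [Measure.restrict_apply_univ, Real.volume_Ioo]
        exact ENNReal.ofReal_le_one.2 (by linarith)

lemma lintegral_sub_shrink_le (H : ConeFace S G n y₀ α r h) {q : ℝ} (hq : 1 ≤ q) {g : Eu d → ℝ}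
    (hg : ContDiff ℝ ∞ g) {τ t : ℝ} (hτ : 0 ≤ τ) (hτt : τ ≤ t) (ht : t ≤ 1) :
    ∫⁻ x in G, ‖g (shrink y₀ τ x) - g (shrink y₀ t x)‖ₑ ^ q ∂μHE[d - 1] ≤
      ENNReal.ofReal h ^ q * ∫⁻ s in Set.Ioo τ t, ∫⁻ x in G,
        ‖fderiv ℝ g (shrink y₀ s x)‖ₑ ^ q ∂μHE[d - 1] := by
  have := H.isFiniteMeasure
  have hne : ENNReal.ofReal h ^ q ≠ ⊤ := ENNReal.rpow_ne_top_of_nonneg (by linarith) (by simp)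
  rw [lintegral_lintegral_swap, ← lintegral_const_mul' _ _ hne]
  · exact setLIntegral_mono' H.compG.measurableSet fun x hx =>
      H.enorm_sub_shrink_le hq hg hτ hτt ht (H.sub hx)
  · refine Measurable.aemeasurable ?_
    have : Measurable fun z : ℝ × Eu d => shrink y₀ z.1 z.2 := by
      unfold shrink; fun_prop
    exact ((measurable_enorm_fderiv hg).comp this).pow_const q

/-- The copies with parameter `s ≥ τ` stay in the contracted set with parameter `τ`, so only the
gradient there enters. This matters for mollified functions, whose gradients are controlled only
away from the boundary of `S`. -/
lemma lintegral_sub_shrink_le' (H : ConeFace S G n y₀ α r h) {q : ℝ} (hq : 1 ≤ q) {g : Eu d → ℝ}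
    (hg : ContDiff ℝ ∞ g) {τ t : ℝ} (hτ : 0 ≤ τ) (hτt : τ ≤ t) (ht : t ≤ 1 / 2) :
    ∫⁻ x in G, ‖g (shrink y₀ τ x) - g (shrink y₀ t x)‖ₑ ^ q ∂μHE[d - 1] ≤
      ENNReal.ofReal h ^ q * (coneConst d r * ∫⁻ x in shrink y₀ τ '' S, ‖fderiv ℝ g x‖ₑ ^ q) := by
  refine (H.lintegral_sub_shrink_le hq hg hτ hτt (by linarith)).trans ?_
  gcongr
  set f : Eu d → ℝ≥0∞ := (shrink y₀ τ '' S).indicator fun x => ‖fderiv ℝ g x‖ₑ ^ q with hf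
  have hfm : Measurable f :=
    ((measurable_enorm_fderiv hg).pow_const q).indicator (H.measurableSet_shrink_image τ)
  calc ∫⁻ s in Set.Ioo τ t, ∫⁻ x in G, ‖fderiv ℝ g (shrink y₀ s x)‖ₑ ^ q ∂μHE[d - 1]
      ≤ ∫⁻ s in Set.Ioo τ t, ∫⁻ x in G, f (shrink y₀ s x) ∂μHE[d - 1] := by
        refine setLIntegral_mono' measurableSet_Ioo fun s hs =>
          setLIntegral_mono' H.compG.measurableSet fun x hx => ?_
        have : shrink y₀ s x ∈ shrink y₀ τ '' S :=
          H.shrink_image_subset hs.1.le (by linarith [hs.2]) ⟨x, H.sub hx, rfl⟩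
        simp [hf, this]
    _ ≤ ∫⁻ s in Set.Ioo (0 : ℝ) (1 / 2), ∫⁻ x in G, f (shrink y₀ s x) ∂μHE[d - 1] :=
        lintegral_mono_set (Set.Ioo_subset_Ioo hτ ht)
    _ ≤ coneConst d r * ∫⁻ x in S, f x := H.lintegral_shrink_le hfm
    _ ≤ coneConst d r * ∫⁻ x, f x := by gcongr; exact Measure.restrict_le_self
    _ = _ := by rw [hf, lintegral_indicator (H.measurableSet_shrink_image τ)]

lemma shrink_zero (x : Eu d) : shrink y₀ 0 x = x := by simp [shrink]

/-- Comparison of the values on a face with the values in the interior. -/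
lemma lintegral_face_sub_le (H : ConeFace S G n y₀ α r h) {g : Eu d → ℝ} (hg : ContDiff ℝ ∞ g) :
    ∫⁻ x in G, (∫⁻ y in S, ‖g x - g y‖ₑ) ∂μHE[d - 1] ≤
      2 ^ (d + 2) * (ENNReal.ofReal h * coneConst d r * (volume S * ∫⁻ x in S, ‖fderiv ℝ g x‖ₑ)) := by
  have := H.isFiniteMeasure
  set I := ∫⁻ x in S, ‖fderiv ℝ g x‖ₑ with hI
  set L := ∫⁻ x in G, (∫⁻ y in S, ‖g x - g y‖ₑ) ∂μHE[d - 1] with hL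
  have hSm := H.compS.measurableSet
  have hgm : Measurable g := hg.continuous.measurable
  set A : ℝ → ℝ≥0∞ := fun t => ∫⁻ x in G, (∫⁻ y in S, ‖g (shrink y₀ t x) - g y‖ₑ) ∂μHE[d - 1]
  -- The comparison passes through the contracted point. Averaging over `t` then turns the remaining
  -- face integral `A t` into a double volume integral, to which the Poincaré inequality applies.
  have hLt : ∀ t ∈ Set.Ioo (0 : ℝ) (1 / 2), L ≤
      volume S * (ENNReal.ofReal h * (coneConst d r * I)) + A t := by
    intro t ht
    have h1 := H.lintegral_sub_shrink_le' le_rfl hg le_rfl ht.1.le ht.2.le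
    have hS0 : shrink y₀ 0 '' S = S := by simp [Set.image_congr (fun x _ => shrink_zero x)]
    rw [hS0] at h1
    simp only [ENNReal.rpow_one, shrink_zero] at h1
    calc L ≤ ∫⁻ x in G, (volume S * ‖g x - g (shrink y₀ t x)‖ₑ +
          ∫⁻ y in S, ‖g (shrink y₀ t x) - g y‖ₑ) ∂μHE[d - 1] := by
          refine lintegral_mono fun x => ?_
          calc ∫⁻ y in S, ‖g x - g y‖ₑ
              ≤ ∫⁻ y in S, (‖g x - g (shrink y₀ t x)‖ₑ + ‖g (shrink y₀ t x) - g y‖ₑ) := by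
                refine lintegral_mono fun y => ?_
                rw [show g x - g y = (g x - g (shrink y₀ t x)) + (g (shrink y₀ t x) - g y) by ring]
                exact enorm_add_le _ _
            _ = _ := by
                rw [lintegral_add_left measurable_const, lintegral_const,
                  Measure.restrict_apply_univ, mul_comm]
      _ = volume S * (∫⁻ x in G, ‖g x - g (shrink y₀ t x)‖ₑ ∂μHE[d - 1]) + A t := by
          have hm : Measurable fun x => ‖g x - g (shrink y₀ t x)‖ₑ :=
            (hgm.sub (hgm.comp (continuous_shrink y₀ t).measurable)).enorm
          rw [lintegral_add_left (hm.const_mul _), lintegral_const_mul _ hm]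
      _ ≤ _ := by gcongr
  have hint : ∫⁻ t in Set.Ioo (0 : ℝ) (1 / 2), A t ≤
      coneConst d r * (ENNReal.ofReal h * (2 ^ d * (volume S * I))) := by
    have h1 := poincare_smooth H.convS hSm H.dist_le le_rfl hg
    simp only [ENNReal.rpow_one] at h1
    refine (H.lintegral_shrink_le (f := fun x => ∫⁻ y in S, ‖g x - g y‖ₑ) ?_).trans ?_
    · exact Measurable.lintegral_prod_right' (f := fun z : Eu d × Eu d => ‖g z.1 - g z.2‖ₑ)
        ((hgm.comp measurable_fst).sub (hgm.comp measurable_snd)).enorm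
    · gcongr
  have h12 : ENNReal.ofReal (1 / 2) = 2⁻¹ := by
    rw [one_div, ENNReal.ofReal_inv_of_pos (by norm_num)]; simp
  have h2 : L * 2⁻¹ ≤ volume S * (ENNReal.ofReal h * (coneConst d r * I)) * 2⁻¹ +
      coneConst d r * (ENNReal.ofReal h * (2 ^ d * (volume S * I))) := by
    calc L * 2⁻¹ = ∫⁻ _ in Set.Ioo (0 : ℝ) (1 / 2), L := by
          rw [lintegral_const, Measure.restrict_apply_univ, Real.volume_Ioo, sub_zero, h12]
      _ ≤ ∫⁻ t in Set.Ioo (0 : ℝ) (1 / 2),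
          (volume S * (ENNReal.ofReal h * (coneConst d r * I)) + A t) :=
          setLIntegral_mono' measurableSet_Ioo hLt
      _ = volume S * (ENNReal.ofReal h * (coneConst d r * I)) * 2⁻¹ +
          ∫⁻ t in Set.Ioo (0 : ℝ) (1 / 2), A t := by
          rw [lintegral_add_left measurable_const, lintegral_const, Measure.restrict_apply_univ,
            Real.volume_Ioo, sub_zero, h12]
      _ ≤ _ := by gcongr
  set X := ENNReal.ofReal h * coneConst d r * (volume S * I) with hX
  have h3 : L * 2⁻¹ ≤ X * 2⁻¹ + 2 ^ d * X := by
    refine h2.trans (le_of_eq ?_)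
    rw [hX]; ring
  have h22 : (2 : ℝ≥0∞)⁻¹ * 2 = 1 := ENNReal.inv_mul_cancel (by simp) (by simp)
  calc L = L * 2⁻¹ * 2 := by rw [mul_assoc, h22, mul_one]
    _ ≤ (X * 2⁻¹ + 2 ^ d * X) * 2 := by gcongr
    _ = X * (2⁻¹ * 2) + 2 ^ (d + 1) * X := by ring
    _ = X + 2 ^ (d + 1) * X := by rw [h22, mul_one]
    _ ≤ 2 ^ (d + 1) * X + 2 ^ (d + 1) * X := by
        gcongr
        exact le_mul_of_one_le_left zero_le (one_le_pow₀ (by norm_num))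
    _ = _ := by ring

end ConeFace

/-! ### Mollification of weakly differentiable functions -/

/-- A sequence of bump functions with radii tending to zero. -/
def bump (d m : ℕ) : ContDiffBump (0 : Eu d) where
  rIn := 1 / (m + 1)
  rOut := 2 / (m + 1)
  rIn_pos := by positivity
  rIn_lt_rOut := by gcongr; norm_num

/-- The mollification of the restriction of `u` to `Ω`. -/
def mollify {d : ℕ} (Ω : Set (Eu d)) (u : Eu d → ℝ) (m : ℕ) : Eu d → ℝ :=
  convolution (Ω.indicator u) ((bump d m).normed volume) (ContinuousLinearMap.mul ℝ ℝ) volume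

section Mollify

variable {d : ℕ} {Ω : Set (Eu d)} {u : Eu d → ℝ}

lemma contDiff_mollify (hΩ : IsOpen Ω) (hu : IntegrableOn u Ω) (m : ℕ) :
    ContDiff ℝ ∞ (mollify Ω u m) :=
  (bump d m).hasCompactSupport_normed.contDiff_convolution_right _
    ((integrable_indicator_iff hΩ.measurableSet).2 hu).locallyIntegrable
    (bump d m).contDiff_normed

lemma tendsto_bump_rOut (d : ℕ) : Tendsto (fun m => (bump d m).rOut) atTop (𝓝 0) := by
  have := (tendsto_one_div_add_atTop_nhds_zero_nat (𝕜 := ℝ)).const_mul 2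
  simpa [bump, div_eq_mul_inv] using this

lemma ae_tendsto_mollify (hΩ : IsOpen Ω) (hu : IntegrableOn u Ω) :
    ∀ᵐ x ∂volume.restrict Ω, Tendsto (fun m => mollify Ω u m x) atTop (𝓝 (u x)) := by
  have hloc : LocallyIntegrable (Ω.indicator u) volume :=
    ((integrable_indicator_iff hΩ.measurableSet).2 hu).locallyIntegrable
  have h := ContDiffBump.ae_convolution_tendsto_right_of_locallyIntegrable (K := 2)
    (tendsto_bump_rOut d) (Eventually.of_forall fun m => by simp [bump]; ring_nf; rfl) hloc
  rw [ae_restrict_iff' hΩ.measurableSet]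
  filter_upwards [h] with x hx hxΩ
  rw [Set.indicator_of_mem hxΩ] at hx
  refine hx.congr fun m => ?_
  unfold mollify
  rw [convolution_eq_swap, convolution_def]
  simp [mul_comm]

/-- The derivative falls on the mollifier, and `t ↦ ρ(x - t)` is an admissible test function because
its support lies in the closed ball around `x`. -/
lemma fderiv_mollify (hΩ : IsOpen Ω) (hu : IntegrableOn u Ω) {j : Fin d} {v : Eu d → ℝ}
    (hw : HasWeakPartial Ω u j v) {m : ℕ} {x : Eu d}
    (hx : Metric.closedBall x (bump d m).rOut ⊆ Ω) :
    fderiv ℝ (mollify Ω u m) x (EuclideanSpace.single j 1) =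
      ∫ t in Ω, v t * (bump d m).normed volume (x - t) := by
  set ρ := (bump d m).normed (volume : Measure (Eu d)) with hρ
  have hloc : LocallyIntegrable (Ω.indicator u) volume :=
    ((integrable_indicator_iff hΩ.measurableSet).2 hu).locallyIntegrable
  have hρs : ContDiff ℝ ∞ ρ := (bump d m).contDiff_normed
  have hρc : HasCompactSupport ρ := (bump d m).hasCompactSupport_normed
  have h1 := hρc.hasFDerivAt_convolution_right (ContinuousLinearMap.mul ℝ ℝ) hloc
    (hρs.of_le (by simp)) x
  have h2 := h1.fderiv
  have h3 := convolution_precompR_apply (ContinuousLinearMap.mul ℝ ℝ) hloc (hρc.fderiv ℝ)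
    (hρs.continuous_fderiv (by simp)) x (EuclideanSpace.single j 1)
  change fderiv ℝ (mollify Ω u m) x = _ at h2
  rw [h2, h3, convolution_def]
  set η : Eu d → ℝ := fun t => ρ (x - t) with hη
  have hηs : ContDiff ℝ ∞ η := hρs.comp (by fun_prop)
  have hsup : tsupport η ⊆ Metric.closedBall x (bump d m).rOut := by
    refine closure_minimal (fun t ht => ?_) Metric.isClosed_closedBall
    have : x - t ∈ Function.support ρ := ht
    rw [hρ, ContDiffBump.support_normed_eq, mem_ball_zero_iff] at this
    rw [Metric.mem_closedBall', dist_eq_norm]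
    exact this.le
  have hηc : HasCompactSupport η :=
    (isCompact_closedBall x _).of_isClosed_subset (isClosed_tsupport η) hsup
  have hwη := hw η hηs hηc (hsup.trans hx)
  have hfd (t : Eu d) : fderiv ℝ η t (EuclideanSpace.single j 1) =
      -fderiv ℝ ρ (x - t) (EuclideanSpace.single j 1) := by
    have e1 : HasFDerivAt (fun t : Eu d => x - t) (-ContinuousLinearMap.id ℝ (Eu d)) t :=
      (hasFDerivAt_id (𝕜 := ℝ) t).const_sub x
    have e2 := ((hρs.differentiable (by simp)) (x - t)).hasFDerivAt.comp t e1
    rw [show η = ρ ∘ fun t => x - t from rfl, e2.fderiv]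
    simp
  have e : ∀ t, (ContinuousLinearMap.mul ℝ ℝ (Ω.indicator u t))
      ((fun a => fderiv ℝ ρ a (EuclideanSpace.single j 1)) (x - t)) =
      Ω.indicator (fun t => u t * fderiv ℝ ρ (x - t) (EuclideanSpace.single j 1)) t := by
    intro t
    by_cases ht : t ∈ Ω <;> simp [ht]
  simp_rw [e]
  rw [integral_indicator hΩ.measurableSet]
  simp_rw [hfd, mul_neg, integral_neg, neg_inj] at hwη
  exact hwη

lemma lintegral_ofReal_bump (d m : ℕ) (x : Eu d) :
    ∫⁻ t, ENNReal.ofReal ((bump d m).normed volume (x - t)) = 1 := by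
  rw [lintegral_sub_left_eq_self (fun t => ENNReal.ofReal ((bump d m).normed volume t)),
    ← ofReal_integral_eq_lintegral_ofReal (bump d m).integrable_normed
    (Eventually.of_forall fun t => (bump d m).nonneg_normed t), (bump d m).integral_normed]
  simp

lemma lintegral_ofReal_bump' (d m : ℕ) (t : Eu d) :
    ∫⁻ x, ENNReal.ofReal ((bump d m).normed volume (x - t)) = 1 := by
  rw [lintegral_sub_right_eq_self (fun t => ENNReal.ofReal ((bump d m).normed volume t)),
    ← ofReal_integral_eq_lintegral_ofReal (bump d m).integrable_normed
    (Eventually.of_forall fun t => (bump d m).nonneg_normed t), (bump d m).integral_normed]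
  simp

/-- Jensen's inequality for the measure with density `ρ(x - ·)`, whose mass is at most one, followed
by Tonelli. For `x ∈ C` the mollifier sees only values in `E`. -/
lemma lintegral_fderiv_mollify_le (hΩ : IsOpen Ω) (hu : IntegrableOn u Ω) {j : Fin d}
    {v : Eu d → ℝ} (hv : IntegrableOn v Ω) (hw : HasWeakPartial Ω u j v) {q : ℝ} (hq : 1 ≤ q)
    {m : ℕ} {C E : Set (Eu d)} (hC : MeasurableSet C) (hE : MeasurableSet E) (hEΩ : E ⊆ Ω)
    (hCE : ∀ x ∈ C, Metric.closedBall x (bump d m).rOut ⊆ E) :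
    ∫⁻ x in C, ‖fderiv ℝ (mollify Ω u m) x (EuclideanSpace.single j 1)‖ₑ ^ q ≤
      ∫⁻ x in E, ‖v x‖ₑ ^ q := by
  set ρ : Eu d → ℝ≥0∞ := fun t => ENNReal.ofReal ((bump d m).normed volume t) with hρ
  have hρm : Measurable ρ := (bump d m).continuous_normed.measurable.ennreal_ofReal
  have hvm : AEMeasurable (fun t => ‖v t‖ₑ) (volume.restrict E) :=
    (hv.mono_set hEΩ).aestronglyMeasurable.enorm
  have hpt : ∀ x ∈ C, ‖fderiv ℝ (mollify Ω u m) x (EuclideanSpace.single j 1)‖ₑ ^ q ≤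
      ∫⁻ t in E, ρ (x - t) * ‖v t‖ₑ ^ q := by
    intro x hx
    have hρx : Measurable fun t => ρ (x - t) := hρm.comp (by fun_prop)
    rw [fderiv_mollify hΩ hu hw ((hCE x hx).trans hEΩ)]
    have e1 : ∫⁻ t in Ω, ‖v t * (bump d m).normed volume (x - t)‖ₑ =
        ∫⁻ t in E, ρ (x - t) * ‖v t‖ₑ := by
      rw [← lintegral_indicator hΩ.measurableSet, ← lintegral_indicator hE]
      congr 1 with t
      by_cases htE : t ∈ E
      · rw [Set.indicator_of_mem htE, Set.indicator_of_mem (hEΩ htE), enorm_mul, mul_comm,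
          Real.enorm_of_nonneg ((bump d m).nonneg_normed _)]
      · rw [Set.indicator_of_notMem htE]
        have h0 : (bump d m).normed volume (x - t) = 0 := by
          by_contra hne
          have : x - t ∈ Function.support ((bump d m).normed (volume : Measure (Eu d))) := hne
          rw [ContDiffBump.support_normed_eq, mem_ball_zero_iff] at this
          exact htE (hCE x hx (by rw [Metric.mem_closedBall', dist_eq_norm]; exact this.le))
        simp [Set.indicator, h0]
    calc _ ≤ (∫⁻ t in E, ρ (x - t) * ‖v t‖ₑ) ^ q := by
          gcongr
          rw [← e1]
          exact enorm_integral_le_lintegral_enorm _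
      _ = (∫⁻ t, ‖v t‖ₑ ∂((volume.restrict E).withDensity fun t => ρ (x - t))) ^ q := by
          rw [lintegral_withDensity_eq_lintegral_mul₀ hρx.aemeasurable hvm]
          rfl
      _ ≤ ∫⁻ t, ‖v t‖ₑ ^ q ∂((volume.restrict E).withDensity fun t => ρ (x - t)) := by
          refine rpow_lintegral_le ?_ hq (hvm.mono_ac (withDensity_absolutelyContinuous _ _))
          rw [withDensity_apply _ MeasurableSet.univ, Measure.restrict_univ]
          exact (setLIntegral_le_lintegral _ _).trans (lintegral_ofReal_bump d m x).le
      _ = _ := by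
          rw [lintegral_withDensity_eq_lintegral_mul₀ hρx.aemeasurable (hvm.pow_const q)]
          rfl
  calc _ ≤ ∫⁻ x in C, ∫⁻ t in E, ρ (x - t) * ‖v t‖ₑ ^ q := setLIntegral_mono' hC hpt
    _ = ∫⁻ t in E, ∫⁻ x in C, ρ (x - t) * ‖v t‖ₑ ^ q := by
        refine lintegral_lintegral_swap (AEMeasurable.mul ?_ ?_)
        · exact (hρm.comp (by fun_prop :
            Measurable fun z : Eu d × Eu d => z.1 - z.2)).aemeasurable
        · exact (hvm.pow_const q).comp_quasiMeasurePreserving Measure.quasiMeasurePreserving_snd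
    _ ≤ ∫⁻ t in E, ‖v t‖ₑ ^ q := by
        refine lintegral_mono fun t => ?_
        have hm : Measurable fun x => ρ (x - t) := hρm.comp (by fun_prop)
        rw [lintegral_mul_const _ hm]
        refine mul_le_of_le_one_left zero_le ?_
        exact (setLIntegral_le_lintegral _ _).trans (lintegral_ofReal_bump' d m t).le

end Mollify

/-! ### Smooth approximation inside a convex set -/

lemma opNorm_rpow_le {d : ℕ} (l : Eu d →L[ℝ] ℝ) {q : ℝ} (hq : 1 ≤ q) :
    ‖l‖ₑ ^ q ≤ (d : ℝ≥0∞) ^ q * ∑ j, ‖l (EuclideanSpace.single j 1)‖ₑ ^ q := by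
  have hq0 : 0 ≤ q := by linarith
  have h1 : ‖l‖ ≤ ∑ j, ‖l (EuclideanSpace.single j 1)‖ := by
    refine l.opNorm_le_bound (by positivity) fun x => ?_
    have hx : x = ∑ j, x j • EuclideanSpace.single j (1 : ℝ) := by
      ext i
      simp [Finset.sum_apply, Pi.single_apply]
    conv_lhs => rw [hx]
    rw [map_sum, Finset.sum_mul]
    refine (norm_sum_le _ _).trans (Finset.sum_le_sum fun j _ => ?_)
    rw [map_smul, norm_smul, mul_comm]
    gcongr
    exact PiLp.norm_apply_le x j
  have h2 : ‖l‖ₑ ≤ ∑ j, ‖l (EuclideanSpace.single j 1)‖ₑ := by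
    simp_rw [← ofReal_norm]
    rw [← ENNReal.ofReal_sum_of_nonneg fun _ _ => norm_nonneg _]
    exact ENNReal.ofReal_le_ofReal h1
  have h3 : ∑ j, ‖l (EuclideanSpace.single j 1)‖ₑ ≤
      d * (∑ j, ‖l (EuclideanSpace.single j 1)‖ₑ ^ q) ^ (1 / q) := by
    calc ∑ j, ‖l (EuclideanSpace.single j 1)‖ₑ
        ≤ ∑ _j : Fin d, (∑ j, ‖l (EuclideanSpace.single j 1)‖ₑ ^ q) ^ (1 / q) := by
          refine Finset.sum_le_sum fun j _ => ?_
          rw [one_div, ENNReal.le_rpow_inv_iff (by linarith)]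
          exact Finset.single_le_sum (f := fun j => ‖l (EuclideanSpace.single j 1)‖ₑ ^ q)
            (fun _ _ => zero_le) (Finset.mem_univ j)
      _ = _ := by simp
  calc ‖l‖ₑ ^ q ≤ (d * (∑ j, ‖l (EuclideanSpace.single j 1)‖ₑ ^ q) ^ (1 / q)) ^ q := by
        gcongr; exact h2.trans h3
    _ = _ := by
        rw [ENNReal.mul_rpow_of_nonneg _ _ hq0, ← ENNReal.rpow_mul,
          one_div_mul_cancel (by linarith), ENNReal.rpow_one]

/-- By convexity `S` contains `(1 - τ) x + τ B(y₀, r)` for every `x ∈ S`. -/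
lemma ConeFace.ball_shrink_subset {d : ℕ} {S G : Set (Eu d)} {n y₀ : Eu d} {α r h : ℝ}
    (H : ConeFace S G n y₀ α r h) {τ : ℝ} (h0 : 0 < τ) (h1 : τ ≤ 1) {x : Eu d}
    (hx : x ∈ shrink y₀ τ '' S) : Metric.ball x (τ * r) ⊆ S := by
  obtain ⟨x, hx, rfl⟩ := hx
  intro z hz
  set w := y₀ + τ⁻¹ • (z - shrink y₀ τ x)
  have hw : w ∈ S := H.ball (by
    rw [mem_ball_iff_norm, add_sub_cancel_left, norm_smul, norm_inv, Real.norm_of_nonneg h0.le,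
      inv_mul_lt_iff₀ h0, ← dist_eq_norm]
    exact hz)
  have := H.convS hw hx h0.le (sub_nonneg.2 h1) (by ring)
  convert this using 1
  simp only [w, smul_add, smul_inv_smul₀ h0.ne']
  unfold shrink
  module

/-- Approximation of a Sobolev function on `S` by smooth functions, with a bound of the gradients
on the contracted sets. -/
lemma ConeFace.exists_smooth_approx {d : ℕ} {S G : Set (Eu d)} {n y₀ : Eu d} {α r h : ℝ}
    (H : ConeFace S G n y₀ α r h) {Ω : Set (Eu d)} (hΩ : IsOpen Ω) (hS : interior S ⊆ Ω)
    {u : Eu d → ℝ} {Du : Eu d → Fin d → ℝ} (hu : IntegrableOn u Ω)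
    (hDu : ∀ j, IntegrableOn (fun x => Du x j) Ω)
    (hw : ∀ j, HasWeakPartial Ω u j (fun x => Du x j)) {q : ℝ} (hq : 1 ≤ q) :
    ∃ g : ℕ → Eu d → ℝ, (∀ m, ContDiff ℝ ∞ (g m)) ∧
      (∀ᵐ x ∂volume.restrict S, Tendsto (fun m => g m x) atTop (𝓝 (u x))) ∧
      ∀ m : ℕ, ∫⁻ x in shrink y₀ (1 / (m + 1)) '' S, ‖fderiv ℝ (g m) x‖ₑ ^ q ≤
        (d : ℝ≥0∞) ^ q * ∑ j, ∫⁻ x in S, ‖Du x j‖ₑ ^ q := by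
  -- The radius of mollification is kept below the distance `r/(m+1)` of the contracted copy from
  -- the complement of `S`. The mean over the mollifier then uses values inside `S` only, so the
  -- bound involves the gradient on `S` alone.
  have hr : ∀ m : ℕ, ∃ N ≥ m, (bump d N).rOut < 1 / (m + 1) * r := by
    intro m
    have h1 : (0 : ℝ) < 1 / (m + 1) * r := mul_pos (by positivity) H.r_pos
    obtain ⟨N, hN⟩ := (((tendsto_bump_rOut d).eventually_lt_const h1).and
      (eventually_ge_atTop m)).exists
    exact ⟨N, hN.2, hN.1⟩
  choose N hNm hN using hr
  have hNt : Tendsto N atTop atTop := tendsto_atTop_mono hNm tendsto_id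
  have hSm : (volume.restrict S : Measure (Eu d)) = volume.restrict (interior S) :=
    (Measure.restrict_congr_set (interior_ae_eq_of_null_frontier
      (H.convS.addHaar_frontier volume))).symm
  refine ⟨fun m => mollify Ω u (N m), fun m => contDiff_mollify hΩ hu _, ?_, fun m => ?_⟩
  · rw [hSm]
    filter_upwards [ae_restrict_of_ae_restrict_of_subset hS (ae_tendsto_mollify hΩ hu)] with x hx
    exact hx.comp hNt
  · have hCm := H.measurableSet_shrink_image (1 / ((m : ℝ) + 1))
    have hsm := contDiff_mollify hΩ hu (N m)
    calc _ ≤ ∫⁻ x in shrink y₀ (1 / (m + 1)) '' S, (d : ℝ≥0∞) ^ q *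
          ∑ j, ‖fderiv ℝ (mollify Ω u (N m)) x (EuclideanSpace.single j 1)‖ₑ ^ q :=
          lintegral_mono fun x => opNorm_rpow_le _ hq
      _ = (d : ℝ≥0∞) ^ q * ∑ j, ∫⁻ x in shrink y₀ (1 / (m + 1)) '' S,
          ‖fderiv ℝ (mollify Ω u (N m)) x (EuclideanSpace.single j 1)‖ₑ ^ q := by
          have hm (j : Fin d) : Measurable fun x =>
              ‖fderiv ℝ (mollify Ω u (N m)) x (EuclideanSpace.single j 1)‖ₑ ^ q :=
            (((hsm.continuous_fderiv (by simp)).clm_apply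
              continuous_const).enorm.measurable).pow_const q
          rw [lintegral_const_mul _ (Finset.measurable_fun_sum _ fun j _ => hm j),
            lintegral_finsetSum _ fun j _ => hm j]
      _ ≤ _ := by
          refine mul_le_mul_right (Finset.sum_le_sum fun j _ => ?_) _
          rw [hSm]
          refine lintegral_fderiv_mollify_le hΩ hu (hDu j) (hw j) hq hCm
            isOpen_interior.measurableSet hS fun x hx => ?_
          have h1 := H.ball_shrink_subset (τ := 1 / ((m : ℝ) + 1)) (by positivity)
            ((div_le_one (by positivity)).2 (by linarith [m.cast_nonneg (α := ℝ)])) hx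
          exact (Metric.closedBall_subset_ball (hN m)).trans
            (interior_maximal h1 Metric.isOpen_ball)

/-! ### Poincaré and trace inequalities for Sobolev functions -/

/-- The right-hand side of the Poincaré inequality. -/
def gradEnergy {d : ℕ} (S : Set (Eu d)) (q : ℝ) (Du : Eu d → Fin d → ℝ) : ℝ≥0∞ :=
  (d : ℝ≥0∞) ^ q * ∑ j, ∫⁻ x in S, ‖Du x j‖ₑ ^ q

/-- Along a subsequence with integrals at most `2^(-k)` the series has finite integral, hence
converges almost everywhere. -/
lemma exists_subseq_ae_tendsto_zero {X : Type*} [MeasurableSpace X] {μ : Measure X}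
    {f : ℕ → X → ℝ≥0∞} (hf : ∀ n, AEMeasurable (f n) μ)
    (h : Tendsto (fun n => ∫⁻ x, f n x ∂μ) atTop (𝓝 0)) :
    ∃ φ : ℕ → ℕ, Tendsto φ atTop atTop ∧
      ∀ᵐ x ∂μ, Tendsto (fun k => f (φ k) x) atTop (𝓝 0) := by
  have h1 : ∀ k : ℕ, ∃ n ≥ k, ∫⁻ x, f n x ∂μ ≤ 2⁻¹ ^ k := fun k => by
    have : (0 : ℝ≥0∞) < 2⁻¹ ^ k := ENNReal.pow_pos (by simp) k
    obtain ⟨n, hn⟩ := ((h.eventually_le_const this).and (eventually_ge_atTop k)).exists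
    exact ⟨n, hn.2, hn.1⟩
  choose φ hφ1 hφ2 using h1
  refine ⟨φ, tendsto_atTop_mono hφ1 tendsto_id, ?_⟩
  have h2 : ∫⁻ x, ∑' k, f (φ k) x ∂μ ≠ ⊤ := by
    rw [lintegral_tsum fun k => hf (φ k)]
    refine ne_top_of_le_ne_top ?_ (ENNReal.tsum_le_tsum hφ2)
    rw [ENNReal.tsum_geometric]
    simp
  filter_upwards [ae_lt_top' (AEMeasurable.tsum fun k => hf (φ k)) h2] with x hx
  exact ENNReal.tendsto_atTop_zero_of_tsum_ne_top hx.ne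

lemma lintegral_le_of_ae_tendsto {X : Type*} [MeasurableSpace X] {μ : Measure X}
    {f : ℕ → X → ℝ≥0∞} {g : X → ℝ≥0∞} {b : ℝ≥0∞} (hf : ∀ n, AEMeasurable (f n) μ)
    (h : ∀ᵐ x ∂μ, Tendsto (fun n => f n x) atTop (𝓝 (g x)))
    (hb : ∀ᶠ n in atTop, ∫⁻ x, f n x ∂μ ≤ b) : ∫⁻ x, g x ∂μ ≤ b := by
  calc ∫⁻ x, g x ∂μ = ∫⁻ x, liminf (fun n => f n x) atTop ∂μ :=
        lintegral_congr_ae (h.mono fun x hx => hx.liminf_eq.symm)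
    _ ≤ liminf (fun n => ∫⁻ x, f n x ∂μ) atTop := lintegral_liminf_le' hf
    _ ≤ liminf (fun _ : ℕ => b) atTop := liminf_le_liminf hb
    _ = b := liminf_const b

lemma tendsto_enorm_sub_rpow {ι : Type*} {l : Filter ι} {f g : ι → ℝ} {a b q : ℝ}
    (hf : Tendsto f l (𝓝 a)) (hg : Tendsto g l (𝓝 b)) :
    Tendsto (fun i => ‖f i - g i‖ₑ ^ q) l (𝓝 (‖a - b‖ₑ ^ q)) :=
  (ENNReal.continuous_rpow_const.tendsto _).comp ((hf.sub hg).enorm)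

namespace ConeFace

variable {d : ℕ} {S G : Set (Eu d)} {n y₀ : Eu d} {α r h : ℝ}

/-- The inverse contractions move an interior point by an amount tending to zero. -/
lemma eventually_mem_shrink (y₀ : Eu d) {x : Eu d} (hx : x ∈ interior S) :
    ∀ᶠ m : ℕ in atTop, x ∈ shrink y₀ (1 / ((m : ℝ) + 1)) '' S := by
  have h1 : Tendsto (fun m : ℕ => (1 / ((m : ℝ) + 1))) atTop (𝓝 0) :=
    tendsto_one_div_add_atTop_nhds_zero_nat
  have h2 : Tendsto (fun m : ℕ => y₀ + (1 - 1 / ((m : ℝ) + 1))⁻¹ • (x - y₀)) atTop (𝓝 x) := by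
    have h3 : Tendsto (fun m : ℕ => (1 - 1 / ((m : ℝ) + 1))⁻¹) atTop (𝓝 1) := by
      simpa using (h1.const_sub 1).inv₀ (by norm_num)
    simpa using (h3.smul_const (x - y₀)).const_add y₀
  filter_upwards [h2.eventually (isOpen_interior.mem_nhds hx), h1.eventually_lt_const one_pos]
    with m hm hm1
  refine ⟨_, interior_subset hm, ?_⟩
  have : 1 - 1 / ((m : ℝ) + 1) ≠ 0 := by linarith
  simp only [shrink, add_sub_cancel_left, smul_inv_smul₀ this]
  abel

lemma ae_mem_interior (H : ConeFace S G n y₀ α r h) : ∀ᵐ x ∂volume.restrict S, x ∈ interior S := by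
  rw [← Measure.restrict_congr_set (interior_ae_eq_of_null_frontier
      (H.convS.addHaar_frontier volume))]
  exact ae_restrict_mem isOpen_interior.measurableSet

lemma convex_shrink_image (H : ConeFace S G n y₀ α r h) (τ : ℝ) :
    Convex ℝ (shrink y₀ τ '' S) := by
  rw [shrink_eq_homothety]
  exact H.convS.affine_image _

lemma shrink_image_subset_self (H : ConeFace S G n y₀ α r h) {τ : ℝ} (h0 : 0 ≤ τ) (h1 : τ ≤ 1) :
    shrink y₀ τ '' S ⊆ S := by
  rintro _ ⟨x, hx, rfl⟩
  exact shrink_mem H.convS H.center_mem hx h0 h1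

/-- The Poincaré inequality for Sobolev functions. -/
lemma poincare (H : ConeFace S G n y₀ α r h) {Ω : Set (Eu d)} (hΩ : IsOpen Ω)
    (hS : interior S ⊆ Ω) {u : Eu d → ℝ} {Du : Eu d → Fin d → ℝ} (hu : IntegrableOn u Ω)
    (hDu : ∀ j, IntegrableOn (fun x => Du x j) Ω)
    (hw : ∀ j, HasWeakPartial Ω u j (fun x => Du x j)) {q : ℝ} (hq : 1 ≤ q) :
    ∫⁻ x in S, ∫⁻ y in S, ‖u x - u y‖ₑ ^ q ≤
      ENNReal.ofReal h ^ q * (2 ^ d * (volume S * gradEnergy S q Du)) := by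
  obtain ⟨g, hgs, hgt, hgb⟩ := H.exists_smooth_approx hΩ hS hu hDu hw hq
  set C : ℕ → Set (Eu d) := fun m => shrink y₀ (1 / ((m : ℝ) + 1)) '' S with hC
  have hτ (m : ℕ) : (0 : ℝ) ≤ 1 / ((m : ℝ) + 1) ∧ 1 / ((m : ℝ) + 1) ≤ 1 :=
    ⟨by positivity, (div_le_one (by positivity)).2 (by linarith [m.cast_nonneg (α := ℝ)])⟩
  have hCS (m : ℕ) : C m ⊆ S := H.shrink_image_subset_self (hτ m).1 (hτ m).2
  have hCm (m : ℕ) : MeasurableSet (C m) := H.measurableSet_shrink_image _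
  -- The cutoff to contracted copies makes the smooth inequality applicable. It disappears in the
  -- limit, since almost every point of `S` is interior. Fatou's lemma is then used in `y` and in
  -- `x`.
  set f : ℕ → Eu d → Eu d → ℝ≥0∞ := fun m x y =>
    (C m).indicator (fun x => (C m).indicator (fun y => ‖g m x - g m y‖ₑ ^ q) y) x with hf
  have hfm (m : ℕ) : Measurable fun z : Eu d × Eu d => f m z.1 z.2 := by
    have e : (fun z : Eu d × Eu d => f m z.1 z.2) =
        (C m ×ˢ C m).indicator fun z => ‖g m z.1 - g m z.2‖ₑ ^ q := by
      ext z
      by_cases h1 : z.1 ∈ C m <;> by_cases h2 : z.2 ∈ C m <;>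
        simp [hf, Set.indicator, h1, h2]
    rw [e]
    refine Measurable.indicator ?_ ((hCm m).prod (hCm m))
    have := (hgs m).continuous.measurable
    exact ((this.comp measurable_fst).sub (this.comp measurable_snd)).enorm.pow_const q
  have hlim : ∀ᵐ x ∂volume.restrict S, ∀ᵐ y ∂volume.restrict S,
      Tendsto (fun m => f m x y) atTop (𝓝 (‖u x - u y‖ₑ ^ q)) := by
    filter_upwards [hgt, H.ae_mem_interior] with x hx hxi
    filter_upwards [hgt, H.ae_mem_interior] with y hy hyi
    refine (tendsto_enorm_sub_rpow hx hy).congr' ?_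
    filter_upwards [eventually_mem_shrink y₀ hxi, eventually_mem_shrink y₀ hyi] with m h1 h2
    simp only [hf]
    rw [Set.indicator_of_mem h1, Set.indicator_of_mem h2]
  have hbound (m : ℕ) : ∫⁻ x in S, ∫⁻ y in S, f m x y ≤
      ENNReal.ofReal h ^ q * (2 ^ d * (volume S * gradEnergy S q Du)) := by
    calc ∫⁻ x in S, ∫⁻ y in S, f m x y ≤ ∫⁻ x, ∫⁻ y, f m x y :=
          (setLIntegral_le_lintegral _ _).trans
            (lintegral_mono fun x => setLIntegral_le_lintegral _ _)
      _ = ∫⁻ x in C m, ∫⁻ y in C m, ‖g m x - g m y‖ₑ ^ q := by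
          rw [← lintegral_indicator (hCm m)]
          congr 1 with x
          by_cases hx : x ∈ C m
          · simp only [hf, Set.indicator_of_mem hx]
            rw [lintegral_indicator (hCm m)]
          · simp [hf, Set.indicator_of_notMem hx]
      _ ≤ _ := poincare_smooth (H.convex_shrink_image _) (hCm m)
          (fun x hx y hy => H.dist_le x (hCS m hx) y (hCS m hy)) hq (hgs m)
      _ ≤ _ := by
          gcongr
          · exact hCS m
          · exact hgb m
  calc ∫⁻ x in S, ∫⁻ y in S, ‖u x - u y‖ₑ ^ q
      ≤ ∫⁻ x in S, liminf (fun m => ∫⁻ y in S, f m x y) atTop := by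
        refine lintegral_mono_ae ?_
        filter_upwards [hlim] with x hx
        calc ∫⁻ y in S, ‖u x - u y‖ₑ ^ q = ∫⁻ y in S, liminf (fun m => f m x y) atTop :=
              lintegral_congr_ae (hx.mono fun y hy => hy.liminf_eq.symm)
          _ ≤ _ := lintegral_liminf_le fun m => (hfm m).comp (measurable_const.prodMk measurable_id)
    _ ≤ liminf (fun m => ∫⁻ x in S, ∫⁻ y in S, f m x y) atTop :=
        lintegral_liminf_le fun m => (hfm m).lintegral_prod_right'
    _ ≤ liminf (fun _ : ℕ => ENNReal.ofReal h ^ q * (2 ^ d * (volume S * gradEnergy S q Du)))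
          atTop := liminf_le_liminf (Eventually.of_forall hbound)
    _ = _ := liminf_const _

/-- On almost every slice the smooth approximations converge almost everywhere, and the smooth bound
with parameter `τ > 0` is available as soon as `1/(m+1) ≤ τ`. Two slices are involved, hence two
exceptional sets. -/
lemma ae_ae_lintegral_sub_shrink_le (H : ConeFace S G n y₀ α r h) {Ω : Set (Eu d)} (hΩ : IsOpen Ω)
    (hS : interior S ⊆ Ω) {u : Eu d → ℝ} {Du : Eu d → Fin d → ℝ} (hu : IntegrableOn u Ω)
    (hDu : ∀ j, IntegrableOn (fun x => Du x j) Ω)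
    (hw : ∀ j, HasWeakPartial Ω u j (fun x => Du x j)) {q : ℝ} (hq : 1 ≤ q) :
    ∀ᵐ τ ∂volume.restrict (Set.Ioo (0 : ℝ) (1 / 2)),
      ∀ᵐ t ∂volume.restrict (Set.Ioo (0 : ℝ) (1 / 2)), τ ≤ t →
        ∫⁻ x in G, ‖u (shrink y₀ τ x) - u (shrink y₀ t x)‖ₑ ^ q ∂μHE[d - 1] ≤
          ENNReal.ofReal h ^ q * (coneConst d r * gradEnergy S q Du) := by
  obtain ⟨g, hgs, hgt, hgb⟩ := H.exists_smooth_approx hΩ hS hu hDu hw hq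
  have hconv := H.ae_ae_shrink hgt
  filter_upwards [hconv, ae_restrict_mem measurableSet_Ioo] with τ hτ hτI
  filter_upwards [hconv, ae_restrict_mem measurableSet_Ioo] with t ht htI hτt
  refine lintegral_le_of_ae_tendsto
    (f := fun m x => ‖g m (shrink y₀ τ x) - g m (shrink y₀ t x)‖ₑ ^ q) (fun m => ?_) ?_ ?_
  · have := (hgs m).continuous.measurable
    exact (((this.comp (continuous_shrink y₀ τ).measurable).sub
      (this.comp (continuous_shrink y₀ t).measurable)).enorm.pow_const q).aemeasurable
  · filter_upwards [hτ, ht] with x h1 h2 using tendsto_enorm_sub_rpow h1 h2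
  · have h1 : Tendsto (fun m : ℕ => (1 / ((m : ℝ) + 1))) atTop (𝓝 0) :=
      tendsto_one_div_add_atTop_nhds_zero_nat
    filter_upwards [h1.eventually_le_const hτI.1] with m hm
    refine (H.lintegral_sub_shrink_le' hq (hgs m) hτI.1.le hτt htI.2.le).trans ?_
    gcongr
    exact (lintegral_mono_set (H.shrink_image_subset hm (by linarith [hτI.2]))).trans (hgb m)

/-- The trace inequality on almost all slices parallel to the face. -/
lemma ae_lintegral_shrink_sub_const_le (H : ConeFace S G n y₀ α r h) {Ω : Set (Eu d)}
    (hΩ : IsOpen Ω) (hS : interior S ⊆ Ω) {u : Eu d → ℝ} (hum : Measurable u)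
    {Du : Eu d → Fin d → ℝ} (hu : IntegrableOn u Ω)
    (hDu : ∀ j, IntegrableOn (fun x => Du x j) Ω)
    (hw : ∀ j, HasWeakPartial Ω u j (fun x => Du x j)) {q : ℝ} (hq : 1 ≤ q) (c : ℝ) :
    ∀ᵐ τ ∂volume.restrict (Set.Ioo (0 : ℝ) (1 / 2)), τ ≤ 1 / 4 →
        ∫⁻ x in G, ‖u (shrink y₀ τ x) - c‖ₑ ^ q ∂μHE[d - 1] ≤
          2 ^ (q + 1) * (ENNReal.ofReal h ^ q * (coneConst d r * gradEnergy S q Du) +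
            coneConst d r * ∫⁻ x in S, ‖u x - c‖ₑ ^ q) := by
  have := H.isFiniteMeasure
  filter_upwards [H.ae_ae_lintegral_sub_shrink_le hΩ hS hu hDu hw hq] with τ hτ hτ4
  set X := ENNReal.ofReal h ^ q * (coneConst d r * gradEnergy S q Du) with hX
  set L := ∫⁻ x in G, ‖u (shrink y₀ τ x) - c‖ₑ ^ q ∂μHE[d - 1] with hL
  set B : ℝ → ℝ≥0∞ := fun t => ∫⁻ x in G, ‖u (shrink y₀ t x) - c‖ₑ ^ q ∂μHE[d - 1] with hB
  have hq1 : (0 : ℝ) ≤ q := by linarith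
  have hsub : Set.Ioo (1 / 4 : ℝ) (1 / 2) ⊆ Set.Ioo 0 (1 / 2) :=
    Set.Ioo_subset_Ioo_left (by norm_num)
  -- As `τ ≤ 1/4`, every `t` in this interval lies beyond `τ`. Averaging over it replaces the second
  -- slice by a volume integral; the interval length `1/4` accounts for the factor 4 below.
  have h1 : ∀ᵐ t ∂volume.restrict (Set.Ioo (1 / 4 : ℝ) (1 / 2)),
      L ≤ 2 ^ (q - 1) * (X + B t) := by
    filter_upwards [ae_restrict_of_ae_restrict_of_subset hsub hτ,
      ae_restrict_mem measurableSet_Ioo] with t ht htI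
    have hm : Measurable fun x => ‖u (shrink y₀ t x) - c‖ₑ ^ q :=
      (((hum.comp (continuous_shrink y₀ t).measurable).sub_const c).enorm).pow_const q
    calc L ≤ ∫⁻ x in G, 2 ^ (q - 1) * (‖u (shrink y₀ τ x) - u (shrink y₀ t x)‖ₑ ^ q +
          ‖u (shrink y₀ t x) - c‖ₑ ^ q) ∂μHE[d - 1] := by
          refine lintegral_mono fun x => ?_
          refine le_trans ?_ (ENNReal.rpow_add_le_mul_rpow_add_rpow _ _ hq)
          gcongr
          rw [show u (shrink y₀ τ x) - c =
            (u (shrink y₀ τ x) - u (shrink y₀ t x)) + (u (shrink y₀ t x) - c) by ring]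
          exact enorm_add_le _ _
      _ = 2 ^ (q - 1) * (∫⁻ x in G, ‖u (shrink y₀ τ x) - u (shrink y₀ t x)‖ₑ ^ q ∂μHE[d - 1] +
          B t) := by
          rw [lintegral_const_mul' _ _ (ENNReal.rpow_ne_top_of_nonneg (by linarith) (by simp)),
            lintegral_add_right _ hm]
      _ ≤ _ := by
          gcongr
          exact ht (by linarith [htI.1])
  have h14 : ENNReal.ofReal (1 / 2 - 1 / 4) = 4⁻¹ := by
    rw [show (1 / 2 - 1 / 4 : ℝ) = 4⁻¹ by norm_num, ENNReal.ofReal_inv_of_pos (by norm_num)]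
    simp
  have h2q : (2 : ℝ≥0∞) ^ (q - 1) ≠ ⊤ := ENNReal.rpow_ne_top_of_nonneg (by linarith) (by simp)
  have h2 : L * 4⁻¹ ≤ 2 ^ (q - 1) * (X * 4⁻¹ + coneConst d r * ∫⁻ x in S, ‖u x - c‖ₑ ^ q) := by
    calc L * 4⁻¹ = ∫⁻ _ in Set.Ioo (1 / 4 : ℝ) (1 / 2), L := by
          rw [lintegral_const, Measure.restrict_apply_univ, Real.volume_Ioo, h14]
      _ ≤ ∫⁻ t in Set.Ioo (1 / 4 : ℝ) (1 / 2), 2 ^ (q - 1) * (X + B t) := lintegral_mono_ae h1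
      _ = 2 ^ (q - 1) * (X * 4⁻¹ + ∫⁻ t in Set.Ioo (1 / 4 : ℝ) (1 / 2), B t) := by
          rw [lintegral_const_mul' _ _ h2q, lintegral_add_left measurable_const, lintegral_const,
            Measure.restrict_apply_univ, Real.volume_Ioo, h14]
      _ ≤ _ := by
          gcongr
          refine (lintegral_mono_set hsub).trans ?_
          exact H.lintegral_shrink_le ((hum.sub_const c).enorm.pow_const q)
  have h44 : (4 : ℝ≥0∞)⁻¹ * 4 = 1 := ENNReal.inv_mul_cancel (by simp) (by simp)
  have e4 : (2 : ℝ≥0∞) ^ (q + 1) = 2 ^ (q - 1) * 4 := by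
    rw [show q + 1 = (q - 1) + 2 by ring, ENNReal.rpow_add _ _ (by simp) (by simp)]
    norm_num
  set Y := coneConst d r * ∫⁻ x in S, ‖u x - c‖ₑ ^ q
  calc L = L * 4⁻¹ * 4 := by rw [mul_assoc, h44, mul_one]
    _ ≤ 2 ^ (q - 1) * (X * 4⁻¹ + Y) * 4 := by gcongr
    _ = 2 ^ (q - 1) * (X * (4⁻¹ * 4) + Y * 4) := by ring
    _ = 2 ^ (q - 1) * (X + Y * 4) := by rw [h44, mul_one]
    _ ≤ 2 ^ (q - 1) * (X * 4 + Y * 4) := by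
        gcongr
        exact le_mul_of_one_le_right zero_le (by norm_num)
    _ = _ := by rw [e4]; ring

/-- The trace is the limit of the values on the slices parallel to the face. -/
lemma exists_ae_lintegral_sub_trace_le (H : ConeFace S G n y₀ α r h) {u tr : Eu d → ℝ}
    {Du : Eu d → Fin d → ℝ} (hum : Measurable u) (hDum : ∀ j, Measurable fun x => Du x j)
    {g : ℕ → Eu d → ℝ} (hg : ∀ m, ContDiff ℝ ∞ (g m))
    (h0 : Tendsto (fun m => ∫⁻ x in S, ‖g m x - u x‖ₑ) atTop (𝓝 0))
    (h1 : ∀ j, Tendsto (fun m => ∫⁻ x in S,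
      ‖fderiv ℝ (g m) x (EuclideanSpace.single j 1) - Du x j‖ₑ) atTop (𝓝 0))
    (h2 : Tendsto (fun m => ∫⁻ x in G, ‖g m x - tr x‖ₑ ∂μHE[d - 1]) atTop (𝓝 0))
    (hfin : ∀ j, ∫⁻ x in S, ‖Du x j‖ₑ ≠ ⊤) :
    ∃ E : ℝ → ℝ≥0∞, Tendsto E (𝓝[>] 0) (𝓝 0) ∧
      ∀ᵐ τ ∂volume.restrict (Set.Ioo (0 : ℝ) (1 / 2)),
        ∫⁻ x in G, ‖u (shrink y₀ τ x) - tr x‖ₑ ∂μHE[d - 1] ≤ E τ := by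
  have := H.isFiniteMeasure
  have hgm (m : ℕ) : Measurable (g m) := (hg m).continuous.measurable
  have hdm (m : ℕ) (j : Fin d) :
      Measurable fun x => fderiv ℝ (g m) x (EuclideanSpace.single j 1) :=
    (((hg m).continuous_fderiv (by simp)).clm_apply continuous_const).measurable
  have hsh (t : ℝ) : Measurable (shrink y₀ t) := (continuous_shrink y₀ t).measurable
  set A : ℕ → ℝ → ℝ≥0∞ := fun m t =>
    ∫⁻ x in G, ‖g m (shrink y₀ t x) - u (shrink y₀ t x)‖ₑ ∂μHE[d - 1] with hA
  set Φ : Fin d → ℝ → ℝ≥0∞ := fun j t => ∫⁻ x in G, ‖Du (shrink y₀ t x) j‖ₑ ∂μHE[d - 1] with hΦ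
  have hlm {f : Eu d → ℝ≥0∞} (hf : Measurable f) :
      Measurable fun t : ℝ => ∫⁻ x in G, f (shrink y₀ t x) ∂μHE[d - 1] :=
    Measurable.lintegral_prod_left' (f := fun z : Eu d × ℝ => f (shrink y₀ z.2 z.1))
      (hf.comp (continuous_shrink_uncurry y₀).measurable)
  have hAint : Tendsto (fun m => ∫⁻ t in Set.Ioo (0 : ℝ) (1 / 2), A m t) atTop (𝓝 0) := by
    refine tendsto_of_tendsto_of_tendsto_of_le_of_le tendsto_const_nhds
      (h := fun m => coneConst d r * ∫⁻ x in S, ‖g m x - u x‖ₑ) ?_ (fun _ => zero_le) fun m =>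
      H.lintegral_shrink_le ((hgm m).sub hum).enorm
    have := ENNReal.Tendsto.const_mul (a := coneConst d r) h0 (Or.inr (by simp [coneConst]))
    simpa using this
  -- Convergence in `L¹(S)` yields convergence on the slices only in the mean over `t`; a
  -- subsequence converges on almost every slice.
  obtain ⟨φ, hφ, hφA⟩ := exists_subseq_ae_tendsto_zero
    (fun m => (hlm ((hgm m).sub hum).enorm).aemeasurable) hAint
  -- The modulus is the integral of the gradient over the slices between the face and level `τ`; it
  -- tends to zero by absolute continuity of the integral.
  refine ⟨fun τ => ENNReal.ofReal h * (d * ∑ j, ∫⁻ t in Set.Ioo 0 τ, Φ j t), ?_, ?_⟩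
  · have hj (j : Fin d) : Tendsto (fun τ => ∫⁻ t in Set.Ioo 0 τ, Φ j t) (𝓝[>] 0) (𝓝 0) := by
      have hfinj : ∫⁻ t, (Set.Ioo (0 : ℝ) (1 / 2)).indicator (Φ j) t ≠ ⊤ := by
        rw [lintegral_indicator measurableSet_Ioo]
        refine ne_top_of_le_ne_top ?_ (H.lintegral_shrink_le (hDum j).enorm)
        exact ENNReal.mul_ne_top (by simp [coneConst]) (hfin j)
      have hvol : Tendsto (fun τ : ℝ => (volume : Measure ℝ) (Set.Ioo 0 τ)) (𝓝[>] 0) (𝓝 0) := by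
        simp only [Real.volume_Ioo, sub_zero]
        have : Tendsto ENNReal.ofReal (𝓝 0) (𝓝 (ENNReal.ofReal 0)) :=
          ENNReal.continuous_ofReal.tendsto 0
        rw [ENNReal.ofReal_zero] at this
        exact this.mono_left nhdsWithin_le_nhds
      refine (tendsto_setLIntegral_zero hfinj hvol).congr' ?_
      filter_upwards [Ioo_mem_nhdsGT (show (0 : ℝ) < 1 / 2 by norm_num)] with τ hτ
      refine setLIntegral_congr_fun measurableSet_Ioo fun t ht => ?_
      exact Set.indicator_of_mem (show t ∈ Set.Ioo (0 : ℝ) (1 / 2) from ⟨ht.1, ht.2.trans hτ.2⟩) _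
    have h3 := tendsto_finsetSum Finset.univ fun j _ => hj j
    have h4 := ENNReal.Tendsto.const_mul (a := (d : ℝ≥0∞)) h3 (Or.inr (by simp))
    have h5 := ENNReal.Tendsto.const_mul (a := ENNReal.ofReal h) h4 (Or.inr (by simp))
    simpa using h5
  · filter_upwards [hφA, ae_restrict_mem measurableSet_Ioo] with τ hτ hτI
    -- The chain of comparison is `u` on the slice, `g m` on the slice, `g m` on the face, and the
    -- trace. In the limit along the subsequence only the gradient of `u` between slice and face
    -- remains.
    have hbound (m : ℕ) : ∫⁻ x in G, ‖u (shrink y₀ τ x) - tr x‖ₑ ∂μHE[d - 1] ≤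
        A m τ + (ENNReal.ofReal h * (d * ∑ j, ((∫⁻ t in Set.Ioo 0 τ, Φ j t) +
          coneConst d r * ∫⁻ x in S,
            ‖fderiv ℝ (g m) x (EuclideanSpace.single j 1) - Du x j‖ₑ)) +
          ∫⁻ x in G, ‖g m x - tr x‖ₑ ∂μHE[d - 1]) := by
      have hm1 : Measurable fun x => ‖g m (shrink y₀ τ x) - u (shrink y₀ τ x)‖ₑ :=
        (((hgm m).sub hum).enorm).comp (hsh τ)
      have hm2 : Measurable fun x => ‖g m x - g m (shrink y₀ τ x)‖ₑ :=
        ((hgm m).sub ((hgm m).comp (hsh τ))).enorm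
      calc ∫⁻ x in G, ‖u (shrink y₀ τ x) - tr x‖ₑ ∂μHE[d - 1]
          ≤ ∫⁻ x in G, (‖g m (shrink y₀ τ x) - u (shrink y₀ τ x)‖ₑ +
              (‖g m x - g m (shrink y₀ τ x)‖ₑ + ‖g m x - tr x‖ₑ)) ∂μHE[d - 1] := by
            refine lintegral_mono fun x => ?_
            rw [show u (shrink y₀ τ x) - tr x = -(g m (shrink y₀ τ x) - u (shrink y₀ τ x)) +
              (-(g m x - g m (shrink y₀ τ x)) + (g m x - tr x)) by ring]
            refine (enorm_add_le _ _).trans ?_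
            rw [enorm_neg]
            gcongr
            refine (enorm_add_le _ _).trans ?_
            rw [enorm_neg]
        _ = A m τ + (∫⁻ x in G, ‖g m x - g m (shrink y₀ τ x)‖ₑ ∂μHE[d - 1] +
              ∫⁻ x in G, ‖g m x - tr x‖ₑ ∂μHE[d - 1]) := by
            rw [lintegral_add_left hm1, lintegral_add_left hm2]
        _ ≤ _ := by
            gcongr
            have h3 := H.lintegral_sub_shrink_le le_rfl (hg m) le_rfl hτI.1.le
              (by linarith [hτI.2])
            simp only [ENNReal.rpow_one, shrink_zero] at h3
            refine h3.trans ?_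
            gcongr
            have hmj (j : Fin d) (s : ℝ) : Measurable fun x =>
                ‖fderiv ℝ (g m) (shrink y₀ s x) (EuclideanSpace.single j 1)‖ₑ :=
              (hdm m j).enorm.comp (hsh s)
            calc ∫⁻ s in Set.Ioo 0 τ, ∫⁻ x in G, ‖fderiv ℝ (g m) (shrink y₀ s x)‖ₑ ∂μHE[d - 1]
                ≤ ∫⁻ s in Set.Ioo 0 τ, ∫⁻ x in G, d * ∑ j,
                  ‖fderiv ℝ (g m) (shrink y₀ s x) (EuclideanSpace.single j 1)‖ₑ ∂μHE[d - 1] := by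
                  refine lintegral_mono fun s => lintegral_mono fun x => ?_
                  simpa using opNorm_rpow_le (fderiv ℝ (g m) (shrink y₀ s x)) le_rfl
              _ = d * ∑ j, ∫⁻ s in Set.Ioo 0 τ, ∫⁻ x in G,
                  ‖fderiv ℝ (g m) (shrink y₀ s x) (EuclideanSpace.single j 1)‖ₑ ∂μHE[d - 1] := by
                  rw [← lintegral_finsetSum _ fun j _ => hlm (hdm m j).enorm,
                    ← lintegral_const_mul' _ _ (by simp)]
                  congr 1 with s
                  rw [lintegral_const_mul' _ _ (by simp),
                    lintegral_finsetSum _ fun j _ => hmj j s]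
              _ ≤ _ := by
                  refine mul_le_mul_right (Finset.sum_le_sum fun j _ => ?_) _
                  have hmd : Measurable fun x =>
                      ‖fderiv ℝ (g m) x (EuclideanSpace.single j 1) - Du x j‖ₑ :=
                    ((hdm m j).sub (hDum j)).enorm
                  calc ∫⁻ s in Set.Ioo 0 τ, ∫⁻ x in G,
                      ‖fderiv ℝ (g m) (shrink y₀ s x) (EuclideanSpace.single j 1)‖ₑ ∂μHE[d - 1]
                      ≤ ∫⁻ s in Set.Ioo 0 τ, (Φ j s + ∫⁻ x in G, ‖fderiv ℝ (g m) (shrink y₀ s x)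
                        (EuclideanSpace.single j 1) - Du (shrink y₀ s x) j‖ₑ ∂μHE[d - 1]) := by
                        refine lintegral_mono fun s => ?_
                        have hc : Measurable fun x => ‖Du (shrink y₀ s x) j‖ₑ :=
                          (hDum j).enorm.comp (hsh s)
                        simp only [hΦ]
                        rw [← lintegral_add_left hc]
                        refine lintegral_mono fun x => ?_
                        refine le_trans (le_of_eq ?_) (enorm_add_le _ _)
                        congr 1
                        simp
                    _ = (∫⁻ s in Set.Ioo 0 τ, Φ j s) + ∫⁻ s in Set.Ioo 0 τ, ∫⁻ x in G,
                        ‖fderiv ℝ (g m) (shrink y₀ s x)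
                        (EuclideanSpace.single j 1) - Du (shrink y₀ s x) j‖ₑ ∂μHE[d - 1] :=
                        lintegral_add_left (hlm (hDum j).enorm) _
                    _ ≤ _ := by
                        gcongr
                        exact (lintegral_mono_set (Set.Ioo_subset_Ioo_right hτI.2.le)).trans
                          (H.lintegral_shrink_le hmd)
    have hlim : Tendsto (fun k => A (φ k) τ + (ENNReal.ofReal h * (d * ∑ j,
        ((∫⁻ t in Set.Ioo 0 τ, Φ j t) + coneConst d r * ∫⁻ x in S,
            ‖fderiv ℝ (g (φ k)) x (EuclideanSpace.single j 1) - Du x j‖ₑ)) +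
          ∫⁻ x in G, ‖g (φ k) x - tr x‖ₑ ∂μHE[d - 1])) atTop
        (𝓝 (0 + (ENNReal.ofReal h * (d * ∑ j,
        ((∫⁻ t in Set.Ioo 0 τ, Φ j t) + coneConst d r * 0)) + 0))) := by
      refine hτ.add (Tendsto.add ?_ (h2.comp hφ))
      refine ENNReal.Tendsto.const_mul (ENNReal.Tendsto.const_mul
        (tendsto_finsetSum _ fun j _ => Tendsto.const_add _ ?_) (Or.inr (by simp)))
        (Or.inr (by simp))
      exact ENNReal.Tendsto.const_mul ((h1 j).comp hφ) (Or.inr (by simp [coneConst]))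
    simp only [zero_add, add_zero, mul_zero] at hlim
    exact ge_of_tendsto' hlim fun k => hbound (φ k)

end ConeFace

/-! ### The Frobenius norm -/

section Frob

variable {d : ℕ}

/-- A tensor as a vector of a Euclidean space. -/
def tenVec (A : Ten d) : EuclideanSpace ℝ (Fin d × Fin d) := WithLp.toLp 2 fun ij => A ij.1 ij.2

lemma frob_eq_norm (A : Ten d) : frob A = ‖tenVec A‖ := by
  rw [EuclideanSpace.norm_eq, frob, Fintype.sum_prod_type]
  simp [tenVec]

lemma frob_nonneg (A : Ten d) : 0 ≤ frob A := Real.sqrt_nonneg _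

lemma frob_sq (A : Ten d) : frob A ^ 2 = ∑ i, ∑ j, A i j ^ 2 :=
  Real.sq_sqrt (Finset.sum_nonneg fun _ _ => Finset.sum_nonneg fun _ _ => sq_nonneg _)

lemma frob_smul (c : ℝ) (A : Ten d) : frob (c • A) = |c| * frob A := by
  rw [frob_eq_norm, frob_eq_norm, show tenVec (c • A) = c • tenVec A from rfl, norm_smul,
    Real.norm_eq_abs]

lemma frob_sum_le {ι : Type*} (s : Finset ι) (A : ι → Ten d) :
    frob (∑ i ∈ s, A i) ≤ ∑ i ∈ s, frob (A i) := by
  classical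
  induction s using Finset.induction_on with
  | empty => simp [frob]
  | insert a s ha ih =>
    rw [Finset.sum_insert ha, Finset.sum_insert ha]
    have : frob (A a + ∑ i ∈ s, A i) ≤ frob (A a) + frob (∑ i ∈ s, A i) := by
      rw [frob_eq_norm, frob_eq_norm, frob_eq_norm]
      exact norm_add_le (tenVec (A a)) (tenVec (∑ i ∈ s, A i))
    linarith

lemma frob_vecMulVec (v n : Eu d) :
    frob (Matrix.vecMulVec (fun i => v i) n) = ‖v‖ * ‖n‖ := by
  rw [EuclideanSpace.norm_eq, EuclideanSpace.norm_eq, ← Real.sqrt_mul (by positivity), frob,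
    Finset.sum_mul_sum]
  simp [Matrix.vecMulVec_apply, mul_pow]

lemma abs_apply_le_frob (A : Ten d) (i j : Fin d) : |A i j| ≤ frob A := by
  rw [frob_eq_norm]
  exact PiLp.norm_apply_le (tenVec A) (i, j)

lemma frob_le_sum (A : Ten d) : frob A ≤ ∑ i, ∑ j, |A i j| := by
  refine Real.sqrt_le_iff.2 ⟨by positivity, ?_⟩
  rw [← Fintype.sum_prod_type' (f := fun i j => A i j ^ 2),
    ← Fintype.sum_prod_type' (f := fun i j => |A i j|)]
  calc ∑ x : Fin d × Fin d, A x.1 x.2 ^ 2 = ∑ x : Fin d × Fin d, |A x.1 x.2| ^ 2 := by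
        simp only [sq_abs]
    _ ≤ _ := Finset.sum_sq_le_sq_sum_of_nonneg fun _ _ => abs_nonneg _

lemma frob_sub_frob_sq_le (A B : Ten d) :
    (frob A - frob B) ^ 2 ≤ ∑ i, ∑ j, (A i j - B i j) ^ 2 := by
  have h1 : |frob A - frob B| ≤ ‖tenVec A - tenVec B‖ := by
    rw [frob_eq_norm, frob_eq_norm]
    exact abs_norm_sub_norm_le _ _
  have h2 : frob (A - B) = ‖tenVec A - tenVec B‖ := frob_eq_norm (A - B)
  rw [← h2] at h1
  have h3 := frob_sq (A - B)
  simp only [Matrix.sub_apply] at h3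
  rw [← h3, ← sq_abs (frob A - frob B)]
  gcongr

lemma measurable_frob {X : Type*} [MeasurableSpace X] {A : X → Ten d}
    (hA : ∀ i j, Measurable fun x => A x i j) : Measurable fun x => frob (A x) := by
  unfold frob
  exact (Finset.measurable_fun_sum _ fun i _ =>
    Finset.measurable_fun_sum _ fun j _ => (hA i j).pow_const 2).sqrt

lemma tendsto_frob {ι : Type*} {l : Filter ι} {A : ι → Ten d} {B : Ten d}
    (h : ∀ i j, Tendsto (fun k => A k i j) l (𝓝 (B i j))) :
    Tendsto (fun k => frob (A k)) l (𝓝 (frob B)) := by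
  unfold frob
  exact (Real.continuous_sqrt.tendsto _).comp (tendsto_finsetSum _ fun i _ =>
    tendsto_finsetSum _ fun j _ => (h i j).pow 2)

lemma symPart_eq_self {A : Ten d} (hA : A.IsSymm) : symPart A = A := by
  unfold symPart
  rw [hA.eq, ← two_smul ℝ A, smul_smul]
  norm_num

/-- For symmetric tensors `|F(A)|` is a function of `|A|`, so the reverse triangle inequality bounds
differences of `frobF` by differences of `F`. -/
lemma frob_F {p δ : ℝ} (hδ : 0 ≤ δ) {A : Ten d} (hA : A.IsSymm) :
    frob (F p δ A) = frobF p δ (frob A) := by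
  have h0 := frob_nonneg A
  rw [F, symPart_eq_self hA, frob_smul, abs_of_nonneg (by positivity), frobF]

lemma measurable_F {X : Type*} [MeasurableSpace X] {p δ : ℝ} {A : X → Ten d}
    (hA : ∀ i j, Measurable fun x => A x i j) (i j : Fin d) :
    Measurable fun x => F p δ (A x) i j := by
  have hs (i j : Fin d) : Measurable fun x => symPart (A x) i j := by
    simp only [symPart, Matrix.smul_apply, Matrix.add_apply, Matrix.transpose_apply]
    exact ((hA i j).add (hA j i)).const_smul (1 / 2 : ℝ)
  simp only [F, Matrix.smul_apply, smul_eq_mul]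
  exact (((measurable_frob hs).const_add δ).pow_const _).mul (hs i j)

end Frob

/-! ### Estimates on an element and its faces -/

namespace ConeFace

variable {d : ℕ} {S G : Set (Eu d)} {n y₀ : Eu d} {α r h : ℝ} {ι : Type*} [Fintype ι]

/-- Some value of a Sobolev function can replace its mean in the Poincaré inequality. -/
lemma exists_poincare_point (H : ConeFace S G n y₀ α r h) {Ω : Set (Eu d)} (hΩ : IsOpen Ω)
    (hS : interior S ⊆ Ω) {V : ι → Eu d → ℝ} {DV : ι → Eu d → Fin d → ℝ}
    (hVm : ∀ i, Measurable (V i)) (hV : ∀ i, IntegrableOn (V i) Ω)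
    (hDV : ∀ i j, IntegrableOn (fun x => DV i x j) Ω)
    (hw : ∀ i j, HasWeakPartial Ω (V i) j (fun x => DV i x j)) {q : ℝ} (hq : 1 ≤ q)
    {P : Eu d → Prop} (hP : ∀ᵐ x ∂volume.restrict S, P x) :
    ∃ y, P y ∧ ∑ i, ∫⁻ x in S, ‖V i x - V i y‖ₑ ^ q ≤
      ENNReal.ofReal h ^ q * (2 ^ d * ∑ i, gradEnergy S q (DV i)) := by
  have hm (i : ι) : Measurable fun z : Eu d × Eu d => ‖V i z.2 - V i z.1‖ₑ ^ q :=
    (((hVm i).comp measurable_snd).sub ((hVm i).comp measurable_fst)).enorm.pow_const q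
  have hm' (i : ι) : Measurable fun y => ∫⁻ x in S, ‖V i x - V i y‖ₑ ^ q :=
    (hm i).lintegral_prod_right'
  have : IsFiniteMeasure (volume.restrict S : Measure (Eu d)) :=
    ⟨by rw [Measure.restrict_apply_univ]; exact H.compS.measure_lt_top⟩
  have hne : (volume.restrict S : Measure (Eu d)) ≠ 0 := by
    rw [Ne, Measure.restrict_eq_zero]; exact H.volume_pos.ne'
  -- Some point does not exceed the average in `y` of the summed integrals, and it can avoid the
  -- null set where `P` fails. Summing first gives one point for all components.
  obtain ⟨y, hyP, hy⟩ := exists_notMem_null_le_laverage hne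
    (Finset.measurable_fun_sum Finset.univ fun i _ => hm' i).aemeasurable (ae_iff.1 hP)
  refine ⟨y, by simpa using hyP, hy.trans ?_⟩
  rw [setLAverage_eq, ENNReal.div_le_iff H.volume_pos.ne' H.compS.measure_lt_top.ne,
    lintegral_finsetSum _ fun i _ => hm' i]
  calc ∑ i, ∫⁻ y in S, ∫⁻ x in S, ‖V i x - V i y‖ₑ ^ q
      ≤ ∑ i, ENNReal.ofReal h ^ q * (2 ^ d * (volume S * gradEnergy S q (DV i))) := by
        refine Finset.sum_le_sum fun i _ => ?_
        refine le_trans (le_of_eq ?_) (H.poincare hΩ hS (hV i) (hDV i) (hw i) hq)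
        simp_rw [enorm_sub_rev]
    _ = _ := by
        rw [Finset.mul_sum, Finset.mul_sum, Finset.sum_mul]
        exact Finset.sum_congr rfl fun i _ => by ring

/-- Slices tending to the face and avoiding the exceptional sets converge to the traces in `L¹`; a
subsequence converges almost everywhere, for all components at once. -/
lemma exists_slices (y₀ : Eu d) {u tr : ι → Eu d → ℝ} {E : ι → ℝ → ℝ≥0∞}
    (hum : ∀ i, Measurable (u i))
    (htr : ∀ i, AEMeasurable (tr i) ((μHE[d - 1] : Measure (Eu d)).restrict G))
    (hE : ∀ i, Tendsto (E i) (𝓝[>] 0) (𝓝 0))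
    (hle : ∀ i, ∀ᵐ τ ∂volume.restrict (Set.Ioo (0 : ℝ) (1 / 2)),
        ∫⁻ x in G, ‖u i (shrink y₀ τ x) - tr i x‖ₑ ∂μHE[d - 1] ≤ E i τ)
    {P : ℝ → Prop} (hP : ∀ᵐ τ ∂volume.restrict (Set.Ioo (0 : ℝ) (1 / 2)), P τ) :
    ∃ τ : ℕ → ℝ, (∀ k, P (τ k) ∧ τ k ≤ 1 / 4) ∧
      ∀ᵐ x ∂((μHE[d - 1] : Measure (Eu d)).restrict G), ∀ i,
        Tendsto (fun k => u i (shrink y₀ (τ k) x)) atTop (𝓝 (tr i x)) := by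
  -- The offset 4 keeps every slice below `1/4`, as the trace inequality on slices requires.
  have hex (k : ℕ) : ∃ τ ∈ Set.Ioo (0 : ℝ) (1 / (k + 4)), P τ ∧
      ∀ i, ∫⁻ x in G, ‖u i (shrink y₀ τ x) - tr i x‖ₑ ∂μHE[d - 1] ≤ E i τ := by
    have hk : (0 : ℝ) < 1 / (k + 4) := by positivity
    have hsub : Set.Ioo (0 : ℝ) (1 / (k + 4)) ⊆ Set.Ioo 0 (1 / 2) :=
      Set.Ioo_subset_Ioo_right (by gcongr; linarith [k.cast_nonneg (α := ℝ)])
    have hne : NeBot (ae (volume.restrict (Set.Ioo (0 : ℝ) (1 / (k + 4))))) := by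
      rw [ae_neBot, Ne, Measure.restrict_eq_zero, Real.volume_Ioo]
      simpa using hk
    have h1 := ae_restrict_of_ae_restrict_of_subset hsub (hP.and (ae_all_iff.2 hle))
    obtain ⟨τ, h2, h3⟩ := (h1.and (ae_restrict_mem measurableSet_Ioo)).exists
    exact ⟨τ, h3, h2⟩
  choose τ hτI hτP hτE using hex
  have hτ0 : Tendsto τ atTop (𝓝[>] 0) := by
    refine tendsto_nhdsWithin_iff.2 ⟨?_, Eventually.of_forall fun k => (hτI k).1⟩
    refine squeeze_zero (fun k => (hτI k).1.le) (fun k => (hτI k).2.le) ?_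
    have := (tendsto_one_div_add_atTop_nhds_zero_nat (𝕜 := ℝ)).comp (tendsto_add_atTop_nat 3)
    refine this.congr fun k => ?_
    simp only [Function.comp, Nat.cast_add, Nat.cast_ofNat]
    ring
  have hsum : Tendsto (fun k => ∫⁻ x in G, ∑ i, ‖u i (shrink y₀ (τ k) x) - tr i x‖ₑ ∂μHE[d - 1])
      atTop (𝓝 0) := by
    have h1 : Tendsto (fun k => ∑ i, E i (τ k)) atTop (𝓝 (∑ _i : ι, 0)) :=
      tendsto_finsetSum _ fun i _ => (hE i).comp hτ0
    rw [Finset.sum_const_zero] at h1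
    refine tendsto_of_tendsto_of_tendsto_of_le_of_le tendsto_const_nhds h1 (fun _ => zero_le)
      fun k => ?_
    rw [lintegral_finsetSum' _ fun i _ => ?_]
    · exact Finset.sum_le_sum fun i _ => hτE k i
    · exact (((hum i).comp (continuous_shrink y₀ (τ k)).measurable).aemeasurable.sub (htr i)).enorm
  obtain ⟨φ, -, hφ⟩ := exists_subseq_ae_tendsto_zero (fun k =>
    Finset.aemeasurable_fun_sum _ fun i _ =>
      (((hum i).comp (continuous_shrink y₀ (τ k)).measurable).aemeasurable.sub (htr i)).enorm) hsum
  refine ⟨τ ∘ φ, fun k => ⟨hτP _, (hτI _).2.le.trans ?_⟩, ?_⟩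
  · gcongr
    linarith [(φ k).cast_nonneg (α := ℝ)]
  · filter_upwards [hφ] with x hx i
    rw [tendsto_iff_edist_tendsto_0]
    refine tendsto_of_tendsto_of_tendsto_of_le_of_le tendsto_const_nhds hx (fun _ => zero_le)
      fun k => ?_
    simp only [edist_eq_enorm_sub, Function.comp]
    exact Finset.single_le_sum
      (f := fun i => ‖u i (shrink y₀ (τ (φ k)) x) - tr i x‖ₑ) (fun _ _ => zero_le)
      (Finset.mem_univ i)

/-- The trace inequality for `F(A)`, where the trace of `A` is given. -/
lemma lintegral_frobF_trace_le (H : ConeFace S G n y₀ α r h) {Ω : Set (Eu d)} (hΩ : IsOpen Ω)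
    (hS : interior S ⊆ Ω) {p δ : ℝ} (hp : 1 < p) (hδ : 0 ≤ δ) {A : Eu d → Ten d}
    (hAm : ∀ i j, Measurable fun x => A x i j)
    (hsymm : ∀ᵐ x ∂volume.restrict S, (A x).IsSymm)
    {DV : Fin d × Fin d → Eu d → Fin d → ℝ}
    (hV : ∀ ij : Fin d × Fin d, IntegrableOn (fun x => F p δ (A x) ij.1 ij.2) Ω)
    (hDV : ∀ ij j, IntegrableOn (fun x => DV ij x j) Ω)
    (hw : ∀ (ij : Fin d × Fin d) j,
      HasWeakPartial Ω (fun x => F p δ (A x) ij.1 ij.2) j (fun x => DV ij x j))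
    {tr : Eu d → Ten d}
    (htr : ∀ ij : Fin d × Fin d, AEMeasurable (fun x => tr x ij.1 ij.2)
      ((μHE[d - 1] : Measure (Eu d)).restrict G))
    {E : Fin d × Fin d → ℝ → ℝ≥0∞} (hE : ∀ i, Tendsto (E i) (𝓝[>] 0) (𝓝 0))
    (hle : ∀ ij : Fin d × Fin d, ∀ᵐ τ ∂volume.restrict (Set.Ioo (0 : ℝ) (1 / 2)),
        ∫⁻ x in G, ‖A (shrink y₀ τ x) ij.1 ij.2 - tr x ij.1 ij.2‖ₑ ∂μHE[d - 1] ≤ E ij τ)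
    {y : Eu d} (hy : (A y).IsSymm) :
    ∫⁻ x in G, ENNReal.ofReal ((frobF p δ (frob (tr x)) - frobF p δ (frob (A y))) ^ 2) ∂μHE[d - 1] ≤
      2 ^ (3 : ℝ) * (ENNReal.ofReal h ^ (2 : ℝ) * (coneConst d r * ∑ ij, gradEnergy S 2 (DV ij)) +
        coneConst d r * ∑ ij : Fin d × Fin d,
          ∫⁻ x in S, ‖F p δ (A x) ij.1 ij.2 - F p δ (A y) ij.1 ij.2‖ₑ ^ (2 : ℝ)) := by
  have := H.isFiniteMeasure
  have hFm (ij : Fin d × Fin d) : Measurable fun x => F p δ (A x) ij.1 ij.2 :=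
    measurable_F hAm ij.1 ij.2
  have hP := (ae_all_iff.2 fun ij : Fin d × Fin d => H.ae_lintegral_shrink_sub_const_le hΩ hS
    (hFm ij) (hV ij) (hDV ij) (hw ij) one_le_two (F p δ (A y) ij.1 ij.2)).and (H.ae_ae_shrink hsymm)
  obtain ⟨τ, hτ, hlim⟩ := exists_slices y₀ (u := fun ij x => A x ij.1 ij.2)
    (tr := fun ij x => tr x ij.1 ij.2) (fun ij => hAm ij.1 ij.2) htr hE hle hP
  have hfm : Measurable fun x => frobF p δ (frob (A x)) := by
    unfold frobF
    exact (((measurable_frob hAm).const_add δ).pow_const _).mul (measurable_frob hAm)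
  -- No trace of `F(A)` is used. Along the slices `A` tends to its given trace almost everywhere,
  -- `frobF` is continuous, and Fatou's lemma carries over the bound valid on each slice.
  refine lintegral_le_of_ae_tendsto (f := fun k x => ENNReal.ofReal
    ((frobF p δ (frob (A (shrink y₀ (τ k) x))) - frobF p δ (frob (A y))) ^ 2)) (fun k => ?_) ?_
    (Eventually.of_forall fun k => ?_)
  · exact (((hfm.comp (continuous_shrink y₀ (τ k)).measurable).sub_const _).pow_const
      2).ennreal_ofReal.aemeasurable
  · filter_upwards [hlim] with x hx
    have h1 : Tendsto (fun k => frob (A (shrink y₀ (τ k) x))) atTop (𝓝 (frob (tr x))) :=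
      tendsto_frob fun i j => hx (i, j)
    have h2 : Tendsto (fun k => frobF p δ (frob (A (shrink y₀ (τ k) x)))) atTop
        (𝓝 (frobF p δ (frob (tr x)))) :=
      (continuousOn_frobF hp hδ _ (frob_nonneg _)).tendsto.comp
        (tendsto_nhdsWithin_iff.2 ⟨h1, Eventually.of_forall fun k => frob_nonneg _⟩)
    exact (ENNReal.continuous_ofReal.tendsto _).comp ((h2.sub_const _).pow 2)
  · obtain ⟨⟨h1, h2⟩, h3⟩ := hτ k
    have hm (ij : Fin d × Fin d) : Measurable fun x =>
        ‖F p δ (A (shrink y₀ (τ k) x)) ij.1 ij.2 - F p δ (A y) ij.1 ij.2‖ₑ ^ (2 : ℝ) :=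
      ((((hFm ij).comp (continuous_shrink y₀ (τ k)).measurable).sub_const _).enorm).pow_const 2
    calc _ ≤ ∫⁻ x in G, ∑ ij : Fin d × Fin d,
          ‖F p δ (A (shrink y₀ (τ k) x)) ij.1 ij.2 - F p δ (A y) ij.1 ij.2‖ₑ ^ (2 : ℝ)
            ∂μHE[d - 1] := by
          refine lintegral_mono_ae ?_
          filter_upwards [h2] with x hx
          rw [← frob_F hδ hx, ← frob_F hδ hy]
          refine (ENNReal.ofReal_le_ofReal (frob_sub_frob_sq_le _ _)).trans (le_of_eq ?_)
          rw [← Fintype.sum_prod_type' (f := fun i j =>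
            (F p δ (A (shrink y₀ (τ k) x)) i j - F p δ (A y) i j) ^ 2),
            ENNReal.ofReal_sum_of_nonneg fun _ _ => sq_nonneg _]
          refine Finset.sum_congr rfl fun ij _ => ?_
          rw [← ofReal_norm, Real.norm_eq_abs, ENNReal.ofReal_rpow_of_nonneg (abs_nonneg _)
            (by norm_num), Real.rpow_two, sq_abs]
      _ = ∑ ij : Fin d × Fin d, ∫⁻ x in G,
          ‖F p δ (A (shrink y₀ (τ k) x)) ij.1 ij.2 - F p δ (A y) ij.1 ij.2‖ₑ ^ (2 : ℝ)
            ∂μHE[d - 1] := lintegral_finsetSum _ fun ij _ => hm ij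
      _ ≤ ∑ ij : Fin d × Fin d, 2 ^ (3 : ℝ) * (ENNReal.ofReal h ^ (2 : ℝ) *
          (coneConst d r * gradEnergy S 2 (DV ij)) + coneConst d r *
          ∫⁻ x in S, ‖F p δ (A x) ij.1 ij.2 - F p δ (A y) ij.1 ij.2‖ₑ ^ (2 : ℝ)) := by
          refine Finset.sum_le_sum fun ij _ => ?_
          have := h1 ij h3
          norm_num at this ⊢
          exact this
      _ = _ := by
          rw [← Finset.mul_sum, Finset.sum_add_distrib, ← Finset.mul_sum, ← Finset.mul_sum,
            ← Finset.mul_sum]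

end ConeFace

/-! ### Simplices and their faces -/

section Simplex

variable {d : ℕ} {K γ : Finset (Eu d)}

lemma IsCell.affineSpan_eq_top (hK : IsCell K) : affineSpan ℝ (K : Set (Eu d)) = ⊤ := by
  have h := hK.2.affineSpan_eq_top_iff_card_eq_finrank_add_one.2
    (by simpa [finrank_euclideanSpace_fin] using hK.1)
  simpa using h

/-- The affine basis given by the vertices of a cell. -/
def IsCell.basis (hK : IsCell K) : AffineBasis K ℝ (Eu d) :=
  ⟨(↑), hK.2, by simpa using hK.affineSpan_eq_top⟩

lemma IsCell.basis_apply (hK : IsCell K) (a : K) : hK.basis a = a := rfl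

lemma IsCell.simplex_eq (hK : IsCell K) : simplex K = {x | ∀ a, 0 ≤ hK.basis.coord a x} := by
  have := hK.basis.convexHull_eq_nonneg_coord
  rw [← this, simplex]
  congr 1
  ext x
  simp [hK.basis_apply]

lemma isCompact_simplex (K : Finset (Eu d)) : IsCompact (simplex K) :=
  K.finite_toSet.isCompact_convexHull ℝ

lemma convex_simplex (K : Finset (Eu d)) : Convex ℝ (simplex K) := convex_convexHull ℝ _

lemma simplex_mono (h : γ ⊆ K) : simplex γ ⊆ simplex K :=
  convexHull_mono (Finset.coe_subset.2 h)

lemma IsCell.nonempty_interior (hK : IsCell K) : (interior (simplex K)).Nonempty :=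
  interior_convexHull_nonempty_iff_affineSpan_eq_top.2 hK.affineSpan_eq_top

open scoped Classical in
lemma exists_opposite_vertex (hK : IsCell K) (hγ : γ ⊆ K) (hc : γ.card = d) :
    ∃ v ∉ γ, insert v γ = K :=
  Finset.exists_eq_insert_iff.2 ⟨hγ, by rw [hc, hK.1]⟩

/-- The face spans directions of dimension `d - 1`, so its unit normal is unique up to sign. -/
lemma finrank_orthogonal_face (hK : IsCell K) (hγ : γ ⊆ K) (hc : γ.card = d) (hd : 0 < d) :
    Module.finrank ℝ (vectorSpan ℝ (γ : Set (Eu d)))ᗮ = 1 := by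
  have hind : AffineIndependent ℝ ((↑) : γ → Eu d) :=
    hK.2.mono (Finset.coe_subset.2 hγ)
  have h1 := hind.finrank_vectorSpan (n := d - 1) (by simp [hc]; omega)
  have e : Set.range ((↑) : γ → Eu d) = γ := by simp
  rw [e] at h1
  have h2 := (vectorSpan ℝ (γ : Set (Eu d))).finrank_add_finrank_orthogonal
  rw [finrank_euclideanSpace_fin] at h2
  omega

lemma mem_orthogonal_face_of_isOuterNormal {n : Eu d} (hn : IsOuterNormal K γ n) :
    n ∈ (vectorSpan ℝ (γ : Set (Eu d)))ᗮ := by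
  rw [Submodule.mem_orthogonal']
  intro u hu
  rw [vectorSpan_def] at hu
  induction hu using Submodule.span_induction with
  | mem x hx =>
    obtain ⟨a, ha, b, hb, rfl⟩ := hx
    exact hn.2.1 a ha b hb
  | zero => simp
  | add x y _ _ hx hy => rw [inner_add_right, hx, hy, add_zero]
  | smul c x _ hx => rw [inner_smul_right, hx, mul_zero]

/-- A nonzero vector orthogonal to the face is not orthogonal to `a₀ - v` for the opposite vertex
`v`: otherwise it would be orthogonal to all edges of `K`, which span the space. The sign of that
product fixes the orientation. -/
lemma exists_isOuterNormal (hK : IsCell K) (hγ : γ ⊆ K) (hc : γ.card = d) (hd : 0 < d) :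
    ∃ n, IsOuterNormal K γ n := by
  classical
  obtain ⟨v, hv, rfl⟩ := exists_opposite_vertex hK hγ hc
  set U := (vectorSpan ℝ (γ : Set (Eu d)))ᗮ
  have hU : Module.finrank ℝ U = 1 := finrank_orthogonal_face hK hγ hc hd
  obtain ⟨m, hm0⟩ := (Module.finrank_pos_iff_exists_ne_zero (R := ℝ) (M := U)).1 (by omega)
  have hm0' : (m : Eu d) ≠ 0 := by simpa using hm0
  have horth : ∀ a ∈ γ, ∀ b ∈ γ, inner ℝ (m : Eu d) (a - b) = 0 := fun a ha b hb =>
    (Submodule.mem_orthogonal' _ _).1 m.2 _ (vsub_mem_vectorSpan ℝ ha hb)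
  obtain ⟨a₀, ha₀⟩ : γ.Nonempty := Finset.card_pos.1 (by omega)
  have hne : inner ℝ (m : Eu d) (a₀ - v) ≠ 0 := by
    intro h0
    have htop : vectorSpan ℝ ((insert v γ : Finset (Eu d)) : Set (Eu d)) = ⊤ := by
      have := hK.2.vectorSpan_eq_top_of_card_eq_finrank_add_one
        (by simpa [finrank_euclideanSpace_fin] using hK.1)
      have e : Set.range ((↑) : ((insert v γ : Finset (Eu d)) : Set (Eu d)) → Eu d) =
          ((insert v γ : Finset (Eu d)) : Set (Eu d)) := Subtype.range_coe
      exact e ▸ this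
    have h1 : (m : Eu d) ∈ vectorSpan ℝ ((insert v γ : Finset (Eu d)) : Set (Eu d)) := by
      rw [htop]; trivial
    have ha₀' : a₀ ∈ ((insert v γ : Finset (Eu d)) : Set (Eu d)) := by simp [ha₀]
    rw [vectorSpan_eq_span_vsub_set_right ℝ ha₀'] at h1
    have h2 : ∀ u ∈ Submodule.span ℝ ((· -ᵥ a₀) '' ((insert v γ : Finset (Eu d)) : Set (Eu d))),
        inner ℝ (m : Eu d) u = 0 := by
      intro u hu
      induction hu using Submodule.span_induction with
      | mem x hx =>
        obtain ⟨a, ha, rfl⟩ := hx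
        rcases Finset.mem_insert.1 (Finset.mem_coe.1 ha) with rfl | ha
        · show inner ℝ (m : Eu d) (a - a₀) = 0
          rw [← neg_sub, inner_neg_right, h0, neg_zero]
        · exact horth a ha a₀ ha₀
      | zero => simp
      | add x y _ _ hx hy => rw [inner_add_right, hx, hy, add_zero]
      | smul c x _ hx => rw [inner_smul_right, hx, mul_zero]
    exact hm0' (inner_self_eq_zero.1 (h2 _ h1))
  have hmn : ‖(m : Eu d)‖ ≠ 0 := by simpa using hm0'
  set s : ℝ := ((SignType.sign (inner ℝ (m : Eu d) (a₀ - v)) : SignType) : ℝ) with hs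
  have hs1 : |s| = 1 := by
    rcases lt_or_gt_of_ne hne with h | h <;> simp [hs, h]
  refine ⟨(s * ‖(m : Eu d)‖⁻¹) • (m : Eu d), ?_, ?_, ?_⟩
  · rw [norm_smul, Real.norm_eq_abs, abs_mul, hs1, one_mul, abs_of_nonneg (by positivity),
      inv_mul_cancel₀ hmn]
  · intro a ha b hb
    rw [inner_smul_left, horth a ha b hb, mul_zero]
  · intro a ha w hw hwγ
    have hwv : w = v := by
      rcases Finset.mem_insert.1 hw with rfl | h
      · rfl
      · exact absurd h hwγ
    subst hwv
    have e : a - w = (a - a₀) + (a₀ - w) := by abel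
    rw [inner_smul_left, e, inner_add_right, horth a ha a₀ ha₀, zero_add]
    have h3 : s * inner ℝ (m : Eu d) (a₀ - w) = |inner ℝ (m : Eu d) (a₀ - w)| :=
      sign_mul_self _
    simp only [conj_trivial]
    rw [mul_comm s, mul_assoc, h3]
    exact mul_pos (by positivity) (abs_pos.2 hne)

lemma isOuterNormal_outerNormal (hK : IsCell K) (hγ : γ ⊆ K) (hc : γ.card = d) (hd : 0 < d) :
    IsOuterNormal K γ (outerNormal K γ) :=
  Classical.epsilon_spec (exists_isOuterNormal hK hγ hc hd)

lemma exists_forall_inner_eq {n : Eu d} (hn : IsOuterNormal K γ n) :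
    ∃ α : ℝ, ∀ a ∈ γ, inner ℝ n a = α := by
  rcases γ.eq_empty_or_nonempty with rfl | ⟨a₀, ha₀⟩
  · exact ⟨0, by simp⟩
  · refine ⟨inner ℝ n a₀, fun a ha => ?_⟩
    have := hn.2.1 a ha a₀ ha₀
    rw [inner_sub_right] at this
    linarith

lemma inner_eq_of_mem_face {n : Eu d} {α : ℝ} (hα : ∀ a ∈ γ, inner ℝ n a = α) {x : Eu d}
    (hx : x ∈ simplex γ) : inner ℝ n x = α := by
  have hconv : Convex ℝ {x : Eu d | inner ℝ n x = α} :=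
    convex_hyperplane (f := fun x => inner ℝ n x)
      ⟨fun x y => inner_add_right n x y, fun c x => by simp [inner_smul_right]⟩ α
  exact convexHull_min (fun a ha => hα a ha) hconv hx

lemma inner_le_of_mem_simplex {n : Eu d} {α : ℝ} (hn : IsOuterNormal K γ n) (hne : γ.Nonempty)
    (hα : ∀ a ∈ γ, inner ℝ n a = α) {x : Eu d} (hx : x ∈ simplex K) : inner ℝ n x ≤ α := by
  have hconv : Convex ℝ {x : Eu d | inner ℝ n x ≤ α} :=
    convex_halfSpace_le (f := fun x => inner ℝ n x)
      ⟨fun x y => inner_add_right n x y, fun c x => by simp [inner_smul_right]⟩ α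
  refine convexHull_min (fun a ha => ?_) hconv hx
  by_cases haγ : a ∈ γ
  · exact (hα a haγ).le
  · obtain ⟨b, hb⟩ := hne
    have := hn.2.2 b hb a ha haγ
    rw [inner_sub_right, hα b hb] at this
    show inner ℝ n a ≤ α
    linarith

lemma interior_simplex_face_eq_empty {n : Eu d} {α : ℝ} (hn : ‖n‖ = 1)
    (hα : ∀ a ∈ γ, inner ℝ n a = α) : interior (simplex γ) = ∅ := by
  rw [Set.eq_empty_iff_forall_notMem]
  intro x hx
  obtain ⟨ε, hε, hb⟩ := Metric.isOpen_iff.1 isOpen_interior x hx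
  have h1 : x + (ε / 2) • n ∈ simplex γ := interior_subset (hb (by
    rw [mem_ball_iff_norm, add_sub_cancel_left, norm_smul, hn, mul_one, Real.norm_of_nonneg
      (by positivity)]
    linarith))
  have h2 := inner_eq_of_mem_face hα h1
  rw [inner_add_right, inner_smul_right, real_inner_self_eq_norm_sq, hn,
    inner_eq_of_mem_face hα (interior_subset hx)] at h2
  linarith

lemma inradius_pos (hd : 0 < d) (hK : IsCell K) : 0 < inradius K := by
  obtain ⟨x, hx⟩ := hK.nonempty_interior
  obtain ⟨ε, hε, hb⟩ := Metric.isOpen_iff.1 isOpen_interior x hx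
  refine hε.trans_le (le_csSup ?_ ⟨x, hb.trans interior_subset⟩)
  refine ⟨Metric.diam (simplex K), fun r ⟨y, hy⟩ => ?_⟩
  rcases le_or_gt r 0 with h | h
  · exact h.trans Metric.diam_nonneg
  -- Positive dimension enters here: in a nontrivial space a ball of radius `r` has diameter `2r`,
  -- which bounds the admissible radii.
  have : Nonempty (Fin d) := ⟨⟨0, hd⟩⟩
  have h1 : Metric.diam (Metric.ball y r) = 2 * r := by
    exact Metric.diam_ball_eq y h.le
  have h2 := Metric.diam_mono hy (isCompact_simplex K).isBounded
  linarith

/-- A ball of more than half the inradius is taken, so attainment of the supremum is not needed;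
this is the origin of the factor 2. -/
lemma exists_ball_subset_simplex (hd : 0 < d) (hK : IsCell K) {ω₀ : ℝ} (hw : chunkiness K ≤ ω₀) :
    ∃ (y : Eu d) (r : ℝ), 0 < r ∧ Metric.ball y r ⊆ simplex K ∧
      Metric.diam (simplex K) ≤ 2 * ω₀ * r := by
  have h0 := inradius_pos hd hK
  have hne : {r : ℝ | ∃ x, Metric.ball x r ⊆ simplex K}.Nonempty := ⟨0, 0, by simp⟩
  obtain ⟨r, ⟨y, hy⟩, hr⟩ := exists_lt_of_lt_csSup hne (half_lt_self h0)
  replace hr : inradius K / 2 < r := hr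
  refine ⟨y, r, by linarith, hy, ?_⟩
  have h1 : Metric.diam (simplex K) ≤ ω₀ * inradius K := by
    rwa [chunkiness, div_le_iff₀ h0] at hw
  have hw0 : 0 ≤ ω₀ := (div_nonneg Metric.diam_nonneg h0.le).trans hw
  have h2 : ω₀ * inradius K ≤ ω₀ * (2 * r) := by
    gcongr
    linarith
  linarith

/-- Each slice parallel to `γ` lies in a copy of `γ` contracted towards the opposite vertex, and the
levels fill an interval of length at most the diameter. -/
lemma volume_simplex_le (hK : IsCell K) (hγ : γ ⊆ K) (hc : γ.card = d) (hd : 0 < d) {n : Eu d}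
    (hn : IsOuterNormal K γ n) :
    volume (simplex K) ≤ ENNReal.ofReal (Metric.diam (simplex K)) * μHE[d - 1] (simplex γ) := by
  classical
  obtain ⟨v, hv, hvK⟩ := exists_opposite_vertex hK hγ hc
  obtain ⟨α, hα⟩ := exists_forall_inner_eq hn
  obtain ⟨a₀, ha₀⟩ : γ.Nonempty := Finset.card_pos.1 (by omega)
  have hvm : v ∈ K := hvK ▸ Finset.mem_insert_self v γ
  set β := inner ℝ n v with hβ
  have hβα : β < α := by
    have := hn.2.2 a₀ ha₀ v hvm hv
    rw [inner_sub_right, hα a₀ ha₀] at this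
    linarith
  have hlen : α - β ≤ Metric.diam (simplex K) := by
    have h1 : α - β = inner ℝ n (a₀ - v) := by rw [inner_sub_right, hα a₀ ha₀]
    have h2 : dist a₀ v ≤ Metric.diam (simplex K) :=
      Metric.dist_le_diam_of_mem (isCompact_simplex K).isBounded
        (subset_convexHull ℝ _ (hγ ha₀)) (subset_convexHull ℝ _ hvm)
    rw [h1]
    refine (real_inner_le_norm _ _).trans ?_
    rwa [hn.1, one_mul, ← dist_eq_norm]
  have hx : ∀ x ∈ simplex K, ∃ l ∈ Set.Icc (0 : ℝ) 1, ∃ g ∈ simplex γ,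
      x = v + l • (g - v) := by
    intro x hx
    rw [simplex, ← hvK, Finset.coe_insert, convexHull_insert ⟨a₀, ha₀⟩, mem_convexJoin] at hx
    obtain ⟨v', hv', g, hg, hx⟩ := hx
    rw [Set.mem_singleton_iff.1 hv', segment_eq_image'] at hx
    obtain ⟨l, hl, rfl⟩ := hx
    exact ⟨l, hl, g, hg, rfl⟩
  rw [volume_eq_lintegral_slices hn.1 (isCompact_simplex K).measurableSet]
  have hslice : ∀ᵐ s : ℝ, μHE[d - 1] (simplex K ∩ {x | inner ℝ n x = s}) ≤
      (Set.Icc β α).indicator (fun _ => μHE[d - 1] (simplex γ)) s := by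
    -- At the level of the opposite vertex the ratio of the homothety is zero, so this single level
    -- is discarded.
    have hne : ∀ᵐ s : ℝ, s ≠ β := Measure.ae_ne volume β
    filter_upwards [hne] with s hs
    have hval : ∀ x ∈ simplex K, inner ℝ n x = s → ∃ g ∈ simplex γ,
        s ∈ Set.Icc β α ∧ x = v + ((s - β) / (α - β)) • (g - v) := by
      intro x hxK hxs
      obtain ⟨l, hl, g, hg, rfl⟩ := hx x hxK
      rw [inner_add_right, inner_smul_right, inner_sub_right, inner_eq_of_mem_face hα hg] at hxs
      have h1 : s - β = l * (α - β) := by rw [← hxs]; ring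
      refine ⟨g, hg, ⟨?_, ?_⟩, ?_⟩
      · nlinarith [hl.1]
      · nlinarith [hl.2]
      · rw [h1, mul_div_cancel_right₀ _ (by linarith)]
    by_cases hsI : s ∈ Set.Icc β α
    · rw [Set.indicator_of_mem hsI]
      set c := (s - β) / (α - β) with hcdef
      have hc0 : c ≠ 0 := div_ne_zero (sub_ne_zero.2 hs) (by linarith)
      have hc1 : |c| ≤ 1 := by
        rw [abs_of_nonneg (div_nonneg (by linarith [hsI.1]) (by linarith)),
          div_le_one (by linarith)]
        linarith [hsI.2]
      have hsub : simplex K ∩ {x | inner ℝ n x = s} ⊆ AffineMap.homothety v c '' simplex γ := by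
        rintro x ⟨hxK, hxs⟩
        obtain ⟨g, hg, -, rfl⟩ := hval x hxK hxs
        refine ⟨g, hg, ?_⟩
        simp [AffineMap.homothety_apply, add_comm]
      refine (measure_mono hsub).trans ?_
      rw [euclideanHausdorffMeasure_homothety_image _ _ hc0, ENNReal.smul_def, smul_eq_mul]
      refine mul_le_of_le_one_left zero_le ?_
      rw [ENNReal.coe_pow]
      refine pow_le_one₀ zero_le ?_
      have : ‖c‖₊ ≤ 1 := by rw [← NNReal.coe_le_coe]; simpa using hc1
      exact_mod_cast this
    · have : simplex K ∩ {x | inner ℝ n x = s} = ∅ := by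
        rw [Set.eq_empty_iff_forall_notMem]
        rintro x ⟨hxK, hxs⟩
        obtain ⟨g, hg, hI, -⟩ := hval x hxK hxs
        exact hsI hI
      simp [this]
  refine (lintegral_mono_ae hslice).trans ?_
  rw [lintegral_indicator measurableSet_Icc, setLIntegral_const, Real.volume_Icc, mul_comm]
  gcongr

/-- A cell of a shape regular triangulation with one of its faces. -/
lemma IsCell.coneFace (hd : 0 < d) (hK : IsCell K) (hγ : γ ⊆ K) (hc : γ.card = d) {y : Eu d}
    {r : ℝ} (hr : 0 < r) (hb : Metric.ball y r ⊆ simplex K) :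
    ∃ n α, ConeFace (simplex K) (simplex γ) n y α r (Metric.diam (simplex K)) := by
  have hn := isOuterNormal_outerNormal hK hγ hc hd
  obtain ⟨α, hα⟩ := exists_forall_inner_eq hn
  exact ⟨_, α,
    { compS := isCompact_simplex K
      convS := convex_simplex K
      compG := isCompact_simplex γ
      sub := simplex_mono hγ
      norm_n := hn.1
      onG := fun x hx => inner_eq_of_mem_face hα hx
      onS := fun x hx => inner_le_of_mem_simplex hn (Finset.card_pos.1 (by omega)) hα hx
      ball := hb
      r_pos := hr
      dist_le := fun x hx y hy => Metric.dist_le_diam_of_mem (isCompact_simplex K).isBounded hx hy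
      vol_le := volume_simplex_le hK hγ hc hd hn }⟩

/-- Near a relative interior point of a face, a cell is a half-space. -/
lemma exists_forall_mem_simplex (hK : IsCell K) (hγ : γ ⊆ K) (hc : γ.card = d) {n : Eu d} {α : ℝ}
    (hn : IsOuterNormal K γ n) (hα : ∀ a ∈ γ, inner ℝ n a = α) {c : Eu d}
    (hcγ : ∀ a : K, a.1 ∈ γ → 0 < hK.basis.coord a c) (hd : 0 < d) :
    ∀ᶠ x in 𝓝 c, inner ℝ n x ≤ α → x ∈ simplex K := by
  classical
  obtain ⟨v, hv, hvK⟩ := exists_opposite_vertex hK hγ hc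
  obtain ⟨a₀, ha₀⟩ : γ.Nonempty := Finset.card_pos.1 (by omega)
  have hvm : v ∈ K := hvK ▸ Finset.mem_insert_self v γ
  have h1 : ∀ a : K, a.1 ∈ γ → ∀ᶠ x in 𝓝 c, 0 < hK.basis.coord a x := fun a ha =>
    ((continuous_barycentric_coord hK.basis a).tendsto c).eventually_const_lt (hcγ a ha)
  have h2 : ∀ᶠ x in 𝓝 c, ∀ a : K, a.1 ∈ γ → 0 < hK.basis.coord a x := by
    rw [eventually_all]
    intro a
    by_cases ha : a.1 ∈ γ
    · filter_upwards [h1 a ha] with x hx _ using hx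
    · exact Eventually.of_forall fun x h => absurd h ha
  filter_upwards [h2] with x hx hxα
  rw [hK.simplex_eq]
  intro a
  by_cases ha : a.1 ∈ γ
  · exact (hx a ha).le
  · have hlin := hK.basis.linear_combination_coord_eq_self x
    have hsum := hK.basis.sum_coord_apply_eq_one x
    have hval : ∀ b : K, b ≠ a → inner ℝ n (b : Eu d) = α := by
      intro b hb
      apply hα
      by_contra hbγ
      have e : ∀ w : K, w.1 ∉ γ → w.1 = v := fun w hw => by
        have : w.1 ∈ insert v γ := by rw [hvK]; exact w.2
        exact (Finset.mem_insert.1 this).resolve_right hw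
      exact hb (Subtype.ext ((e b hbγ).trans (e a ha).symm))
    have hinner : inner ℝ n x = ∑ b : K, hK.basis.coord b x * inner ℝ n (b : Eu d) := by
      conv_lhs => rw [← hlin]
      rw [inner_sum]
      simp [inner_smul_right, hK.basis_apply]
    have hpos := hn.2.2 a₀ ha₀ a a.2 ha
    rw [inner_sub_right, hα a₀ ha₀] at hpos
    rw [← Finset.add_sum_erase _ _ (Finset.mem_univ a)] at hinner hsum
    have e2 : ∑ b ∈ Finset.univ.erase a, hK.basis.coord b x * inner ℝ n (b : Eu d) =
        (∑ b ∈ Finset.univ.erase a, hK.basis.coord b x) * α := by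
      rw [Finset.sum_mul]
      exact Finset.sum_congr rfl fun b hb => by rw [hval b (Finset.ne_of_mem_erase hb)]
    have e3 : ∑ b ∈ Finset.univ.erase a, hK.basis.coord b x = 1 - hK.basis.coord a x := by linarith
    rw [e2, e3] at hinner
    by_contra hneg
    push Not at hneg
    nlinarith

end Simplex

/-! ### Triangulations -/

/-- Immediately below a boundary point there is an open set disjoint from `Ω`, namely the points
strictly under the Lipschitz graph. So `Ω` has no slits, and open cells lie in `Ω`. -/
lemma interior_closure_subset_of_hasLipschitzBoundary {d : ℕ} {Ω : Set (Eu d)} (ho : IsOpen Ω)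
    (hΩ : HasLipschitzBoundary Ω) : interior (closure Ω) ⊆ Ω := by
  intro x hx
  by_contra hxΩ
  have hxf : x ∈ frontier Ω := by
    rw [ho.frontier_eq]
    exact ⟨interior_subset hx, hxΩ⟩
  obtain ⟨e, he, r, hr, L, g, hg, hiff⟩ := hΩ x hxf
  have h1 : inner ℝ e x ≤ g (x - inner ℝ e x • e) :=
    not_lt.1 fun h => hxΩ ((hiff x (Metric.mem_ball_self hr)).2 h)
  obtain ⟨ε, hε, hb⟩ := Metric.isOpen_iff.1 isOpen_interior x hx
  set t := min ε r / 2 with ht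
  have ht0 : 0 < t := by positivity
  have hmin : t < min ε r := half_lt_self (by positivity)
  have hdist : dist (x - t • e) x = t := by
    rw [dist_eq_norm, sub_sub_cancel_left, norm_neg, norm_smul, he, mul_one,
      Real.norm_of_nonneg ht0.le]
  have hee : inner ℝ e e = (1 : ℝ) := by rw [real_inner_self_eq_norm_sq, he, one_pow]
  have hin : inner ℝ e (x - t • e) = inner ℝ e x - t := by
    rw [inner_sub_right, inner_smul_right, hee, mul_one]
  have hy : x - t • e ∈ closure Ω := interior_subset (hb (by
    rw [Metric.mem_ball, hdist]; exact hmin.trans_le (min_le_left _ _)))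
  have hcont : Continuous fun y : Eu d => g (y - inner ℝ e y • e) := by
    have := hg.continuous
    fun_prop
  have hopen : IsOpen (Metric.ball x r ∩ {y | inner ℝ e y < g (y - inner ℝ e y • e)}) :=
    Metric.isOpen_ball.inter (isOpen_lt (by fun_prop) hcont)
  have hmem : x - t • e ∈ Metric.ball x r ∩ {y | inner ℝ e y < g (y - inner ℝ e y • e)} := by
    refine ⟨by rw [Metric.mem_ball, hdist]; exact hmin.trans_le (min_le_right _ _), ?_⟩
    show inner ℝ e (x - t • e) < g (x - t • e - inner ℝ e (x - t • e) • e)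
    have e1 : x - t • e - (inner ℝ e x - t) • e = x - inner ℝ e x • e := by
      rw [sub_smul]; abel
    rw [hin, e1]
    linarith
  obtain ⟨y, ⟨hyb, hylt⟩, hyΩ⟩ := mem_closure_iff.1 hy _ hopen hmem
  exact lt_asymm hylt ((hiff y hyb).1 hyΩ)

lemma IsCell.exists_face {d : ℕ} {K σ : Finset (Eu d)} (hK : IsCell K) (hσ : σ ⊆ K)
    (hc : σ.card ≤ d) : ∃ γ, σ ⊆ γ ∧ γ ⊆ K ∧ γ.card = d :=
  Finset.exists_subsuperset_card_eq hσ hc (by rw [hK.1]; omega)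

lemma IsCell.interior_simplex_eq_empty {d : ℕ} {K σ : Finset (Eu d)} (hd : 0 < d) (hK : IsCell K)
    (hσ : σ ⊆ K) (hc : σ.card ≤ d) : interior (simplex σ) = ∅ := by
  obtain ⟨γ, hσγ, hγ, hγc⟩ := hK.exists_face hσ hc
  have hn := isOuterNormal_outerNormal hK hγ hγc hd
  obtain ⟨α, hα⟩ := exists_forall_inner_eq hn
  exact Set.subset_empty_iff.1 ((interior_mono (simplex_mono hσγ)).trans
    (interior_simplex_face_eq_empty hn.1 hα).subset)

lemma volume_frontier_simplex {d : ℕ} (K : Finset (Eu d)) :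
    volume (frontier (simplex K)) = 0 := (convex_simplex K).addHaar_frontier volume

lemma IsCell.coord_eq_zero {d : ℕ} {K : Finset (Eu d)} (hK : IsCell K) {a b : K} (h : a ≠ b) :
    hK.basis.coord a b.1 = 0 := by
  rw [← hK.basis_apply b]
  exact hK.basis.coord_apply_ne h

/-- The barycentre of a face has positive barycentric coordinates. -/
lemma IsCell.coord_barycenter {d : ℕ} {K γ : Finset (Eu d)} (hK : IsCell K) (hγ : γ ⊆ K)
    (hc : γ.card = d) (hd : 0 < d) (a : K) (ha : a.1 ∈ γ) :
    0 < hK.basis.coord a (∑ b ∈ γ, (d : ℝ)⁻¹ • b) := by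
  classical
  have hd' : (d : ℝ) ≠ 0 := by positivity
  set u : K → ℝ := fun b => if b.1 ∈ γ then (d : ℝ)⁻¹ else 0 with hu
  have hsum : ∑ b, u b = 1 := by
    rw [Finset.sum_coe_sort K (fun b => if b ∈ γ then (d : ℝ)⁻¹ else 0), Finset.sum_ite_mem,
      Finset.inter_eq_right.2 hγ, Finset.sum_const, hc, nsmul_eq_mul, mul_inv_cancel₀ hd']
  have hcomb : Finset.univ.affineCombination ℝ hK.basis u = ∑ b ∈ γ, (d : ℝ)⁻¹ • b := by
    rw [Finset.affineCombination_eq_linear_combination _ _ _ hsum]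
    have : ∀ b : K, u b • hK.basis b = (fun b : Eu d => if b ∈ γ then (d : ℝ)⁻¹ • b else 0) b := by
      intro b
      simp only [hu, hK.basis_apply]
      split_ifs <;> simp
    rw [Finset.sum_congr rfl fun b _ => this b,
      Finset.sum_coe_sort K (fun b => if b ∈ γ then (d : ℝ)⁻¹ • b else 0), Finset.sum_ite_mem,
      Finset.inter_eq_right.2 hγ]
  rw [← hcomb, hK.basis.coord_apply_combination_of_mem (Finset.mem_univ a) hsum]
  simp only [hu, ha, if_true]
  positivity

lemma barycenter_mem_simplex {d : ℕ} {γ : Finset (Eu d)} (hc : γ.card = d) (hd : 0 < d) :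
    ∑ b ∈ γ, (d : ℝ)⁻¹ • b ∈ simplex γ := by
  have hd' : (d : ℝ) ≠ 0 := by positivity
  refine (convex_convexHull ℝ _).sum_mem (fun _ _ => by positivity) ?_
    fun b hb => subset_convexHull ℝ _ hb
  rw [Finset.sum_const, hc, nsmul_eq_mul, mul_inv_cancel₀ hd']

namespace Triangulation

variable {d : ℕ} {Ω : Set (Eu d)} (T : Triangulation Ω) {K K' γ : Finset (Eu d)}

lemma simplex_subset_closure (hK : K ∈ T.cells) : simplex K ⊆ closure Ω := by
  rw [← T.cover]
  exact Set.subset_biUnion_of_mem (u := fun K => simplex K) hK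

lemma interior_simplex_subset (hΩ : IsPolyhedralLipschitzDomain Ω) (hK : K ∈ T.cells) :
    interior (simplex K) ⊆ Ω :=
  (interior_mono (T.simplex_subset_closure hK)).trans
    (interior_closure_subset_of_hasLipschitzBoundary hΩ.isOpen hΩ.lipschitz)

lemma diam_le_meshSize (hK : K ∈ T.cells) : Metric.diam (simplex K) ≤ T.meshSize :=
  le_ciSup (f := fun K : T.cells => Metric.diam (simplex (K : Finset (Eu d))))
    (Set.finite_range _).bddAbove ⟨K, hK⟩

open scoped Classical in
lemma card_inter_le (hK : K ∈ T.cells) (hK' : K' ∈ T.cells) (hne : K ≠ K') :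
    (K ∩ K').card ≤ d := by
  by_contra h
  push Not at h
  have h1 := (T.isCell K hK).1
  have h2 := (T.isCell K' hK').1
  have e1 : K ∩ K' = K := Finset.eq_of_subset_of_card_le Finset.inter_subset_left (by omega)
  have e2 : K ∩ K' = K' := Finset.eq_of_subset_of_card_le Finset.inter_subset_right (by omega)
  exact hne (e1.symm.trans e2)

open scoped Classical in
lemma simplex_inter (hK : K ∈ T.cells) (hK' : K' ∈ T.cells) :
    simplex K ∩ simplex K' = simplex (K ∩ K') := by
  rw [T.conforming K hK K' hK', simplex, Finset.coe_inter]

/-- Distinct cells share at most `d` vertices, so the vertices of `γ` are all of the common ones. -/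
lemma simplex_inter_eq_face (hK : K ∈ T.cells) (hK' : K' ∈ T.cells) (hne : K ≠ K') (hγ : γ ⊆ K)
    (hγ' : γ ⊆ K') (hc : γ.card = d) : simplex K ∩ simplex K' = simplex γ := by
  classical
  rw [T.simplex_inter hK hK', ← Finset.eq_of_subset_of_card_le (Finset.subset_inter hγ hγ')
    (by rw [hc]; exact T.card_inter_le hK hK' hne)]

lemma disjoint_interior (hd : 0 < d) (hK : K ∈ T.cells) (hK' : K' ∈ T.cells) (hne : K ≠ K') :
    Disjoint (interior (simplex K)) (interior (simplex K')) := by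
  classical
  rw [Set.disjoint_iff_inter_eq_empty, ← interior_inter, T.simplex_inter hK hK']
  exact (T.isCell K hK).interior_simplex_eq_empty hd Finset.inter_subset_left
    (T.card_inter_le hK hK' hne)

lemma simplex_ae_eq_interior (K : Finset (Eu d)) :
    simplex K =ᵐ[volume] interior (simplex K) :=
  (interior_ae_eq_of_null_frontier (volume_frontier_simplex K)).symm

lemma simplex_ae_le (hΩ : IsPolyhedralLipschitzDomain Ω) (hK : K ∈ T.cells) :
    simplex K ≤ᵐ[volume] Ω :=
  (simplex_ae_eq_interior K).le.trans (T.interior_simplex_subset hΩ hK).eventuallyLE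

lemma restrict_simplex_le (hΩ : IsPolyhedralLipschitzDomain Ω) (hK : K ∈ T.cells) :
    volume.restrict (simplex K) ≤ volume.restrict Ω :=
  Measure.restrict_mono' (T.simplex_ae_le hΩ hK) le_rfl

/-- The interiors of the cells are disjoint, and the boundaries are null sets. -/
lemma sum_lintegral_simplex_le (hd : 0 < d) (hΩ : IsPolyhedralLipschitzDomain Ω)
    (f : Eu d → ℝ≥0∞) : ∑ K ∈ T.cells, ∫⁻ x in simplex K, f x ≤ ∫⁻ x in Ω, f x := by
  have h : ∀ K : Finset (Eu d), ∫⁻ x in simplex K, f x = ∫⁻ x in interior (simplex K), f x :=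
    fun K => setLIntegral_congr (simplex_ae_eq_interior K)
  simp only [h]
  rw [← lintegral_biUnion_finset (fun K hK K' hK' hne => T.disjoint_interior hd hK hK' hne)
    (fun K _ => isOpen_interior.measurableSet)]
  exact lintegral_mono_set (Set.iUnion₂_subset fun K hK => T.interior_simplex_subset hΩ hK)

/-- The two normals are unit vectors on one line. If they were equal, both cells would lie on the
same side of `γ`. Points near the barycentre of `γ`, moved towards the opposite vertex of `K'`,
would then belong to both cells without lying on `γ`, against conformity. -/
lemma outerNormal_eq_neg (hd : 0 < d) (hK : K ∈ T.cells) (hK' : K' ∈ T.cells) (hne : K ≠ K')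
    (hγ : γ ⊆ K) (hγ' : γ ⊆ K') (hc : γ.card = d) : outerNormal K' γ = -outerNormal K γ := by
  have hn := isOuterNormal_outerNormal (T.isCell K hK) hγ hc hd
  have hn' := isOuterNormal_outerNormal (T.isCell K' hK') hγ' hc hd
  set n := outerNormal K γ
  set n' := outerNormal K' γ
  have hf := finrank_orthogonal_face (T.isCell K hK) hγ hc hd
  have hn0 : (⟨n, mem_orthogonal_face_of_isOuterNormal hn⟩ :
      ((vectorSpan ℝ (γ : Set (Eu d)))ᗮ : Submodule ℝ (Eu d))) ≠ 0 := by
    intro h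
    have h0 : n = 0 := congrArg Subtype.val h
    have := hn.1
    rw [h0, norm_zero] at this
    exact zero_ne_one this
  obtain ⟨t, ht⟩ := (finrank_eq_one_iff_of_nonzero' _ hn0).1 hf
    ⟨n', mem_orthogonal_face_of_isOuterNormal hn'⟩
  replace ht : t • n = n' := congrArg Subtype.val ht
  have ht1 : |t| = 1 := by
    have := hn'.1
    rwa [← ht, norm_smul, hn.1, mul_one, Real.norm_eq_abs] at this
  rcases (abs_eq zero_le_one).1 ht1 with rfl | rfl
  · exfalso
    rw [one_smul] at ht
    obtain ⟨α, hα⟩ := exists_forall_inner_eq hn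
    obtain ⟨v, hv, hvK⟩ := exists_opposite_vertex (T.isCell K' hK') hγ' hc
    have hvm : v ∈ K' := hvK ▸ Finset.mem_insert_self v γ
    obtain ⟨a₀, ha₀⟩ : γ.Nonempty := Finset.card_pos.1 (by omega)
    have hvα : inner ℝ n v < α := by
      have := hn'.2.2 a₀ ha₀ v hvm hv
      rw [← ht, inner_sub_right, hα a₀ ha₀] at this
      linarith
    set c : Eu d := ∑ b ∈ γ, (d : ℝ)⁻¹ • b
    have hcm : c ∈ simplex γ := barycenter_mem_simplex hc hd
    have hcα : inner ℝ n c = α := inner_eq_of_mem_face hα hcm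
    have hev := exists_forall_mem_simplex (T.isCell K hK) hγ hc hn hα (c := c)
      (fun a ha => (T.isCell K hK).coord_barycenter hγ hc hd a ha) hd
    have htend : Tendsto (fun ε : ℝ => c + ε • (v - c)) (𝓝[>] 0) (𝓝 c) := by
      have : Continuous fun ε : ℝ => c + ε • (v - c) := by fun_prop
      have h := this.tendsto 0
      simp only [zero_smul, add_zero] at h
      exact h.mono_left nhdsWithin_le_nhds
    have hI : Set.Ioo (0 : ℝ) 1 ∈ 𝓝[>] (0 : ℝ) := Ioo_mem_nhdsGT one_pos
    obtain ⟨ε, hεK, hε⟩ := ((htend.eventually hev).and (eventually_of_mem hI fun _ h => h)).exists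
    have hin : inner ℝ n (c + ε • (v - c)) = α + ε * (inner ℝ n v - α) := by
      rw [inner_add_right, inner_smul_right, inner_sub_right, hcα]
    have hlt : inner ℝ n (c + ε • (v - c)) < α := by rw [hin]; nlinarith [hε.1]
    have hmem : c + ε • (v - c) ∈ simplex K' :=
      (convex_simplex K').add_smul_sub_mem (simplex_mono hγ' hcm) (subset_convexHull ℝ _ hvm)
        ⟨hε.1.le, hε.2.le⟩
    have h2 : c + ε • (v - c) ∈ simplex γ := by
      rw [← T.simplex_inter_eq_face hK hK' hne hγ hγ' hc]
      exact ⟨hεK hlt.le, hmem⟩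
    exact hlt.ne (inner_eq_of_mem_face hα h2)
  · rw [← ht, neg_one_smul]

/-- A relative interior point of a face of `K` that lies in `K'` forces the face to be shared. -/
lemma face_subset_of_mem (hK : K ∈ T.cells) (hK' : K' ∈ T.cells) (hγ : γ ⊆ K) {c : Eu d}
    (hc : c ∈ simplex K) (hc' : c ∈ simplex K')
    (hpos : ∀ a : K, a.1 ∈ γ → 0 < (T.isCell K hK).basis.coord a c) : γ ⊆ K' := by
  intro a ha
  by_contra haK'
  have hci : c ∈ convexHull ℝ ((K : Set (Eu d)) ∩ (K' : Set (Eu d))) := by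
    rw [← T.conforming K hK K' hK']
    exact ⟨hc, hc'⟩
  have hKc := T.isCell K hK
  set f := hKc.basis.coord ⟨a, hγ ha⟩ with hf
  have hconv : Convex ℝ (f ⁻¹' {0}) := (convex_singleton (𝕜 := ℝ) (0 : ℝ)).affine_preimage f
  have h0 : c ∈ f ⁻¹' {0} := by
    refine convexHull_min ?_ hconv hci
    rintro b ⟨hb, hb'⟩
    have hba : (⟨a, hγ ha⟩ : K) ≠ ⟨b, hb⟩ := fun h => by
      have : a = b := congrArg Subtype.val h
      exact haK' (this ▸ hb')
    have hfb : f b = 0 := hKc.coord_eq_zero (b := ⟨b, hb⟩) hba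
    exact Set.mem_singleton_iff.2 hfb
  exact (hpos ⟨a, hγ ha⟩ ha).ne' h0

/-- If a relative interior point `c` of `γ` were in `Ω`, the points `c + ε n` just outside `K` would
lie in other cells, and so would `c`, their union being closed. Such a cell would contain `γ`. The
remaining points of `γ` are limits of relative interior ones. -/
lemma simplex_subset_frontier (hd : 0 < d) (ho : IsOpen Ω) (hK : K ∈ T.cells) (hγ : γ ⊆ K)
    (hc : γ.card = d) (huniq : ∀ K' ∈ T.cells, γ ⊆ K' → K' = K) : simplex γ ⊆ frontier Ω := by
  classical
  have hKc := T.isCell K hK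
  have hn := isOuterNormal_outerNormal hKc hγ hc hd
  set n := outerNormal K γ
  obtain ⟨α, hα⟩ := exists_forall_inner_eq hn
  have hne : γ.Nonempty := Finset.card_pos.1 (by omega)
  have hpos : ∀ c ∈ simplex γ, (∀ a : K, a.1 ∈ γ → 0 < hKc.basis.coord a c) →
      c ∈ frontier Ω := by
    intro c hcγ hcpos
    rw [ho.frontier_eq]
    refine ⟨T.simplex_subset_closure hK (simplex_mono hγ hcγ), fun hcΩ => ?_⟩
    set Z := ⋃ K' ∈ T.cells.erase K, simplex K' with hZ
    have hZc : IsClosed Z :=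
      isClosed_biUnion_finset fun K' _ => (isCompact_simplex K').isClosed
    have htend : Tendsto (fun ε : ℝ => c + ε • n) (𝓝[>] 0) (𝓝 c) := by
      have : Continuous fun ε : ℝ => c + ε • n := by fun_prop
      have h := this.tendsto 0
      simp only [zero_smul, add_zero] at h
      exact h.mono_left nhdsWithin_le_nhds
    have hcZ : c ∈ Z := by
      refine hZc.mem_of_tendsto htend ?_
      filter_upwards [htend.eventually (ho.mem_nhds hcΩ), self_mem_nhdsWithin] with ε hε hε0
      have h1 : c + ε • n ∈ ⋃ K ∈ T.cells, simplex K := T.cover ▸ subset_closure hε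
      obtain ⟨K', hK', hx⟩ := Set.mem_iUnion₂.1 h1
      refine Set.mem_iUnion₂.2 ⟨K', Finset.mem_erase.2 ⟨?_, hK'⟩, hx⟩
      rintro rfl
      have h2 := inner_le_of_mem_simplex hn hne hα hx
      rw [inner_add_right, inner_smul_right, real_inner_self_eq_norm_sq, hn.1,
        inner_eq_of_mem_face hα hcγ] at h2
      have : 0 < ε := hε0
      linarith
    obtain ⟨K', hK', hcK'⟩ := Set.mem_iUnion₂.1 hcZ
    obtain ⟨hne', hK'⟩ := Finset.mem_erase.1 hK'
    exact hne' (huniq K' hK' (T.face_subset_of_mem hK hK' hγ (simplex_mono hγ hcγ) hcK' hcpos))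
  intro x hx
  set c : Eu d := ∑ b ∈ γ, (d : ℝ)⁻¹ • b
  have hcm : c ∈ simplex γ := barycenter_mem_simplex hc hd
  have htend : Tendsto (fun ε : ℝ => AffineMap.lineMap x c ε) (𝓝[>] 0) (𝓝 x) := by
    have : Continuous fun ε : ℝ => AffineMap.lineMap x c ε := AffineMap.lineMap_continuous
    have h := this.tendsto 0
    simp only [AffineMap.lineMap_apply_zero] at h
    exact h.mono_left nhdsWithin_le_nhds
  refine isClosed_frontier.mem_of_tendsto htend ?_
  filter_upwards [Ioo_mem_nhdsGT (one_pos : (0 : ℝ) < 1)] with ε hε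
  refine hpos _ ((convex_simplex γ).lineMap_mem hx hcm ⟨hε.1.le, hε.2.le⟩) fun a ha => ?_
  have h1 : 0 ≤ hKc.basis.coord a x := by
    have : x ∈ simplex K := simplex_mono hγ hx
    rw [hKc.simplex_eq] at this
    exact this a
  have h2 := hKc.coord_barycenter hγ hc hd a ha
  rw [AffineMap.apply_lineMap, AffineMap.lineMap_apply_ring]
  have := hε.1
  have := hε.2
  have h3 : 0 ≤ (1 - ε) * hKc.basis.coord a x := mul_nonneg (by linarith) h1
  have h4 : 0 < ε * hKc.basis.coord a c := mul_pos (by linarith) h2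
  linarith

open scoped Classical in
/-- The cells adjacent to a face. -/
lemma adjacent_cells (hd : 0 < d) (ho : IsOpen Ω) (hc : γ.card = d) :
    (T.cells.filter (fun K => γ ⊆ K)).card ≤ 2 ∧
      (∑ K ∈ T.cells.filter (fun K => γ ⊆ K), outerNormal K γ = 0 ∨ simplex γ ⊆ frontier Ω) := by
  set S := T.cells.filter (fun K => γ ⊆ K) with hS
  have hmem : ∀ K ∈ S, K ∈ T.cells ∧ γ ⊆ K := fun K hK => Finset.mem_filter.1 hK
  have hopp : ∀ K ∈ S, ∀ K' ∈ S, K ≠ K' → outerNormal K' γ = -outerNormal K γ :=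
    fun K hK K' hK' hne =>
      T.outerNormal_eq_neg hd (hmem K hK).1 (hmem K' hK').1 hne (hmem K hK).2 (hmem K' hK').2 hc
  -- Among three adjacent cells the normals would be pairwise opposite, which is impossible for unit
  -- vectors. Two cells have cancelling normals, and a face with a single cell lies on the boundary.
  by_cases hex : ∃ K ∈ S, ∃ K' ∈ S, K ≠ K'
  · obtain ⟨K, hK, K', hK', hne⟩ := hex
    have hSeq : S = {K, K'} := by
      ext K''
      simp only [Finset.mem_insert, Finset.mem_singleton]
      constructor
      · intro hK''
        by_contra! hcon
        have h1 := hopp K hK K' hK' hne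
        have h2 := hopp K hK K'' hK'' (Ne.symm hcon.1)
        have h3 := hopp K' hK' K'' hK'' (Ne.symm hcon.2)
        rw [h2, h1, neg_neg] at h3
        have h4 : outerNormal K γ = 0 := by
          have : (2 : ℝ) • outerNormal K γ = 0 := by
            rw [two_smul]
            nth_rewrite 1 [← h3]
            exact neg_add_cancel _
          simpa using this
        have h5 := (isOuterNormal_outerNormal (T.isCell K (hmem K hK).1) (hmem K hK).2 hc hd).1
        rw [h4, norm_zero] at h5
        exact zero_ne_one h5
      · rintro (rfl | rfl) <;> assumption
    rw [hSeq]
    refine ⟨Finset.card_le_two, Or.inl ?_⟩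
    rw [Finset.sum_pair hne, hopp K hK K' hK' hne, add_neg_cancel]
  · push Not at hex
    have hcard : S.card ≤ 1 := Finset.card_le_one.2 hex
    refine ⟨by omega, ?_⟩
    rcases S.eq_empty_or_nonempty with h | ⟨K, hK⟩
    · left
      rw [h, Finset.sum_empty]
    · right
      exact T.simplex_subset_frontier hd ho (hmem K hK).1 (hmem K hK).2 hc
        fun K' hK' hγ' => hex K' (Finset.mem_filter.2 ⟨hK', hγ'⟩) K hK

end Triangulation

/-! ### Mean values over faces -/

namespace ConeFace

variable {d : ℕ} {S G : Set (Eu d)} {n y₀ : Eu d} {α r h : ℝ}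

/-- The constant in the Poincaré inequality with mean values over a face. -/
def faceConst (d : ℕ) (r h : ℝ) : ℝ≥0∞ :=
  2 ^ (d + 2) * (ENNReal.ofReal h * coneConst d r * ENNReal.ofReal h)

lemma faceConst_ne_top (d : ℕ) (r h : ℝ) : faceConst d r h ≠ ⊤ := by
  unfold faceConst coneConst
  finiteness

/-- Averages the comparison of face values with interior values over the face; the bound of the
volume by `h` times the face measure cancels the normalising factor. -/
lemma lintegral_sub_average_le (H : ConeFace S G n y₀ α r h) {g : Eu d → ℝ}
    (hg : ContDiff ℝ ∞ g) :
    ∫⁻ x in S, ‖g x - ⨍ y in G, g y ∂μHE[d - 1]‖ₑ ≤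
      faceConst d r h * ∫⁻ x in S, ‖fderiv ℝ g x‖ₑ := by
  have := H.isFiniteMeasure
  set ν : Measure (Eu d) := (μHE[d - 1] : Measure (Eu d)).restrict G with hν
  have hν0 : ν Set.univ ≠ 0 := by
    rw [hν, Measure.restrict_apply_univ]; exact H.hausdorff_pos.ne'
  have hνt : ν Set.univ ≠ ⊤ := measure_ne_top _ _
  have : NeZero ν := ⟨fun h0 => hν0 (by rw [h0]; simp)⟩
  obtain ⟨M, hM⟩ := H.compG.exists_bound_of_continuousOn hg.continuous.continuousOn
  have hint : Integrable g ν := Measure.integrableOn_of_bounded H.hausdorff_lt_top.ne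
    hg.continuous.aestronglyMeasurable (ae_restrict_of_forall_mem H.compG.measurableSet hM)
  set a := ⨍ y, g y ∂ν with ha
  have hpt (x : Eu d) : ‖g x - a‖ₑ ≤ (ν Set.univ)⁻¹ * ∫⁻ y, ‖g y - g x‖ₑ ∂ν := by
    have e : g x - a = -⨍ y, (g y - g x) ∂ν := by
      rw [ha, average_eq, average_eq, integral_sub hint (integrable_const _), integral_const,
        smul_sub, smul_smul, inv_mul_cancel₀, one_smul, neg_sub]
      rw [Measure.real, ENNReal.toReal_ne_zero]
      exact ⟨hν0, hνt⟩
    rw [e, enorm_neg, average_eq, enorm_smul]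
    refine mul_le_mul' ?_ (enorm_integral_le_lintegral_enorm _)
    rw [enorm_inv (by rw [Measure.real, ENNReal.toReal_ne_zero]; exact ⟨hν0, hνt⟩),
      Real.enorm_of_nonneg (by positivity), Measure.real, ENNReal.ofReal_toReal hνt]
  have hm : Measurable fun q : Eu d × Eu d => ‖g q.2 - g q.1‖ₑ := by
    have := hg.continuous
    exact Continuous.measurable (by fun_prop)
  have hSf : IsFiniteMeasure (volume.restrict S) :=
    ⟨by rw [Measure.restrict_apply_univ]; exact H.compS.measure_lt_top⟩
  calc ∫⁻ x in S, ‖g x - a‖ₑ ≤ ∫⁻ x in S, (ν Set.univ)⁻¹ * ∫⁻ y, ‖g y - g x‖ₑ ∂ν :=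
        lintegral_mono fun x => hpt x
    _ = (ν Set.univ)⁻¹ * ∫⁻ x in S, ∫⁻ y, ‖g y - g x‖ₑ ∂ν :=
        lintegral_const_mul' _ _ (ENNReal.inv_ne_top.2 hν0)
    _ = (ν Set.univ)⁻¹ * ∫⁻ y, (∫⁻ x in S, ‖g y - g x‖ₑ) ∂ν := by
        rw [lintegral_lintegral_swap hm.aemeasurable]
    _ ≤ (ν Set.univ)⁻¹ * (2 ^ (d + 2) * (ENNReal.ofReal h * coneConst d r *
          (volume S * ∫⁻ x in S, ‖fderiv ℝ g x‖ₑ))) := by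
        gcongr
        exact H.lintegral_face_sub_le hg
    _ ≤ (ν Set.univ)⁻¹ * (2 ^ (d + 2) * (ENNReal.ofReal h * coneConst d r *
          (ENNReal.ofReal h * ν Set.univ * ∫⁻ x in S, ‖fderiv ℝ g x‖ₑ))) := by
        gcongr
        rw [hν, Measure.restrict_apply_univ]
        exact H.vol_le
    _ = ((ν Set.univ)⁻¹ * ν Set.univ) * (2 ^ (d + 2) * (ENNReal.ofReal h * coneConst d r *
          (ENNReal.ofReal h * ∫⁻ x in S, ‖fderiv ℝ g x‖ₑ))) := by ring
    _ = _ := by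
        rw [ENNReal.inv_mul_cancel hν0 hνt, faceConst]
        ring

/-- The Poincaré inequality for a Sobolev function, up to the distance to a smooth function. -/
lemma lintegral_sub_average_le_add (H : ConeFace S G n y₀ α r h) {Ω : Set (Eu d)}
    (hSΩ : volume.restrict S ≤ volume.restrict Ω) {g u : Eu d → ℝ} (hg : ContDiff ℝ ∞ g)
    {Du : Eu d → Fin d → ℝ} (hDu : ∀ j, IntegrableOn (fun x => Du x j) Ω) :
    ∫⁻ x in S, ‖u x - ⨍ y in G, g y ∂μHE[d - 1]‖ₑ ≤
      (∫⁻ x in Ω, ‖g x - u x‖ₑ) + faceConst d r h * (d * ∑ j, ∫⁻ x in Ω,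
        ‖fderiv ℝ g x (EuclideanSpace.single j 1) - Du x j‖ₑ) +
      faceConst d r h * (d * ∑ j, ∫⁻ x in S, ‖Du x j‖ₑ) := by
  set a := ⨍ y in G, g y ∂μHE[d - 1] with ha
  have hgc := hg.continuous
  have hm1 : Measurable fun x => ‖g x - a‖ₑ := Continuous.measurable (by fun_prop)
  have hjc (j : Fin d) : Continuous fun x => fderiv ℝ g x (EuclideanSpace.single j 1) :=
    (hg.continuous_fderiv (by simp)).clm_apply continuous_const
  have h1 : ∫⁻ x in S, ‖fderiv ℝ g x‖ₑ ≤ d * ∑ j, ((∫⁻ x in Ω,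
      ‖fderiv ℝ g x (EuclideanSpace.single j 1) - Du x j‖ₑ) + ∫⁻ x in S, ‖Du x j‖ₑ) := by
    calc ∫⁻ x in S, ‖fderiv ℝ g x‖ₑ
        ≤ ∫⁻ x in S, d * ∑ j, ‖fderiv ℝ g x (EuclideanSpace.single j 1)‖ₑ := by
          refine lintegral_mono fun x => ?_
          simpa using opNorm_rpow_le (fderiv ℝ g x) le_rfl
      _ = d * ∑ j, ∫⁻ x in S, ‖fderiv ℝ g x (EuclideanSpace.single j 1)‖ₑ := by
          rw [lintegral_const_mul' _ _ (by simp), lintegral_finsetSum]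
          exact fun j _ => (hjc j).enorm.measurable
      _ ≤ _ := by
          gcongr with j
          calc ∫⁻ x in S, ‖fderiv ℝ g x (EuclideanSpace.single j 1)‖ₑ
              ≤ ∫⁻ x in S, (‖fderiv ℝ g x (EuclideanSpace.single j 1) - Du x j‖ₑ + ‖Du x j‖ₑ) := by
                refine lintegral_mono fun x => ?_
                refine le_trans (le_of_eq ?_) (enorm_add_le _ _)
                rw [sub_add_cancel]
            _ = (∫⁻ x in S, ‖fderiv ℝ g x (EuclideanSpace.single j 1) - Du x j‖ₑ) +
                  ∫⁻ x in S, ‖Du x j‖ₑ :=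
                lintegral_add_right' _ ((hDu j).1.enorm.mono_measure hSΩ)
            _ ≤ _ := by gcongr
  calc ∫⁻ x in S, ‖u x - a‖ₑ ≤ ∫⁻ x in S, (‖g x - u x‖ₑ + ‖g x - a‖ₑ) := by
        refine lintegral_mono fun x => ?_
        rw [show u x - a = -(g x - u x) + (g x - a) by ring, ← enorm_neg (g x - u x)]
        exact enorm_add_le _ _
    _ = (∫⁻ x in S, ‖g x - u x‖ₑ) + ∫⁻ x in S, ‖g x - a‖ₑ := lintegral_add_right _ hm1
    _ ≤ (∫⁻ x in Ω, ‖g x - u x‖ₑ) + faceConst d r h * (d * ∑ j, ((∫⁻ x in Ω,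
      ‖fderiv ℝ g x (EuclideanSpace.single j 1) - Du x j‖ₑ) + ∫⁻ x in S, ‖Du x j‖ₑ)) := by
        refine add_le_add (lintegral_mono' hSΩ le_rfl) ((H.lintegral_sub_average_le hg).trans ?_)
        gcongr
    _ = _ := by rw [Finset.sum_add_distrib]; ring

end ConeFace

namespace Triangulation

variable {d : ℕ} {Ω : Set (Eu d)} (T : Triangulation Ω) {γ : Finset (Eu d)}

/-- On every face there is a constant (a limit of mean values) with which the Poincaré inequality
holds on the adjacent cells, and which vanishes on boundary faces. -/
lemma exists_face_mean (hd : 0 < d) (hΩ : IsPolyhedralLipschitzDomain Ω) (hc : γ.card = d)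
    {u : Eu d → ℝ} {Du : Eu d → Fin d → ℝ} (hu : IntegrableOn u Ω)
    (hDu : ∀ j, IntegrableOn (fun x => Du x j) Ω)
    (htr : HasTraceOn Ω (frontier Ω) u Du (fun _ => 0)) :
    ∃ c : ℝ, (simplex γ ⊆ frontier Ω → c = 0) ∧ ∀ K ∈ T.cells, γ ⊆ K → ∀ (y : Eu d) (r : ℝ),
      0 < r → Metric.ball y r ⊆ simplex K →
      ∫⁻ x in simplex K, ‖u x - c‖ₑ ≤ ConeFace.faceConst d r (Metric.diam (simplex K)) *
        (d * ∑ j, ∫⁻ x in simplex K, ‖Du x j‖ₑ) := by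
  obtain ⟨-, g, hg, hgu, hgD, hgt⟩ := htr
  by_cases hex : ∃ K ∈ T.cells, γ ⊆ K
  swap
  · exact ⟨0, fun _ => rfl, fun K hK hγ => absurd ⟨K, hK, hγ⟩ hex⟩
  obtain ⟨K₀, hK₀, hγ₀⟩ := hex
  -- These averages depend only on the face, which is why one constant serves all adjacent cells.
  -- Boundedness and compactness supply a limit, so no trace of `u` on interior faces has to be
  -- constructed.
  set a : ℕ → ℝ := fun m => ⨍ y in simplex γ, g m y ∂μHE[d - 1] with ha
  have hlim (r h : ℝ) : Tendsto (fun m => (∫⁻ x in Ω, ‖g m x - u x‖ₑ) +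
      ConeFace.faceConst d r h * (d * ∑ j, ∫⁻ x in Ω,
        ‖fderiv ℝ (g m) x (EuclideanSpace.single j 1) - Du x j‖ₑ)) atTop (𝓝 0) := by
    have h1 : Tendsto (fun m => ∑ j, ∫⁻ x in Ω,
        ‖fderiv ℝ (g m) x (EuclideanSpace.single j 1) - Du x j‖ₑ) atTop (𝓝 0) := by
      simpa using tendsto_finsetSum Finset.univ fun j _ => hgD j
    have h2 := ENNReal.Tendsto.const_mul (a := (d : ℝ≥0∞)) h1 (Or.inr (by simp))
    have h3 := ENNReal.Tendsto.const_mul (a := ConeFace.faceConst d r h) h2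
      (Or.inr (ConeFace.faceConst_ne_top d r h))
    simpa using hgu.add h3
  have hface : ∀ K ∈ T.cells, γ ⊆ K → ∀ (y : Eu d) (r : ℝ), 0 < r →
      Metric.ball y r ⊆ simplex K → ∃ e, ConeFace (simplex K) (simplex γ) e y
        (inner ℝ e (∑ b ∈ γ, (d : ℝ)⁻¹ • b)) r (Metric.diam (simplex K)) := by
    intro K hK hγ y r hr hb
    obtain ⟨e, α, H⟩ := (T.isCell K hK).coneFace hd hγ hc hr hb
    refine ⟨e, ?_⟩
    rwa [H.onG _ (barycenter_mem_simplex hc hd)]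
  have hle : ∀ K ∈ T.cells, γ ⊆ K → ∀ (y : Eu d) (r : ℝ), 0 < r →
      Metric.ball y r ⊆ simplex K → ∀ m, ∫⁻ x in simplex K, ‖u x - a m‖ₑ ≤
        (∫⁻ x in Ω, ‖g m x - u x‖ₑ) +
        ConeFace.faceConst d r (Metric.diam (simplex K)) * (d * ∑ j, ∫⁻ x in Ω,
          ‖fderiv ℝ (g m) x (EuclideanSpace.single j 1) - Du x j‖ₑ) +
        ConeFace.faceConst d r (Metric.diam (simplex K)) *
          (d * ∑ j, ∫⁻ x in simplex K, ‖Du x j‖ₑ) := by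
    intro K hK hγ y r hr hb m
    obtain ⟨e, H⟩ := hface K hK hγ y r hr hb
    exact H.lintegral_sub_average_le_add (T.restrict_simplex_le hΩ hK) (hg m) hDu
  obtain ⟨y₀, hy₀⟩ := (T.isCell K₀ hK₀).nonempty_interior
  obtain ⟨r₀, hr₀, hb₀⟩ := Metric.isOpen_iff.1 isOpen_interior y₀ hy₀
  replace hb₀ := hb₀.trans interior_subset
  obtain ⟨e₀, H₀⟩ := hface K₀ hK₀ hγ₀ y₀ r₀ hr₀ hb₀
  have huK : ∀ K ∈ T.cells, IntegrableOn u (simplex K) := fun K hK =>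
    Integrable.mono_measure hu (T.restrict_simplex_le hΩ hK)
  -- the mean values are bounded
  have hbdd : ∃ M : ℝ, ∀ᶠ m in atTop, a m ∈ Metric.closedBall (0 : ℝ) M := by
    set B := ConeFace.faceConst d r₀ (Metric.diam (simplex K₀)) *
          (d * ∑ j, ∫⁻ x in simplex K₀, ‖Du x j‖ₑ) with hB
    have hBt : B ≠ ⊤ := by
      refine ENNReal.mul_ne_top (ConeFace.faceConst_ne_top _ _ _) (ENNReal.mul_ne_top (by simp) ?_)
      refine ENNReal.sum_ne_top.2 fun j _ => ?_
      exact ((Integrable.mono_measure (hDu j) (T.restrict_simplex_le hΩ hK₀)).2).ne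
    have hut : ∫⁻ x in simplex K₀, ‖u x‖ₑ ≠ ⊤ := (huK K₀ hK₀).2.ne
    have hv0 := H₀.volume_pos.ne'
    have hvt : volume (simplex K₀) ≠ ⊤ := H₀.compS.measure_lt_top.ne
    set M : ℝ≥0∞ := (1 + B + ∫⁻ x in simplex K₀, ‖u x‖ₑ) / volume (simplex K₀) with hM
    have hMt : M ≠ ⊤ := ENNReal.div_ne_top (by finiteness) hv0
    refine ⟨M.toReal, ?_⟩
    filter_upwards [(hlim r₀ (Metric.diam (simplex K₀))).eventually_le_const one_pos] with m hm
    have h1 : ‖a m‖ₑ * volume (simplex K₀) ≤ 1 + B + ∫⁻ x in simplex K₀, ‖u x‖ₑ := by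
      calc ‖a m‖ₑ * volume (simplex K₀) = ∫⁻ _ in simplex K₀, ‖a m‖ₑ := by rw [setLIntegral_const]
        _ ≤ ∫⁻ x in simplex K₀, (‖u x - a m‖ₑ + ‖u x‖ₑ) := by
            refine lintegral_mono fun x => ?_
            rw [show a m = -(u x - a m) + u x by ring, ← enorm_neg (u x - _)]
            refine (enorm_add_le _ _).trans (le_of_eq ?_)
            ring_nf
        _ = (∫⁻ x in simplex K₀, ‖u x - a m‖ₑ) + ∫⁻ x in simplex K₀, ‖u x‖ₑ :=
            lintegral_add_right' _ (huK K₀ hK₀).1.enorm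
        _ ≤ _ := by
            gcongr
            refine (hle K₀ hK₀ hγ₀ y₀ r₀ hr₀ hb₀ m).trans ?_
            gcongr
    have h2 : ‖a m‖ₑ ≤ M := (ENNReal.le_div_iff_mul_le (Or.inl hv0) (Or.inl hvt)).2 h1
    rw [mem_closedBall_zero_iff]
    rw [← toReal_enorm]
    exact ENNReal.toReal_mono hMt h2
  obtain ⟨M, hM⟩ := hbdd
  obtain ⟨c, -, φ, hφ, hφc⟩ := (isCompact_closedBall (0 : ℝ) M).tendsto_subseq' hM.frequently
  refine ⟨c, fun hfr => ?_, fun K hK hγ y r hr hb => ?_⟩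
  -- The approximations come from the vanishing trace, so they tend to zero in `L¹` of a boundary
  -- face, and so do their averages.
  · have h0 : Tendsto a atTop (𝓝 0) := by
      have := H₀.isFiniteMeasure
      set ν : Measure (Eu d) := (μHE[d - 1] : Measure (Eu d)).restrict (simplex γ) with hν
      have hν0 : ν Set.univ ≠ 0 := by
        rw [hν, Measure.restrict_apply_univ]; exact H₀.hausdorff_pos.ne'
      rw [tendsto_zero_iff_enorm_tendsto_zero]
      have h1 : Tendsto (fun m => ‖(ν.real Set.univ)⁻¹‖ₑ *
          ∫⁻ x in frontier Ω, ‖g m x - 0‖ₑ ∂μHE[d - 1]) atTop (𝓝 0) := by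
        simpa using ENNReal.Tendsto.const_mul (a := ‖(ν.real Set.univ)⁻¹‖ₑ) hgt
          (Or.inr enorm_ne_top)
      refine tendsto_of_tendsto_of_tendsto_of_le_of_le tendsto_const_nhds h1 (fun _ => zero_le)
        fun m => ?_
      simp only [ha]
      rw [average_eq, enorm_smul]
      gcongr
      refine (enorm_integral_le_lintegral_enorm _).trans ?_
      simp only [sub_zero]
      exact lintegral_mono_set hfr
    exact tendsto_nhds_unique hφc (h0.comp hφ.tendsto_atTop)
  · have hvt : volume (simplex K) ≠ ⊤ := (isCompact_simplex K).measure_lt_top.ne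
    have h1 : Tendsto (fun m => ‖a (φ m) - c‖ₑ * volume (simplex K)) atTop (𝓝 0) := by
      have h2 : Tendsto (fun m => ‖a (φ m) - c‖ₑ) atTop (𝓝 0) := by
        have := (tendsto_sub_nhds_zero_iff.2 hφc)
        simpa using (tendsto_zero_iff_enorm_tendsto_zero.1 this)
      simpa using ENNReal.Tendsto.mul_const h2 (Or.inr hvt)
    have h3 := ((hlim r (Metric.diam (simplex K))).comp hφ.tendsto_atTop).add_const
      (ConeFace.faceConst d r (Metric.diam (simplex K)) *
        (d * ∑ j, ∫⁻ x in simplex K, ‖Du x j‖ₑ))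
    have h4 := h3.add h1
    rw [zero_add, add_zero] at h4
    refine ge_of_tendsto' h4 fun m => ?_
    calc ∫⁻ x in simplex K, ‖u x - c‖ₑ
        ≤ ∫⁻ x in simplex K, (‖u x - a (φ m)‖ₑ + ‖a (φ m) - c‖ₑ) := by
          refine lintegral_mono fun x => ?_
          refine le_trans (le_of_eq ?_) (enorm_add_le _ _)
          rw [sub_add_sub_cancel]
      _ = (∫⁻ x in simplex K, ‖u x - a (φ m)‖ₑ) + ‖a (φ m) - c‖ₑ * volume (simplex K) := by
          rw [lintegral_add_right _ measurable_const, setLIntegral_const]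
      _ ≤ _ := by
          gcongr
          exact hle K hK hγ y r hr hb (φ m)

end Triangulation

/-! ### The projection on an element -/

/-- The supremum of a polynomial and of its derivatives on a shape regular set is controlled by
moments. -/
lemma abs_peval_le_of_moment (d k : ℕ) (R : ℝ) : ∃ C : ℝ, 0 ≤ C ∧ ∀ P : MvPolynomial (Fin d) ℝ,
    P.totalDegree ≤ k → ∀ (S : Set (Eu d)) (y : Eu d) (r : ℝ), 0 < r → IsCompact S →
      Metric.ball y r ⊆ S → S ⊆ Metric.closedBall y (R * r) → ∀ f : Eu d → ℝ, IntegrableOn f S →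
      ∫ x in S, peval P x ^ 2 = ∫ x in S, f x * peval P x →
      ∀ x ∈ S, |peval P x| ≤ C * ((r ^ d)⁻¹ * ∫ x in S, |f x|) ∧
        ∀ j, r * |fderiv ℝ (peval P) x (EuclideanSpace.single j 1)| ≤
          C * ((r ^ d)⁻¹ * ∫ x in S, |f x|) := by
  obtain ⟨C, hC0, hC⟩ := peval_sq_le d k R
  refine ⟨C, hC0, fun P hP S y r hr hS hb hSR f hf hmom => ?_⟩
  have hc : Continuous (peval P) := (contDiff_peval P).continuous
  have hne : S.Nonempty := ⟨y, hb (Metric.mem_ball_self hr)⟩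
  obtain ⟨x₀, hx₀, hmax⟩ := hS.exists_isMaxOn hne hc.abs.continuousOn
  set m := |peval P x₀| with hm
  set I := ∫ x in S, |f x| with hI
  have hI0 : 0 ≤ I := integral_nonneg fun x => abs_nonneg _
  have hm0 : 0 ≤ m := abs_nonneg _
  have hsq : IntegrableOn (fun x => peval P x ^ 2) S :=
    (hc.pow 2).continuousOn.integrableOn_compact hS
  have hball : ∫ x in Metric.ball y r, peval P x ^ 2 ≤ m * I := by
    calc ∫ x in Metric.ball y r, peval P x ^ 2 ≤ ∫ x in S, peval P x ^ 2 :=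
          setIntegral_mono_set hsq (Eventually.of_forall fun x => sq_nonneg _) hb.eventuallyLE
      _ = ∫ x in S, f x * peval P x := hmom
      _ ≤ ∫ x in S, m * |f x| := by
          refine (Real.le_norm_self _).trans
            (norm_integral_le_of_norm_le (hf.abs.const_mul m) ?_)
          refine ae_restrict_of_forall_mem hS.measurableSet fun x hx => ?_
          rw [Real.norm_eq_abs, abs_mul, mul_comm]
          exact mul_le_mul_of_nonneg_right (hmax hx) (abs_nonneg _)
      _ = m * I := integral_const_mul _ _
  have hD0 : 0 ≤ C * (r ^ d)⁻¹ := by positivity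
  have hmain : ∀ x ∈ S, peval P x ^ 2 ≤ C * (r ^ d)⁻¹ * (m * I) ∧
      ∀ j, r ^ 2 * fderiv ℝ (peval P) x (EuclideanSpace.single j 1) ^ 2 ≤
        C * (r ^ d)⁻¹ * (m * I) := fun x hx => by
    have h := hC P hP y r hr x (hSR hx)
    exact ⟨h.1.trans (by gcongr), fun j => (h.2 j).trans (by gcongr)⟩
  -- At a maximum point the bound reads `m² ≤ C r^(-d) m I`, and one factor `m` cancels. Inserting
  -- the result again bounds the derivatives.
  have hmI : m ≤ C * ((r ^ d)⁻¹ * I) := by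
    rcases hm0.eq_or_lt with h | h
    · rw [← h]; positivity
    · have h1 := (hmain x₀ hx₀).1
      rw [← sq_abs, ← hm] at h1
      nlinarith
  refine fun x hx => ⟨(hmax hx).trans hmI, fun j => ?_⟩
  have h1 := (hmain x hx).2 j
  rw [← abs_of_pos hr, ← abs_mul, abs_of_pos hr]
  refine abs_le_of_sq_le_sq ?_ (by positivity)
  calc (r * fderiv ℝ (peval P) x (EuclideanSpace.single j 1)) ^ 2
      = r ^ 2 * fderiv ℝ (peval P) x (EuclideanSpace.single j 1) ^ 2 := mul_pow _ _ _
    _ ≤ C * (r ^ d)⁻¹ * (m * I) := h1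
    _ ≤ C * (r ^ d)⁻¹ * ((C * ((r ^ d)⁻¹ * I)) * I) := by gcongr
    _ = (C * ((r ^ d)⁻¹ * I)) ^ 2 := by ring

namespace Triangulation

variable {d : ℕ} {Ω : Set (Eu d)} {T : Triangulation Ω} {K : Finset (Eu d)} {k : ℕ}
  {z : Eu d → Eu d} {w : Finset (Eu d) → Eu d → Eu d}

/-- On a single element, a component of the projection is again an `L²`-projection. -/
lemma IsL2Projection.integral_sq (hw : T.IsL2Projection k z w) (hK : K ∈ T.cells)
    (hz : ∀ i, IntegrableOn (fun x => z x i) (simplex K)) (i : Fin d) {P : MvPolynomial (Fin d) ℝ}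
    (hP : P.totalDegree ≤ k) (hwP : ∀ x, w K x i = peval P x) (c : ℝ) :
    ∫ x in simplex K, peval (P - MvPolynomial.C c) x ^ 2 =
      ∫ x in simplex K, (z x i - c) * peval (P - MvPolynomial.C c) x := by
  classical
  set Q := P - MvPolynomial.C c with hQ
  have hQk : Q.totalDegree ≤ k :=
    (MvPolynomial.totalDegree_sub _ _).trans (max_le hP (by simp))
  have hQx (x : Eu d) : peval Q x = w K x i - c := by
    rw [hwP x, hQ]; simp [peval]
  have hQc : Continuous (peval Q) := (contDiff_peval Q).continuous
  -- Broken fields are independent across cells, so the test field may be supported on `K` and in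
  -- the component `i`.
  set v : Finset (Eu d) → Eu d → Eu d := fun K' x =>
    if K' = K then EuclideanSpace.single i (peval Q x) else 0 with hv
  have hvp : T.IsBrokenPoly k v := by
    intro K' _ j
    by_cases hKK : K' = K ∧ j = i
    · refine ⟨Q, hQk, fun x => ?_⟩
      simp [hv, hKK.1, hKK.2, peval]
    · refine ⟨0, by simp, fun x => ?_⟩
      by_cases h1 : K' = K
      · have h2 : j ≠ i := fun h => hKK ⟨h1, h⟩
        simp [hv, h1, h2]
      · simp [hv, h1]
  have h := hw.2 v hvp
  rw [Finset.sum_eq_single_of_mem K hK (fun K' _ hne => by simp [hv, hne]),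
    Finset.sum_eq_single_of_mem K hK (fun K' _ hne => by simp [hv, hne])] at h
  simp only [hv, if_true, EuclideanSpace.inner_single_right, conj_trivial] at h
  have hS := isCompact_simplex K
  have hi1 : IntegrableOn (fun x => peval Q x * w K x i) (simplex K) := by
    simp only [hwP]
    exact (hQc.mul (contDiff_peval P).continuous).continuousOn.integrableOn_compact hS
  have hi2 : IntegrableOn (fun x => peval Q x * c) (simplex K) :=
    (hQc.mul continuous_const).continuousOn.integrableOn_compact hS
  have hi3 : IntegrableOn (fun x => peval Q x * z x i) (simplex K) :=
    IntegrableOn.continuousOn_mul hQc.continuousOn (hz i) hS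
  calc ∫ x in simplex K, peval Q x ^ 2
      = ∫ x in simplex K, (peval Q x * w K x i - peval Q x * c) := by
        refine integral_congr_ae (Eventually.of_forall fun x => ?_)
        simp only [hQx]
        ring
    _ = ∫ x in simplex K, (peval Q x * z x i - peval Q x * c) := by
        rw [integral_sub hi1 hi2, integral_sub hi3 hi2, h]
    _ = _ := by
        refine integral_congr_ae (Eventually.of_forall fun x => ?_)
        show _ = _
        ring

end Triangulation

lemma norm_le_sum_abs {d : ℕ} (v : Eu d) : ‖v‖ ≤ ∑ i, |v i| := by
  rw [EuclideanSpace.norm_eq]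
  refine Real.sqrt_le_iff.2 ⟨by positivity, ?_⟩
  simp only [Real.norm_eq_abs]
  exact Finset.sum_sq_le_sq_sum_of_nonneg fun i _ => abs_nonneg _

/-- Bounds of the projection on an element by the distance of the function to a constant. -/
lemma exists_projection_le (d k : ℕ) (R : ℝ) : ∃ C : ℝ, 0 ≤ C ∧ ∀ (Ω : Set (Eu d))
    (T : Triangulation Ω) (z : Eu d → Eu d) (w : Finset (Eu d) → Eu d → Eu d),
    T.IsL2Projection k z w → ∀ K ∈ T.cells, (∀ i, IntegrableOn (fun x => z x i) (simplex K)) →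
    ∀ (y : Eu d) (r : ℝ), 0 < r → Metric.ball y r ⊆ simplex K →
      Metric.diam (simplex K) ≤ R * r → ∀ c : Eu d, ∀ x ∈ simplex K,
      ‖w K x - c‖ ≤ C * ((r ^ d)⁻¹ * ∑ i, ∫ x in simplex K, |z x i - c i|) ∧
      r * frob (jac (w K) x) ≤ C * ((r ^ d)⁻¹ * ∑ i, ∫ x in simplex K, |z x i - c i|) := by
  obtain ⟨C, hC0, hC⟩ := abs_peval_le_of_moment d k R
  refine ⟨d * C + C, by positivity, fun Ω T z w hw K hK hz y r hr hb hdiam c x hx => ?_⟩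
  have hS := isCompact_simplex K
  have hSR : simplex K ⊆ Metric.closedBall y (R * r) := fun x hx =>
    (Metric.dist_le_diam_of_mem hS.isBounded hx (hb (Metric.mem_ball_self hr))).trans hdiam
  have hvol : IsFiniteMeasure (volume.restrict (simplex K)) :=
    ⟨by rw [Measure.restrict_apply_univ]; exact hS.measure_lt_top⟩
  choose P hPk hP using fun i => hw.1 K hK i
  have hkey (i : Fin d) := hC (P i - MvPolynomial.C (c i))
    ((MvPolynomial.totalDegree_sub _ _).trans (max_le (hPk i) (by simp))) (simplex K) y r hr hS hb
    hSR (fun x => z x i - c i) ((hz i).sub (integrable_const _))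
    (hw.integral_sq hK hz i (hPk i) (hP i) (c i)) x hx
  set I : Fin d → ℝ := fun i => ∫ x in simplex K, |z x i - c i| with hI
  have hI0 (i : Fin d) : 0 ≤ I i := integral_nonneg fun _ => abs_nonneg _
  have hX : 0 ≤ (r ^ d)⁻¹ * ∑ i, I i := mul_nonneg (by positivity)
    (Finset.sum_nonneg fun i _ => hI0 i)
  have hw_eq (i : Fin d) (x : Eu d) : peval (P i - MvPolynomial.C (c i)) x = w K x i - c i := by
    rw [hP i x]; simp [peval]
  have e1 : ∑ i, C * ((r ^ d)⁻¹ * I i) = C * ((r ^ d)⁻¹ * ∑ i, I i) := by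
    rw [Finset.mul_sum, Finset.mul_sum]
  have hwi (i : Fin d) : (fun x => w K x i) =
      fun x => peval (P i - MvPolynomial.C (c i)) x + c i := by
    funext x; rw [hw_eq]; ring
  have hdiff (i : Fin d) : Differentiable ℝ (peval (P i - MvPolynomial.C (c i))) :=
    (contDiff_peval _).differentiable (by simp)
  have hwd : Differentiable ℝ (w K) := by
    rw [differentiable_euclidean]
    intro i
    show Differentiable ℝ fun x => w K x i
    rw [hwi i]
    exact (hdiff i).add_const _
  have hjac (i j : Fin d) : jac (w K) x i j =
      fderiv ℝ (peval (P i - MvPolynomial.C (c i))) x (EuclideanSpace.single j 1) := by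
    have h1 : HasFDerivAt (fun x => w K x i)
        ((EuclideanSpace.proj i : Eu d →L[ℝ] ℝ).comp (fderiv ℝ (w K) x)) x :=
      (EuclideanSpace.proj i : Eu d →L[ℝ] ℝ).hasFDerivAt.comp x (hwd x).hasFDerivAt
    have h2 : HasFDerivAt (fun x => w K x i)
        (fderiv ℝ (peval (P i - MvPolynomial.C (c i))) x) x := by
      rw [hwi i]
      exact (hdiff i x).hasFDerivAt.add_const _
    rw [← h1.unique h2]
    rfl
  constructor
  · calc ‖w K x - c‖ ≤ ∑ i, |w K x i - c i| := norm_le_sum_abs _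
      _ ≤ ∑ i, C * ((r ^ d)⁻¹ * I i) := Finset.sum_le_sum fun i _ => by
          rw [← hw_eq]; exact (hkey i).1
      _ = C * ((r ^ d)⁻¹ * ∑ i, I i) := e1
      _ ≤ _ := by
          have : 0 ≤ d * C * ((r ^ d)⁻¹ * ∑ i, I i) := mul_nonneg (by positivity) hX
          linarith
  · calc r * frob (jac (w K) x) ≤ r * ∑ i, ∑ j, |jac (w K) x i j| := by
          gcongr
          exact frob_le_sum _
      _ = ∑ i, ∑ j, r * |jac (w K) x i j| := by simp only [Finset.mul_sum]
      _ ≤ ∑ i, ∑ _j : Fin d, C * ((r ^ d)⁻¹ * I i) :=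
          Finset.sum_le_sum fun i _ => Finset.sum_le_sum fun j _ => by
            rw [hjac]; exact (hkey i).2 j
      _ = d * (C * ((r ^ d)⁻¹ * ∑ i, I i)) := by
          rw [← e1, Finset.mul_sum]
          simp
      _ ≤ _ := by
          have : 0 ≤ C * ((r ^ d)⁻¹ * ∑ i, I i) := mul_nonneg hC0 hX
          linarith

/-- Bounds of the projection on an element by the mean of the gradient. -/
lemma exists_projection_le_average (d k : ℕ) (hd : 0 < d) (R : ℝ) : ∃ C : ℝ, 1 ≤ C ∧
    ∀ (Ω : Set (Eu d)) (T : Triangulation Ω) (z : Eu d → Eu d) (Dz : Eu d → Ten d)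
    (w : Finset (Eu d) → Eu d → Eu d),
    T.IsL2Projection k z w → ∀ K ∈ T.cells, (∀ i, IntegrableOn (fun x => z x i) (simplex K)) →
    (∀ i j, IntegrableOn (fun x => Dz x i j) (simplex K)) →
    ∀ (y : Eu d) (r : ℝ), 0 < r → Metric.ball y r ⊆ simplex K →
      Metric.diam (simplex K) ≤ R * r → ∀ c : Eu d,
      (∀ i, ∫⁻ x in simplex K, ‖z x i - c i‖ₑ ≤
        ConeFace.faceConst d r (Metric.diam (simplex K)) *
          (d * ∑ j, ∫⁻ x in simplex K, ‖Dz x i j‖ₑ)) → ∀ x ∈ simplex K,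
      frob (jac (w K) x) ≤ C * ⨍ x in simplex K, frob (Dz x) ∧
      ‖w K x - c‖ ≤ C * (Metric.diam (simplex K) * ⨍ x in simplex K, frob (Dz x)) := by
  obtain ⟨C, hC0, hC⟩ := exists_projection_le d k R
  -- `B r` bounds the face Poincaré constant when the diameter is at most `R r`, and `|R|^d V r^d`
  -- bounds the volume of the cell. The factor `d³` counts the components, the partial derivatives
  -- and the dimension factor of the face inequality. The absolute value keeps `M` nonnegative
  -- before `R > 0` is known.
  set V : ℝ := volume.real (Metric.closedBall (0 : Eu d) 1) with hV
  set B : ℝ := 2 ^ (d + 2) * (R * 2 ^ (d - 1) * R) with hB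
  set M : ℝ := C * (B * d ^ 3 * (|R| ^ d * V)) with hM
  have hV0 : 0 ≤ V := measureReal_nonneg
  have hB0 : 0 ≤ B := by
    have : B = 2 ^ (d + 2) * 2 ^ (d - 1) * (R * R) := by rw [hB]; ring
    rw [this]
    exact mul_nonneg (by positivity) (mul_self_nonneg _)
  have hM0 : 0 ≤ M := by positivity
  refine ⟨M + 1, by linarith, fun Ω T z Dz w hw K hK hz hDz y r hr hb hdiam c hc x hx => ?_⟩
  have hS := isCompact_simplex K
  set h := Metric.diam (simplex K) with hh
  set v : ℝ := volume.real (simplex K) with hv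
  set J : ℝ := ∫ x in simplex K, frob (Dz x) with hJ
  have hJ0 : 0 ≤ J := integral_nonneg fun _ => frob_nonneg _
  have hav : ⨍ x in simplex K, frob (Dz x) = v⁻¹ * J := by
    rw [setAverage_eq, smul_eq_mul]
  have hSR : simplex K ⊆ Metric.closedBall y (R * r) := fun x hx =>
    (Metric.dist_le_diam_of_mem hS.isBounded hx (hb (Metric.mem_ball_self hr))).trans hdiam
  obtain ⟨γ, -, hγ, hγc⟩ := (T.isCell K hK).exists_face (Finset.empty_subset K) (by simp)
  obtain ⟨e, α, H⟩ := (T.isCell K hK).coneFace hd hγ hγc hr hb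
  have hrh : r ≤ h := H.r_le_h
  have hR0 : 0 < R := by
    by_contra hcon
    push Not at hcon
    nlinarith
  have hv0 : 0 < v := ENNReal.toReal_pos H.volume_pos.ne' hS.measure_lt_top.ne
  have hvr : v ≤ |R| ^ d * V * r ^ d := by
    have h1 : v ≤ volume.real (Metric.closedBall y (R * r)) :=
      measureReal_mono hSR (isCompact_closedBall _ _).measure_lt_top.ne
    rw [Measure.real, Measure.addHaar_closedBall' volume y (by positivity),
      finrank_euclideanSpace_fin, ENNReal.toReal_mul, ENNReal.toReal_ofReal (by positivity)] at h1
    rw [abs_of_pos hR0, hV, Measure.real]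
    calc v ≤ _ := h1
      _ = _ := by rw [mul_pow]; ring
  have hrv : (r ^ d)⁻¹ ≤ |R| ^ d * V * v⁻¹ := by
    rw [inv_le_iff_one_le_mul₀ (by positivity), mul_right_comm, ← div_eq_mul_inv,
      one_le_div hv0]
    exact hvr
  have hDzm : AEMeasurable (fun x => frob (Dz x)) (volume.restrict (simplex K)) := by
    unfold frob
    exact (Finset.aemeasurable_fun_sum _ fun i _ =>
      Finset.aemeasurable_fun_sum _ fun j _ => (hDz i j).1.aemeasurable.pow_const 2).sqrt
  have hfi : IntegrableOn (fun x => frob (Dz x)) (simplex K) := by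
    refine Integrable.mono' (g := fun x => ∑ i, ∑ j, |Dz x i j|) ?_ hDzm.aestronglyMeasurable ?_
    · exact integrable_finsetSum _ fun i _ => integrable_finsetSum _ fun j _ => (hDz i j).abs
    · refine Eventually.of_forall fun x => ?_
      rw [Real.norm_of_nonneg (frob_nonneg _)]
      exact frob_le_sum _
  have hJe : ENNReal.ofReal J = ∫⁻ x in simplex K, ENNReal.ofReal (frob (Dz x)) :=
    ofReal_integral_eq_lintegral_ofReal hfi (Eventually.of_forall fun _ => frob_nonneg _)
  have hfc : ConeFace.faceConst d r h ≤ ENNReal.ofReal (B * r) := by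
    have e1 : ConeFace.faceConst d r h =
        ENNReal.ofReal (2 ^ (d + 2) * (h * (2 ^ (d - 1) / r) * h)) := by
      have hh0 : 0 ≤ h := Metric.diam_nonneg
      rw [ConeFace.faceConst, ConeFace.coneConst, ← ENNReal.ofReal_mul hh0,
        ← ENNReal.ofReal_mul (by positivity), ← ENNReal.ofReal_ofNat 2, ← ENNReal.ofReal_pow
        (by norm_num), ← ENNReal.ofReal_mul (by positivity)]
    rw [e1]
    refine ENNReal.ofReal_le_ofReal ?_
    calc 2 ^ (d + 2) * (h * (2 ^ (d - 1) / r) * h)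
        ≤ 2 ^ (d + 2) * ((R * r) * (2 ^ (d - 1) / r) * (R * r)) := by
          have : 0 ≤ h := Metric.diam_nonneg
          gcongr
      _ = B * r := by rw [hB]; field_simp
  have hI (i : Fin d) : ∫ x in simplex K, |z x i - c i| ≤ B * r * (d * (d * J)) := by
    have hvol : IsFiniteMeasure (volume.restrict (simplex K)) :=
      ⟨by rw [Measure.restrict_apply_univ]; exact hS.measure_lt_top⟩
    have hzi : IntegrableOn (fun x => z x i - c i) (simplex K) := (hz i).sub (integrable_const _)
    rw [← ENNReal.ofReal_le_ofReal_iff (by positivity),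
      ofReal_integral_eq_lintegral_ofReal hzi.abs (Eventually.of_forall fun _ => abs_nonneg _)]
    calc ∫⁻ x in simplex K, ENNReal.ofReal |z x i - c i| = ∫⁻ x in simplex K, ‖z x i - c i‖ₑ := by
          simp only [Real.enorm_eq_ofReal_abs]
      _ ≤ _ := hc i
      _ ≤ ENNReal.ofReal (B * r) * (d * ∑ _j : Fin d, ENNReal.ofReal J) := by
          gcongr with j
          rw [hJe]
          refine lintegral_mono fun x => ?_
          rw [Real.enorm_eq_ofReal_abs]
          exact ENNReal.ofReal_le_ofReal (abs_apply_le_frob _ _ _)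
      _ = _ := by
          rw [Finset.sum_const, Finset.card_univ, Fintype.card_fin, nsmul_eq_mul,
            ENNReal.ofReal_mul (p := B * r) (by positivity),
            ENNReal.ofReal_mul (p := (d : ℝ)) (by positivity),
            ENNReal.ofReal_mul (p := (d : ℝ)) (by positivity), ENNReal.ofReal_natCast]
  have hfin : C * ((r ^ d)⁻¹ * ∑ i, ∫ x in simplex K, |z x i - c i|) ≤ r * (M * (v⁻¹ * J)) := by
    calc C * ((r ^ d)⁻¹ * ∑ i, ∫ x in simplex K, |z x i - c i|)
        ≤ C * ((|R| ^ d * V * v⁻¹) * ∑ _i : Fin d, B * r * (d * (d * J))) := by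
          have : 0 ≤ ∑ i, ∫ x in simplex K, |z x i - c i| :=
            Finset.sum_nonneg fun i _ => integral_nonneg fun _ => abs_nonneg _
          gcongr with i
          exact hI i
      _ = r * (M * (v⁻¹ * J)) := by
          rw [Finset.sum_const, Finset.card_univ, Fintype.card_fin, nsmul_eq_mul, hM]
          ring
  have hmain := hC Ω T z w hw K hK hz y r hr hb hdiam c x hx
  have hm0 : 0 ≤ v⁻¹ * J := by positivity
  rw [hav]
  constructor
  · have h1 := hmain.2.trans hfin
    have h2 : frob (jac (w K) x) ≤ M * (v⁻¹ * J) := le_of_mul_le_mul_left h1 hr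
    linarith
  · refine (hmain.1.trans hfin).trans ?_
    calc r * (M * (v⁻¹ * J)) ≤ h * (M * (v⁻¹ * J)) := by gcongr
      _ = M * (h * (v⁻¹ * J)) := by ring
      _ ≤ _ := by
          have : 0 ≤ h * (v⁻¹ * J) := mul_nonneg Metric.diam_nonneg hm0
          linarith

/-! ### Modulars on an element -/

/-- `φ'_b(t) t`, which is equivalent to `φ_b(t)`. -/
def phiMul (p b t : ℝ) : ℝ := phiDeriv p b t * t

section Modular

variable {p b s t : ℝ}

lemma phiMul_nonneg (hb : 0 ≤ b) (ht : 0 ≤ t) : 0 ≤ phiMul p b t :=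
  mul_nonneg (phiDeriv_nonneg hb ht) ht

lemma phiMul_mono (hp : 1 < p) (hb : 0 ≤ b) (hs : 0 ≤ s) (hst : s ≤ t) :
    phiMul p b s ≤ phiMul p b t :=
  mul_le_mul (phiDeriv_mono hp hb hs hst) hst hs (phiDeriv_nonneg hb (hs.trans hst))

lemma phiMul_mul_le (hp : 1 < p) (hb : 0 ≤ b) (ht : 0 ≤ t) {l : ℝ} (hl : 1 ≤ l) :
    phiMul p b (l * t) ≤ l ^ p * l * phiMul p b t := by
  have h := mul_le_mul_of_nonneg_right (phiDeriv_mul_le hp hb ht hl)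
    (mul_nonneg (zero_le_one.trans hl) ht)
  calc phiMul p b (l * t) ≤ l ^ p * phiDeriv p b t * (l * t) := h
    _ = _ := by rw [phiMul]; ring

/-- A substitute for convexity: small factors come out at least linearly. This later converts the
mesh size in the jump term into local diameters. -/
lemma phiMul_mul_le_of_le_one (hp : 1 < p) (hb : 0 ≤ b) (ht : 0 ≤ t) {l : ℝ} (hl0 : 0 ≤ l)
    (hl : l ≤ 1) : phiMul p b (l * t) ≤ l * phiMul p b t := by
  have h := mul_le_mul_of_nonneg_right
    (phiDeriv_mono hp hb (mul_nonneg hl0 ht) (mul_le_of_le_one_left ht hl)) (mul_nonneg hl0 ht)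
  calc phiMul p b (l * t) ≤ phiDeriv p b t * (l * t) := h
    _ = _ := by rw [phiMul]; ring

/-- A sum of at most two terms is at most twice the largest one. -/
lemma phiMul_sum_le (hp : 1 < p) (hb : 0 ≤ b) {ι : Type*} (S : Finset ι) (hS : S.card ≤ 2)
    {a : ι → ℝ} (ha : ∀ i ∈ S, 0 ≤ a i) :
    phiMul p b (∑ i ∈ S, a i) ≤ ∑ i ∈ S, phiMul p b (2 * a i) := by
  rcases S.eq_empty_or_nonempty with rfl | hne
  · simp [phiMul]
  obtain ⟨i, hi, hmax⟩ := S.exists_max_image a hne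
  have h1 : ∑ j ∈ S, a j ≤ 2 * a i := by
    calc ∑ j ∈ S, a j ≤ S.card • a i := Finset.sum_le_card_nsmul _ _ _ hmax
      _ = S.card * a i := nsmul_eq_mul _ _
      _ ≤ 2 * a i := by
          have : (S.card : ℝ) ≤ 2 := by exact_mod_cast hS
          exact mul_le_mul_of_nonneg_right this (ha i hi)
  refine (phiMul_mono hp hb (Finset.sum_nonneg ha) h1).trans ?_
  exact Finset.single_le_sum (f := fun i => phiMul p b (2 * a i))
    (fun j hj => phiMul_nonneg hb (mul_nonneg zero_le_two (ha j hj))) hi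

variable {X : Type*} [MeasurableSpace X] {μ : Measure X}

/-- Jensen's inequality, up to a constant. -/
lemma measure_mul_phiMul_average_le [IsFiniteMeasure μ] (hp : 1 < p) (hb : 0 ≤ b) {f : X → ℝ}
    (hf : Integrable f μ) (hf0 : ∀ x, 0 ≤ f x) :
    μ Set.univ * ENNReal.ofReal (phiMul p b (⨍ x, f x ∂μ)) ≤
      ENNReal.ofReal (2 ^ p * 4) * ∫⁻ x, ENNReal.ofReal (phiMul p b (f x)) ∂μ := by
  set m := ⨍ x, f x ∂μ with hm
  have hint : μ.real Set.univ * m = ∫ x, f x ∂μ := by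
    rw [hm, ← smul_eq_mul, measure_smul_average]
  have hm0 : 0 ≤ m := by
    rw [hm, average_eq]
    exact smul_nonneg (by positivity) (integral_nonneg hf0)
  -- `θ` plays the role of the slope of a supporting line. Integrating `θ f ≤ φ'(f) f + θ m/2` and
  -- absorbing half of the left side leaves `θ m/2` times the mass, and by doubling this dominates
  -- `φ'(m) m`.
  set θ := phiDeriv p b (m / 2) with hθ
  have hθ0 : 0 ≤ θ := phiDeriv_nonneg hb (by positivity)
  have hpt (x : X) : θ * f x ≤ phiMul p b (f x) + θ * (m / 2) := by
    rcases le_total (f x) (m / 2) with h | h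
    · have h1 := mul_le_mul_of_nonneg_left h hθ0
      have h2 := phiMul_nonneg (p := p) hb (hf0 x)
      linarith
    · have h1 : θ * f x ≤ phiMul p b (f x) :=
        mul_le_mul_of_nonneg_right (phiDeriv_mono hp hb (by positivity) h) (hf0 x)
      have h2 : 0 ≤ θ * (m / 2) := by positivity
      linarith
  have hI : ENNReal.ofReal θ * (μ Set.univ * ENNReal.ofReal m) ≤
      (∫⁻ x, ENNReal.ofReal (phiMul p b (f x)) ∂μ) +
        ENNReal.ofReal θ * (μ Set.univ * ENNReal.ofReal (m / 2)) := by
    calc ENNReal.ofReal θ * (μ Set.univ * ENNReal.ofReal m)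
        = ∫⁻ x, ENNReal.ofReal (θ * f x) ∂μ := by
          rw [← ofReal_measureReal (s := Set.univ) (μ := μ), ← ENNReal.ofReal_mul measureReal_nonneg,
            hint, ofReal_integral_eq_lintegral_ofReal hf (Eventually.of_forall hf0),
            ← lintegral_const_mul' _ _ ENNReal.ofReal_ne_top]
          simp only [ENNReal.ofReal_mul hθ0]
      _ ≤ ∫⁻ x, (ENNReal.ofReal (phiMul p b (f x)) + ENNReal.ofReal (θ * (m / 2))) ∂μ :=
          lintegral_mono fun x => (ENNReal.ofReal_le_ofReal (hpt x)).trans ENNReal.ofReal_add_le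
      _ = _ := by
          rw [lintegral_add_right _ measurable_const, lintegral_const, ENNReal.ofReal_mul hθ0]
          ring
  have e2 : ENNReal.ofReal m = 2 * ENNReal.ofReal (m / 2) := by
    rw [← ENNReal.ofReal_ofNat 2, ← ENNReal.ofReal_mul (by norm_num)]
    congr 1
    ring
  have hfin : ENNReal.ofReal θ * (μ Set.univ * ENNReal.ofReal (m / 2)) ≠ ⊤ := by finiteness
  have hI2 : ENNReal.ofReal θ * (μ Set.univ * ENNReal.ofReal (m / 2)) ≤
      ∫⁻ x, ENNReal.ofReal (phiMul p b (f x)) ∂μ := by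
    refine (ENNReal.add_le_add_iff_right hfin).1 (le_trans (le_of_eq ?_) hI)
    rw [e2]
    ring
  have h3 : phiMul p b m ≤ 2 ^ p * 4 * (θ * (m / 2)) := by
    have h := phiMul_mul_le hp hb (t := m / 2) (by positivity) one_le_two
    rw [show 2 * (m / 2) = m by ring] at h
    refine h.trans ?_
    have : 0 ≤ θ * (m / 2) := by positivity
    have h2p : (0 : ℝ) ≤ 2 ^ p := by positivity
    change 2 ^ p * 2 * (θ * (m / 2)) ≤ _
    nlinarith [mul_nonneg h2p this]
  calc μ Set.univ * ENNReal.ofReal (phiMul p b m)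
      ≤ μ Set.univ * ENNReal.ofReal (2 ^ p * 4 * (θ * (m / 2))) := by gcongr
    _ = ENNReal.ofReal (2 ^ p * 4) *
          (ENNReal.ofReal θ * (μ Set.univ * ENNReal.ofReal (m / 2))) := by
        rw [ENNReal.ofReal_mul (by positivity), ENNReal.ofReal_mul hθ0]
        ring
    _ ≤ _ := by gcongr

variable {δ : ℝ}

/-- The constant of the shift change. -/
def shiftConst (p : ℝ) : ℝ≥0∞ := ENNReal.ofReal (144 * 5 ^ p)

lemma shiftConst_ne_top (p : ℝ) : shiftConst p ≠ ⊤ := ENNReal.ofReal_ne_top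

lemma ofReal_phiMul_shift_le (hp : 1 < p) (hδ : 0 ≤ δ) {a a' : ℝ} (ha : 0 ≤ a) (ha' : 0 ≤ a')
    (ht : 0 ≤ t) : ENNReal.ofReal (phiMul p (δ + a) t) ≤ shiftConst p *
      (ENNReal.ofReal (phiMul p (δ + a') t) +
        ENNReal.ofReal ((frobF p δ a - frobF p δ a') ^ 2)) := by
  have h0 : 0 ≤ phiMul p (δ + a') t := phiMul_nonneg (by positivity) ht
  rw [shiftConst, ← ENNReal.ofReal_add h0 (sq_nonneg _), ← ENNReal.ofReal_mul (by positivity)]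
  refine ENNReal.ofReal_le_ofReal ((phiDeriv_shift_le hp hδ ha ha' ht).trans (le_of_eq ?_))
  rw [phiMul]
  ring

lemma lintegral_phiMul_shift_le (hp : 1 < p) (hδ : 0 ≤ δ) {a : X → ℝ} {a' : ℝ} (ha : ∀ x, 0 ≤ a x)
    (ha' : 0 ≤ a') (ht : 0 ≤ t) : ∫⁻ x, ENNReal.ofReal (phiMul p (δ + a x) t) ∂μ ≤
      shiftConst p * (ENNReal.ofReal (phiMul p (δ + a') t) * μ Set.univ +
        ∫⁻ x, ENNReal.ofReal ((frobF p δ (a x) - frobF p δ a') ^ 2) ∂μ) := by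
  calc ∫⁻ x, ENNReal.ofReal (phiMul p (δ + a x) t) ∂μ
      ≤ ∫⁻ x, shiftConst p * (ENNReal.ofReal (phiMul p (δ + a') t) +
        ENNReal.ofReal ((frobF p δ (a x) - frobF p δ a') ^ 2)) ∂μ :=
        lintegral_mono fun x => ofReal_phiMul_shift_le hp hδ (ha x) ha' ht
    _ = _ := by
        rw [lintegral_const_mul' _ _ (shiftConst_ne_top p), lintegral_add_left measurable_const,
          lintegral_const]

/-- The passage back from a frozen shift to the variable one, after Jensen's inequality has been
applied with the frozen shift. -/
lemma lintegral_phiMul_le_phiShift (hp : 1 < p) (hδ : 0 ≤ δ) {a f : X → ℝ} {a' : ℝ}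
    (ham : Measurable a) (ha : ∀ x, 0 ≤ a x) (ha' : 0 ≤ a') (hf : ∀ x, 0 ≤ f x) :
    ∫⁻ x, ENNReal.ofReal (phiMul p (δ + a') (f x)) ∂μ ≤
      shiftConst p * (ENNReal.ofReal (2 ^ (p + 1)) *
        (∫⁻ x, ENNReal.ofReal (phiShift p δ (a x) (f x)) ∂μ) +
        ∫⁻ x, ENNReal.ofReal ((frobF p δ (a x) - frobF p δ a') ^ 2) ∂μ) := by
  have hfm : Measurable fun x => ENNReal.ofReal ((frobF p δ (a x) - frobF p δ a') ^ 2) := by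
    unfold frobF
    exact (((((ham.const_add δ).pow_const _).mul ham).sub_const _).pow_const 2).ennreal_ofReal
  calc ∫⁻ x, ENNReal.ofReal (phiMul p (δ + a') (f x)) ∂μ
      ≤ ∫⁻ x, shiftConst p * (ENNReal.ofReal (2 ^ (p + 1)) *
          ENNReal.ofReal (phiShift p δ (a x) (f x)) +
          ENNReal.ofReal ((frobF p δ (a x) - frobF p δ a') ^ 2)) ∂μ := by
        refine lintegral_mono fun x => ?_
        refine (ofReal_phiMul_shift_le hp hδ ha' (ha x) (hf x)).trans ?_
        rw [← ENNReal.ofReal_mul (by positivity)]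
        refine mul_le_mul' le_rfl (add_le_add (ENNReal.ofReal_le_ofReal ?_) (le_of_eq ?_))
        · exact le_phiShift hp hδ (ha x) (hf x)
        · rw [← neg_sub, neg_sq]
    _ = _ := by
        rw [lintegral_const_mul' _ _ (shiftConst_ne_top p), lintegral_add_right _ hfm,
          lintegral_const_mul' _ _ ENNReal.ofReal_ne_top]

end Modular

namespace ConeFace

/-- The estimates on an element and on one of its faces. -/
lemma exists_lintegral_phiShift_le (d : ℕ) {p : ℝ} (hp : 1 < p) (R : ℝ) {L : ℝ} (hL : 1 ≤ L) :
    ∃ C : ℝ≥0∞, C ≠ ⊤ ∧ ∀ (S G : Set (Eu d)) (n y₀ : Eu d) (α r h : ℝ),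
      ConeFace S G n y₀ α r h → h ≤ R * r → ∀ Ω : Set (Eu d), IsOpen Ω → interior S ⊆ Ω →
      ∀ δ : ℝ, 0 ≤ δ → ∀ A : Eu d → Ten d, (∀ i j, Measurable fun x => A x i j) →
      (∀ᵐ x ∂volume.restrict S, (A x).IsSymm) →
      ∀ DV : Fin d × Fin d → Eu d → Fin d → ℝ,
      (∀ ij : Fin d × Fin d, IntegrableOn (fun x => F p δ (A x) ij.1 ij.2) Ω) →
      (∀ ij j, IntegrableOn (fun x => DV ij x j) Ω) →
      (∀ (ij : Fin d × Fin d) j,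
        HasWeakPartial Ω (fun x => F p δ (A x) ij.1 ij.2) j (fun x => DV ij x j)) →
      ∀ tr : Eu d → Ten d, (∀ ij : Fin d × Fin d, AEMeasurable (fun x => tr x ij.1 ij.2)
        ((μHE[d - 1] : Measure (Eu d)).restrict G)) →
      ∀ E : Fin d × Fin d → ℝ → ℝ≥0∞, (∀ i, Tendsto (E i) (𝓝[>] 0) (𝓝 0)) →
      (∀ ij : Fin d × Fin d, ∀ᵐ τ ∂volume.restrict (Set.Ioo (0 : ℝ) (1 / 2)),
        ∫⁻ x in G, ‖A (shrink y₀ τ x) ij.1 ij.2 - tr x ij.1 ij.2‖ₑ ∂μHE[d - 1] ≤ E ij τ) →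
      ∀ f : Eu d → ℝ, IntegrableOn f S → (∀ x, 0 ≤ f x) →
      (∀ g : Eu d → ℝ, (∀ x ∈ S, 0 ≤ g x ∧ g x ≤ L * ⨍ x in S, f x) →
        ∫⁻ x in S, ENNReal.ofReal (phiShift p δ (frob (A x)) (g x)) ≤
          C * ((∫⁻ x in S, ENNReal.ofReal (phiShift p δ (frob (A x)) (f x))) +
            ENNReal.ofReal h ^ (2 : ℝ) * ∑ ij, gradEnergy S 2 (DV ij))) ∧
      ENNReal.ofReal h * ∫⁻ x in G, ENNReal.ofReal (phiMul p (δ + frob (tr x))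
          (L * ⨍ x in S, f x)) ∂μHE[d - 1] ≤
        C * ((∫⁻ x in S, ENNReal.ofReal (phiShift p δ (frob (A x)) (f x))) +
            ENNReal.ofReal h ^ (2 : ℝ) * ∑ ij, gradEnergy S 2 (DV ij)) := by
  set N := shiftConst p with hN
  set B : ℝ≥0∞ := ENNReal.ofReal (2 ^ (d - 1) * R) with hB
  set L' : ℝ≥0∞ := ENNReal.ofReal (L ^ p * L) with hL'
  set J : ℝ≥0∞ := ENNReal.ofReal (2 ^ p * 4) with hJ
  set Q : ℝ≥0∞ := ENNReal.ofReal (2 ^ (p + 1)) with hQ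
  set W : ℝ≥0∞ := J * (N * (Q + 2 ^ d)) with hW
  refine ⟨N * (L' * W + 2 ^ d) + N * (2 * B * L' * W + 8 * B * (1 + 2 ^ d)), ?_, ?_⟩
  · have : N ≠ ⊤ := shiftConst_ne_top p
    finiteness
  intro S G n y₀ α r h H hhR Ω hΩ hS δ hδ A hAm hsymm DV hV hDV hw tr htr E hE hle f hf hf0
  set X := ∫⁻ x in S, ENNReal.ofReal (phiShift p δ (frob (A x)) (f x)) with hX
  set Y := ENNReal.ofReal h ^ (2 : ℝ) * ∑ ij, gradEnergy S 2 (DV ij) with hY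
  have hSf : IsFiniteMeasure (volume.restrict S) :=
    ⟨by rw [Measure.restrict_apply_univ]; exact H.compS.measure_lt_top⟩
  -- The shift is frozen at `|A(y)|`, where `y` is chosen so that the squared oscillation of `F(A)`
  -- around `F(A(y))` satisfies the Poincaré bound. The same `y` is used on the cell and on the
  -- face.
  obtain ⟨y, hy, hyle⟩ := H.exists_poincare_point hΩ hS
    (V := fun (ij : Fin d × Fin d) x => F p δ (A x) ij.1 ij.2)
    (fun ij => measurable_F hAm ij.1 ij.2) hV hDV hw one_le_two
    (P := fun y => (A y).IsSymm) hsymm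
  have hyY : ∑ ij : Fin d × Fin d, ∫⁻ x in S, ‖F p δ (A x) ij.1 ij.2 - F p δ (A y) ij.1 ij.2‖ₑ ^
      (2 : ℝ) ≤ 2 ^ d * Y := hyle.trans (le_of_eq (by rw [hY]; ring))
  set a' := frob (A y) with ha'
  have ha'0 : 0 ≤ a' := frob_nonneg _
  set m := ⨍ x in S, f x with hm
  have hm0 : 0 ≤ m := by
    rw [hm, setAverage_eq]
    exact smul_nonneg (by positivity) (integral_nonneg hf0)
  have hL0 : 0 ≤ L := zero_le_one.trans hL
  have hb : 0 ≤ δ + a' := by positivity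
  have hEle : ∫⁻ x in S, ENNReal.ofReal ((frobF p δ (frob (A x)) - frobF p δ a') ^ 2) ≤
      2 ^ d * Y := by
    refine le_trans ?_ hyY
    rw [← lintegral_finsetSum _ fun ij _ =>
      (((measurable_F hAm ij.1 ij.2).sub_const _).enorm.pow_const _)]
    refine lintegral_mono_ae ?_
    filter_upwards [hsymm] with x hx
    rw [← frob_F hδ hx, ha', ← frob_F hδ hy]
    refine (ENNReal.ofReal_le_ofReal (frob_sub_frob_sq_le _ _)).trans (le_of_eq ?_)
    rw [← Fintype.sum_prod_type' (f := fun i j => (F p δ (A x) i j - F p δ (A y) i j) ^ 2),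
      ENNReal.ofReal_sum_of_nonneg fun _ _ => sq_nonneg _]
    refine Finset.sum_congr rfl fun ij _ => ?_
    rw [Real.enorm_eq_ofReal_abs, ENNReal.ofReal_rpow_of_nonneg (abs_nonneg _) zero_le_two,
      Real.rpow_two, sq_abs]
  -- Jensen's inequality with the frozen shift, followed by the change back to the variable shift.
  have hvol : volume S * ENNReal.ofReal (phiMul p (δ + a') m) ≤ W * (X + Y) := by
    have h1 := measure_mul_phiMul_average_le (μ := volume.restrict S) hp hb hf hf0
    rw [Measure.restrict_apply_univ] at h1
    have h2 := lintegral_phiMul_le_phiShift (μ := volume.restrict S) hp hδ (measurable_frob hAm)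
      (fun x => frob_nonneg _) ha'0 hf0
    calc _ ≤ _ := h1
      _ ≤ J * (N * (Q * X + 2 ^ d * Y)) := by
          refine mul_le_mul' le_rfl (h2.trans ?_)
          gcongr
      _ ≤ J * (N * ((Q + 2 ^ d) * (X + Y))) := by
          gcongr
          rw [add_mul, mul_add, mul_add]
          exact add_le_add le_self_add le_add_self
      _ = _ := by rw [hW]; ring
  have hLm : ENNReal.ofReal (phiMul p (δ + a') (L * m)) ≤
      L' * ENNReal.ofReal (phiMul p (δ + a') m) := by
    rw [hL', ← ENNReal.ofReal_mul (by positivity)]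
    exact ENNReal.ofReal_le_ofReal (phiMul_mul_le hp hb hm0 hL)
  have hYle : 2 ^ d * Y ≤ 2 ^ d * (X + Y) := by gcongr; exact le_add_self
  constructor
  · intro g hg
    calc ∫⁻ x in S, ENNReal.ofReal (phiShift p δ (frob (A x)) (g x))
        ≤ ∫⁻ x in S, ENNReal.ofReal (phiMul p (δ + frob (A x)) (L * m)) := by
          refine setLIntegral_mono_ae' H.compS.measurableSet (Eventually.of_forall fun x hx => ?_)
          have h0 := frob_nonneg (A x)
          refine ENNReal.ofReal_le_ofReal ((phiShift_le hp hδ h0 (hg x hx).1).trans ?_)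
          exact phiMul_mono hp (by positivity) (hg x hx).1 (hg x hx).2
      _ ≤ N * (ENNReal.ofReal (phiMul p (δ + a') (L * m)) * volume S + 2 ^ d * Y) := by
          refine (lintegral_phiMul_shift_le (μ := volume.restrict S) hp hδ (fun x => frob_nonneg _)
            ha'0 (mul_nonneg hL0 hm0)).trans ?_
          rw [Measure.restrict_apply_univ]
          gcongr
      _ ≤ N * (L' * (W * (X + Y)) + 2 ^ d * (X + Y)) := by
          refine mul_le_mul' le_rfl (add_le_add ?_ hYle)
          calc _ ≤ (L' * ENNReal.ofReal (phiMul p (δ + a') m)) * volume S := by gcongr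
            _ = L' * (volume S * ENNReal.ofReal (phiMul p (δ + a') m)) := by ring
            _ ≤ _ := by gcongr
      _ = N * (L' * W + 2 ^ d) * (X + Y) := by ring
      _ ≤ _ := by gcongr; exact le_self_add
  -- The product of the diameter with the cone constant is invariant under scaling. Here shape
  -- regularity enters, and it explains the weight `h` in front of face integrals.
  · have hcone : ENNReal.ofReal h * coneConst d r ≤ B := by
      rw [coneConst, ← ENNReal.ofReal_mul H.h_pos.le, hB]
      refine ENNReal.ofReal_le_ofReal ?_
      have := H.r_pos
      calc h * (2 ^ (d - 1) / r) ≤ R * r * (2 ^ (d - 1) / r) := by gcongr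
        _ = _ := by field_simp
    have htrace := H.lintegral_frobF_trace_le hΩ hS hp hδ hAm hsymm hV hDV hw htr hE hle hy
    have h8 : (2 : ℝ≥0∞) ^ (3 : ℝ) = 8 := by
      rw [show (3 : ℝ) = ((3 : ℕ) : ℝ) by norm_num, ENNReal.rpow_natCast]
      norm_num
    rw [h8] at htrace
    have htr2 : ENNReal.ofReal h * ∫⁻ x in G,
        ENNReal.ofReal ((frobF p δ (frob (tr x)) - frobF p δ a') ^ 2) ∂μHE[d - 1] ≤
        8 * B * (1 + 2 ^ d) * (X + Y) := by
      calc _ ≤ ENNReal.ofReal h * (8 * (ENNReal.ofReal h ^ (2 : ℝ) * (coneConst d r *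
            ∑ ij, gradEnergy S 2 (DV ij)) + coneConst d r * (2 ^ d * Y))) := by
            refine mul_le_mul' le_rfl (htrace.trans ?_)
            gcongr
        _ = 8 * (ENNReal.ofReal h * coneConst d r) * (1 + 2 ^ d) * Y := by rw [hY]; ring
        _ ≤ _ := by gcongr; exact le_add_self
    have hGvol : ENNReal.ofReal h * μHE[d - 1] G ≤ 2 * B * volume S := by
      calc _ ≤ ENNReal.ofReal h * (2 * coneConst d r * volume S) := by
            gcongr
            exact H.hausdorff_le
        _ = 2 * (ENNReal.ofReal h * coneConst d r) * volume S := by ring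
        _ ≤ _ := by gcongr
    calc ENNReal.ofReal h * ∫⁻ x in G, ENNReal.ofReal (phiMul p (δ + frob (tr x)) (L * m))
          ∂μHE[d - 1]
        ≤ ENNReal.ofReal h * (N * (ENNReal.ofReal (phiMul p (δ + a') (L * m)) * μHE[d - 1] G +
          ∫⁻ x in G, ENNReal.ofReal ((frobF p δ (frob (tr x)) - frobF p δ a') ^ 2)
            ∂μHE[d - 1])) := by
          refine mul_le_mul' le_rfl ((lintegral_phiMul_shift_le
            (μ := (μHE[d - 1] : Measure (Eu d)).restrict G) hp hδ
            (fun x => frob_nonneg _) ha'0 (mul_nonneg hL0 hm0)).trans ?_)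
          rw [Measure.restrict_apply_univ]
      _ = N * (ENNReal.ofReal (phiMul p (δ + a') (L * m)) * (ENNReal.ofReal h * μHE[d - 1] G) +
          ENNReal.ofReal h * ∫⁻ x in G, ENNReal.ofReal ((frobF p δ (frob (tr x)) -
            frobF p δ a') ^ 2) ∂μHE[d - 1]) := by ring
      _ ≤ N * ((L' * ENNReal.ofReal (phiMul p (δ + a') m)) * (2 * B * volume S) +
          8 * B * (1 + 2 ^ d) * (X + Y)) := by gcongr
      _ = N * (2 * B * L' * (volume S * ENNReal.ofReal (phiMul p (δ + a') m)) +
          8 * B * (1 + 2 ^ d) * (X + Y)) := by ring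
      _ ≤ N * (2 * B * L' * (W * (X + Y)) + 8 * B * (1 + 2 ^ d) * (X + Y)) := by gcongr
      _ = N * (2 * B * L' * W + 8 * B * (1 + 2 ^ d)) * (X + Y) := by ring
      _ ≤ _ := by gcongr; exact le_add_self

end ConeFace

/-! ### Summation over the elements and faces -/

lemma aemeasurable_frob {d : ℕ} {X : Type*} [MeasurableSpace X] {μ : Measure X} {A : X → Ten d}
    (hA : ∀ i j, AEMeasurable (fun x => A x i j) μ) : AEMeasurable (fun x => frob (A x)) μ := by
  unfold frob
  exact (Finset.aemeasurable_fun_sum _ fun i _ =>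
    Finset.aemeasurable_fun_sum _ fun j _ => (hA i j).pow_const 2).sqrt

lemma integrable_frob {d : ℕ} {X : Type*} [MeasurableSpace X] {μ : Measure X} {A : X → Ten d}
    (hA : ∀ i j, Integrable (fun x => A x i j) μ) : Integrable (fun x => frob (A x)) μ := by
  refine Integrable.mono' (g := fun x => ∑ i, ∑ j, |A x i j|) ?_
    (aemeasurable_frob fun i j => (hA i j).1.aemeasurable).aestronglyMeasurable ?_
  · exact integrable_finsetSum _ fun i _ => integrable_finsetSum _ fun j _ => (hA i j).abs
  · refine Eventually.of_forall fun x => ?_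
    rw [Real.norm_of_nonneg (frob_nonneg _)]
    exact frob_le_sum _

namespace Triangulation

variable {d : ℕ} {Ω : Set (Eu d)} (T : Triangulation Ω) {γ K : Finset (Eu d)}

lemma mem_faces : γ ∈ T.faces ↔ ∃ K ∈ T.cells, γ ⊆ K ∧ γ.card = d := by
  simp [faces, Finset.mem_powersetCard]

open scoped Classical in
-- Subtracting `c` from all traces changes the jump by `c ⊗ ∑ n_K`, which vanishes if the normals
-- cancel or if `c = 0`.
lemma frob_jump_le (hd : 0 < d) (hc : γ.card = d) {w : Finset (Eu d) → Eu d → Eu d} {x c : Eu d}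
    (hcn : ∑ K ∈ T.cells.filter (fun K => γ ⊆ K), outerNormal K γ = 0 ∨ c = 0)
    {s : Finset (Eu d) → ℝ} (hs : ∀ K ∈ T.cells, γ ⊆ K → ‖w K x - c‖ ≤ s K) :
    frob (T.jump w γ x) ≤ ∑ K ∈ T.cells.filter (fun K => γ ⊆ K), s K := by
  have hmem : ∀ K ∈ T.cells.filter (fun K => γ ⊆ K), K ∈ T.cells ∧ γ ⊆ K :=
    fun K hK => Finset.mem_filter.1 hK
  have e : T.jump w γ x = ∑ K ∈ T.cells.filter (fun K => γ ⊆ K),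
      Matrix.vecMulVec (fun i => (w K x - c) i) (outerNormal K γ) := by
    ext i j
    have h0 : c i * (∑ K ∈ T.cells.filter (fun K => γ ⊆ K), outerNormal K γ) j = 0 := by
      rcases hcn with h | h <;> simp [h]
    rw [jump, Matrix.sum_apply, Matrix.sum_apply]
    simp only [Matrix.vecMulVec_apply, PiLp.sub_apply, sub_mul, Finset.sum_sub_distrib]
    rw [← Finset.mul_sum]
    have e1 : ∑ K ∈ T.cells.filter (fun K => γ ⊆ K), outerNormal K γ j =
        (∑ K ∈ T.cells.filter (fun K => γ ⊆ K), outerNormal K γ) j := by simp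
    rw [e1, h0, sub_zero]
  rw [e]
  refine (frob_sum_le _ _).trans (Finset.sum_le_sum fun K hK => ?_)
  obtain ⟨hK, hγ⟩ := hmem K hK
  rw [frob_vecMulVec, (isOuterNormal_outerNormal (T.isCell K hK) hγ hc hd).1, mul_one]
  exact hs K hK hγ

open scoped Classical in
/-- The contribution of a face to the jump modular. -/
lemma lintegral_jump_le (hd : 0 < d) (hΩ : IsPolyhedralLipschitzDomain Ω) (hc : γ.card = d)
    {p δ : ℝ} (hp : 1 < p) (hδ : 0 ≤ δ) {w : Finset (Eu d) → Eu d → Eu d} {c : Eu d}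
    (hcf : simplex γ ⊆ frontier Ω → c = 0) {tr : Eu d → Ten d}
    (htr : ∀ i j, AEMeasurable (fun x => tr x i j)
      ((μHE[d - 1] : Measure (Eu d)).restrict (simplex γ)))
    {C : ℝ} (hC : 0 ≤ C) {m : Finset (Eu d) → ℝ} (hm : ∀ K, 0 ≤ m K)
    (hw : ∀ K ∈ T.cells, γ ⊆ K → ∀ x ∈ simplex γ,
      ‖w K x - c‖ ≤ C * (Metric.diam (simplex K) * m K)) :
    ENNReal.ofReal T.meshSize * ∫⁻ x in simplex γ, ENNReal.ofReal
        (phiShift p δ (frob (tr x)) (frob (T.meshSize⁻¹ • T.jump w γ x))) ∂μHE[d - 1] ≤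
      ∑ K ∈ T.cells.filter (fun K => γ ⊆ K), ENNReal.ofReal (Metric.diam (simplex K)) *
        ∫⁻ x in simplex γ, ENNReal.ofReal (phiMul p (δ + frob (tr x)) (2 * C * m K))
          ∂μHE[d - 1] := by
  obtain ⟨hcard, hor⟩ := T.adjacent_cells hd hΩ.isOpen hc
  set S := T.cells.filter (fun K => γ ⊆ K) with hS
  set h := T.meshSize with hh
  -- A mesh size that is not positive makes the weight, and with it the left side, zero.
  rcases le_or_gt h 0 with hneg | hpos
  · rw [ENNReal.ofReal_of_nonpos hneg, zero_mul]
    exact zero_le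
  have hmem : ∀ K ∈ S, K ∈ T.cells ∧ γ ⊆ K := fun K hK => Finset.mem_filter.1 hK
  have hpt : ∀ x ∈ simplex γ, phiShift p δ (frob (tr x)) (frob (h⁻¹ • T.jump w γ x)) ≤
      ∑ K ∈ S, Metric.diam (simplex K) / h * phiMul p (δ + frob (tr x)) (2 * C * m K) := by
    intro x hx
    have ha := frob_nonneg (tr x)
    have hb : 0 ≤ δ + frob (tr x) := by positivity
    have h1 : frob (h⁻¹ • T.jump w γ x) ≤
        ∑ K ∈ S, h⁻¹ * (C * (Metric.diam (simplex K) * m K)) := by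
      rw [frob_smul, abs_of_pos (inv_pos.2 hpos), ← Finset.mul_sum]
      have := T.frob_jump_le (w := w) (x := x) hd hc (hor.imp_right hcf)
        (s := fun K => C * (Metric.diam (simplex K) * m K)) fun K hK hγ => hw K hK hγ x hx
      gcongr
    have hs0 : ∀ K ∈ S, 0 ≤ h⁻¹ * (C * (Metric.diam (simplex K) * m K)) := fun K _ => by
      have := hm K
      have : 0 ≤ Metric.diam (simplex K) := Metric.diam_nonneg
      positivity
    calc phiShift p δ (frob (tr x)) (frob (h⁻¹ • T.jump w γ x))
        ≤ phiMul p (δ + frob (tr x)) (frob (h⁻¹ • T.jump w γ x)) :=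
          phiShift_le hp hδ ha (frob_nonneg _)
      _ ≤ phiMul p (δ + frob (tr x)) (∑ K ∈ S, h⁻¹ * (C * (Metric.diam (simplex K) * m K))) :=
          phiMul_mono hp hb (frob_nonneg _) h1
      _ ≤ ∑ K ∈ S, phiMul p (δ + frob (tr x)) (2 * (h⁻¹ * (C * (Metric.diam (simplex K) * m K)))) :=
          phiMul_sum_le hp hb S hcard hs0
      _ ≤ _ := by
          -- The ratio of the diameter of `K` to `h` is at most one and comes out as a factor.
          -- Against the outer weight `h` it leaves the local diameter, so no quasi-uniformity of
          -- the mesh is needed.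
          refine Finset.sum_le_sum fun K hK => ?_
          rw [show 2 * (h⁻¹ * (C * (Metric.diam (simplex K) * m K))) =
            Metric.diam (simplex K) / h * (2 * C * m K) by rw [div_eq_mul_inv]; ring]
          have := hm K
          exact phiMul_mul_le_of_le_one hp hb (by positivity)
            (div_nonneg Metric.diam_nonneg hpos.le)
            ((div_le_one hpos).2 (T.diam_le_meshSize (hmem K hK).1))
  have hmeas (t : ℝ) : AEMeasurable (fun x => ENNReal.ofReal (phiMul p (δ + frob (tr x)) t))
      ((μHE[d - 1] : Measure (Eu d)).restrict (simplex γ)) := by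
    unfold phiMul phiDeriv
    exact ((((((aemeasurable_frob htr).const_add δ).add_const t).pow_const _).mul_const
      t).mul_const t).ennreal_ofReal
  calc ENNReal.ofReal h * ∫⁻ x in simplex γ, ENNReal.ofReal
        (phiShift p δ (frob (tr x)) (frob (h⁻¹ • T.jump w γ x))) ∂μHE[d - 1]
      ≤ ENNReal.ofReal h * ∫⁻ x in simplex γ, ∑ K ∈ S, ENNReal.ofReal
          (Metric.diam (simplex K) / h) * ENNReal.ofReal (phiMul p (δ + frob (tr x)) (2 * C * m K))
          ∂μHE[d - 1] := by
        refine mul_le_mul' le_rfl (setLIntegral_mono_ae' (isCompact_simplex γ).measurableSet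
          (Eventually.of_forall fun x hx => ?_))
        refine (ENNReal.ofReal_le_ofReal (hpt x hx)).trans ?_
        rw [ENNReal.ofReal_sum_of_nonneg]
        · refine Finset.sum_le_sum fun K _ => ?_
          rw [ENNReal.ofReal_mul (div_nonneg Metric.diam_nonneg hpos.le)]
        · intro K _
          have := hm K
          have := frob_nonneg (tr x)
          exact mul_nonneg (div_nonneg Metric.diam_nonneg hpos.le)
            (phiMul_nonneg (by positivity) (by positivity))
    _ = ∑ K ∈ S, ENNReal.ofReal h * (ENNReal.ofReal (Metric.diam (simplex K) / h) *
          ∫⁻ x in simplex γ, ENNReal.ofReal (phiMul p (δ + frob (tr x)) (2 * C * m K))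
          ∂μHE[d - 1]) := by
        rw [lintegral_finsetSum' _ fun K _ => (hmeas _).const_mul _, Finset.mul_sum]
        refine Finset.sum_congr rfl fun K _ => ?_
        rw [lintegral_const_mul' _ _ ENNReal.ofReal_ne_top]
    _ = _ := by
        refine Finset.sum_congr rfl fun K _ => ?_
        rw [← mul_assoc, ← ENNReal.ofReal_mul hpos.le, mul_div_cancel₀ _ hpos.ne']

open scoped Classical in
-- Exchanging the order of summation counts each cell once for each of its at most `d + 1` faces.
lemma sum_faces_sum_cells_le (Z : Finset (Eu d) → ℝ≥0∞) :
    ∑ γ ∈ T.faces, ∑ K ∈ T.cells.filter (fun K => γ ⊆ K), Z K ≤ (d + 1) * ∑ K ∈ T.cells, Z K := by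
  rw [Finset.sum_comm' (t' := T.cells) (s' := fun K => T.faces.filter (fun γ => γ ⊆ K))
    (fun γ K => by simp only [Finset.mem_filter]; tauto), Finset.mul_sum]
  refine Finset.sum_le_sum fun K hK => ?_
  rw [Finset.sum_const, nsmul_eq_mul]
  gcongr
  have h1 : T.faces.filter (fun γ => γ ⊆ K) ⊆ K.powersetCard d := by
    intro γ hγ
    obtain ⟨h1, h2⟩ := Finset.mem_filter.1 hγ
    obtain ⟨-, -, -, h3⟩ := T.mem_faces.1 h1
    exact Finset.mem_powersetCard.2 ⟨h2, h3⟩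
  have h2 := Finset.card_le_card h1
  rw [Finset.card_powersetCard, (T.isCell K hK).1, Nat.choose_succ_self_right] at h2
  exact_mod_cast h2

/-- The stability estimate for Borel representatives of `A` and its gradient. -/
lemma exists_dgModular_le (d : ℕ) (hd : 0 < d) (k : ℕ) (ω₀ : ℝ) {p : ℝ} (hp : 1 < p) :
    ∃ C : ℝ≥0∞, C ≠ ⊤ ∧ ∀ Ω : Set (Eu d), IsPolyhedralLipschitzDomain Ω → ∀ δ : ℝ, 0 ≤ δ →
      ∀ T : Triangulation Ω, (∀ K ∈ T.cells, chunkiness K ≤ ω₀) →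
      ∀ (z : Eu d → Eu d) (Dz : Eu d → Ten d), MemW10 Ω (ENNReal.ofReal p) z Dz →
      ∀ w : Finset (Eu d) → Eu d → Eu d, T.IsL2Projection k z w →
      ∀ (A : Eu d → Ten d) (DA : Eu d → Fin d → Fin d → Fin d → ℝ) (trA : Eu d → Ten d)
        (DF : Eu d → Fin d → Fin d → Fin d → ℝ), (∀ i j, Measurable fun x => A x i j) →
        (∀ i j l, Measurable fun x => DA x i j l) →
        (∀ᵐ x ∂(volume.restrict Ω), (A x).IsSymm) →
        (∀ i j l, IntegrableOn (fun x => DA x i j l) Ω) →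
        (∀ i j, HasTraceOn Ω T.skeleton (fun x => A x i j) (fun x => DA x i j)
          (fun x => trA x i j)) →
        (∀ i j, MemW1 Ω 2 (fun x => F p δ (A x) i j) (fun x => DF x i j)) →
        T.dgModular (fun x => phiShift p δ (frob (A x))) (fun x => phiShift p δ (frob (trA x))) w ≤
          C * ((∫⁻ x in Ω, ENNReal.ofReal (phiShift p δ (frob (A x)) (frob (Dz x)))) +
            ENNReal.ofReal T.meshSize ^ (2 : ℝ) *
              ∑ ij : Fin d × Fin d, gradEnergy Ω 2 (fun x => DF x ij.1 ij.2)) := by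
  classical
  obtain ⟨C₁, hC₁, hproj⟩ := exists_projection_le_average d k hd (2 * ω₀)
  -- The factor 2 in `L` absorbs the splitting of the jump into the contributions of two cells. The
  -- ratio `2 ω₀` is the one provided by a ball of at least half the inradius.
  obtain ⟨C₂, hC₂, hmod⟩ := ConeFace.exists_lintegral_phiShift_le d hp (2 * ω₀)
    (L := 2 * C₁) (by linarith)
  refine ⟨(1 + (d + 1)) * C₂, by finiteness, ?_⟩
  intro Ω hΩ δ hδ T hT z Dz hz w hw A DA trA DF hAm hDAm hsymm hDA htr hF
  have hΩf : IsFiniteMeasure (volume.restrict Ω) :=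
    ⟨by rw [Measure.restrict_apply_univ]; exact hΩ.isBounded.measure_lt_top⟩
  have hp1 : 1 ≤ ENNReal.ofReal p := by simpa using hp.le
  have hzi (i : Fin d) : IntegrableOn (fun x => z x i) Ω := (hz i).1.1.integrable hp1
  have hDzi (i j : Fin d) : IntegrableOn (fun x => Dz x i j) Ω := ((hz i).1.2 j).1.integrable hp1
  have hV (ij : Fin d × Fin d) : IntegrableOn (fun x => F p δ (A x) ij.1 ij.2) Ω :=
    (hF ij.1 ij.2).1.integrable one_le_two
  have hDV (ij : Fin d × Fin d) (l : Fin d) : IntegrableOn (fun x => DF x ij.1 ij.2 l) Ω :=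
    ((hF ij.1 ij.2).2 l).1.integrable one_le_two
  set DV : Fin d × Fin d → Eu d → Fin d → ℝ := fun ij x => DF x ij.1 ij.2 with hDVdef
  set m : Finset (Eu d) → ℝ := fun K => ⨍ x in simplex K, frob (Dz x) with hm
  have hm0 (K : Finset (Eu d)) : 0 ≤ m K := by
    simp only [hm]
    rw [setAverage_eq]
    exact smul_nonneg (by positivity) (integral_nonneg fun x => frob_nonneg _)
  -- face constants
  have hmean : ∀ γ : Finset (Eu d), ∃ c : Eu d, γ.card = d →
      (simplex γ ⊆ frontier Ω → c = 0) ∧ ∀ i, ∀ K ∈ T.cells, γ ⊆ K → ∀ (y : Eu d) (r : ℝ),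
      0 < r → Metric.ball y r ⊆ simplex K →
      ∫⁻ x in simplex K, ‖z x i - c i‖ₑ ≤ ConeFace.faceConst d r (Metric.diam (simplex K)) *
        (d * ∑ j, ∫⁻ x in simplex K, ‖Dz x i j‖ₑ) := by
    intro γ
    by_cases hc : γ.card = d
    · choose c hc1 hc2 using fun i =>
        T.exists_face_mean hd hΩ hc (hzi i) (hDzi i) (hz i).2
      refine ⟨WithLp.toLp 2 c, fun _ => ⟨fun h => ?_, fun i => hc2 i⟩⟩
      ext i
      simpa using hc1 i h
    · exact ⟨0, fun h => absurd h hc⟩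
  choose c hc using hmean
  have hsub : ∀ K ∈ T.cells, ∀ f : Eu d → ℝ, IntegrableOn f Ω → IntegrableOn f (simplex K) :=
    fun K hK f hf => Integrable.mono_measure hf (T.restrict_simplex_le hΩ hK)
  have hbound : ∀ K ∈ T.cells, ∀ γ ⊆ K, γ.card = d → ∀ x ∈ simplex K,
      frob (jac (w K) x) ≤ C₁ * m K ∧
      ‖w K x - c γ‖ ≤ C₁ * (Metric.diam (simplex K) * m K) := by
    intro K hK γ hγ hγc
    obtain ⟨y, r, hr, hb, hdiam⟩ := exists_ball_subset_simplex hd (T.isCell K hK) (hT K hK)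
    exact hproj Ω T z Dz w hw K hK (fun i => hsub K hK _ (hzi i))
      (fun i j => hsub K hK _ (hDzi i j)) y r hr hb hdiam (c γ)
      fun i => (hc γ hγc).2 i K hK hγ y r hr hb
  set Z : Finset (Eu d) → ℝ≥0∞ := fun K => C₂ *
    ((∫⁻ x in simplex K, ENNReal.ofReal (phiShift p δ (frob (A x)) (frob (Dz x)))) +
      ENNReal.ofReal (Metric.diam (simplex K)) ^ (2 : ℝ) *
        ∑ ij, gradEnergy (simplex K) 2 (DV ij)) with hZ
  have hskel : ∀ K ∈ T.cells, ∀ γ ⊆ K, γ.card = d → simplex γ ⊆ T.skeleton :=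
    fun K hK γ hγ hγc => Set.subset_biUnion_of_mem (u := fun γ => simplex γ)
      (Finset.mem_coe.2 (T.mem_faces.2 ⟨K, hK, hγ, hγc⟩))
  have htrm : ∀ K ∈ T.cells, ∀ γ ⊆ K, γ.card = d → ∀ i j, AEMeasurable (fun x => trA x i j)
      ((μHE[d - 1] : Measure (Eu d)).restrict (simplex γ)) :=
    fun K hK γ hγ hγc i j =>
      ((htr i j).1.mono_set (hskel K hK γ hγ hγc)).1.aemeasurable
  have hloc : ∀ K ∈ T.cells, ∀ γ ⊆ K, γ.card = d →
      (∫⁻ x in simplex K, ENNReal.ofReal (phiShift p δ (frob (A x)) (frob (jac (w K) x)))) ≤ Z K ∧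
      ENNReal.ofReal (Metric.diam (simplex K)) * ∫⁻ x in simplex γ,
        ENNReal.ofReal (phiMul p (δ + frob (trA x)) (2 * C₁ * m K)) ∂μHE[d - 1] ≤ Z K := by
    intro K hK γ hγ hγc
    obtain ⟨y, r, hr, hb, hdiam⟩ := exists_ball_subset_simplex hd (T.isCell K hK) (hT K hK)
    obtain ⟨n, α, H⟩ := (T.isCell K hK).coneFace hd hγ hγc hr hb
    have hres := T.restrict_simplex_le hΩ hK
    have hE (ij : Fin d × Fin d) : ∃ E : ℝ → ℝ≥0∞, Tendsto E (𝓝[>] 0) (𝓝 0) ∧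
        ∀ᵐ τ ∂volume.restrict (Set.Ioo (0 : ℝ) (1 / 2)), ∫⁻ x in simplex γ,
          ‖A (shrink y τ x) ij.1 ij.2 - trA x ij.1 ij.2‖ₑ ∂μHE[d - 1] ≤ E τ := by
      obtain ⟨-, g, hg, hgA, hgD, hgt⟩ := htr ij.1 ij.2
      refine H.exists_ae_lintegral_sub_trace_le (u := fun x => A x ij.1 ij.2)
        (tr := fun x => trA x ij.1 ij.2) (Du := fun x => DA x ij.1 ij.2) (hAm ij.1 ij.2)
        (hDAm ij.1 ij.2) hg ?_ (fun j => ?_) ?_ fun j =>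
          (hsub K hK _ (hDA ij.1 ij.2 j)).2.ne
      · exact tendsto_of_tendsto_of_tendsto_of_le_of_le tendsto_const_nhds hgA (fun _ => zero_le)
          fun _ => lintegral_mono' hres le_rfl
      · exact tendsto_of_tendsto_of_tendsto_of_le_of_le tendsto_const_nhds (hgD j)
          (fun _ => zero_le) fun _ => lintegral_mono' hres le_rfl
      · exact tendsto_of_tendsto_of_tendsto_of_le_of_le tendsto_const_nhds hgt
          (fun _ => zero_le) fun _ => lintegral_mono_set (hskel K hK γ hγ hγc)
    choose E hE0 hEle using hE
    obtain ⟨h1, h2⟩ := hmod (simplex K) (simplex γ) n y α r _ H hdiam Ω hΩ.isOpen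
      (T.interior_simplex_subset hΩ hK) δ hδ A hAm (ae_mono hres hsymm) DV hV hDV
      (fun ij j => ((hF ij.1 ij.2).2 j).2) trA
      (fun ij => htrm K hK γ hγ hγc ij.1 ij.2) E hE0 hEle (fun x => frob (Dz x))
      (integrable_frob fun i j => hsub K hK _ (hDzi i j)) fun x => frob_nonneg _
    refine ⟨h1 _ fun x hx => ⟨frob_nonneg _, ?_⟩, h2⟩
    refine (hbound K hK γ hγ hγc x hx).1.trans ?_
    have := hm0 K
    exact mul_le_mul_of_nonneg_right (by linarith) this
  have hvol : ∑ K ∈ T.cells, ∫⁻ x in simplex K,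
      ENNReal.ofReal (phiShift p δ (frob (A x)) (frob (jac (w K) x))) ≤ ∑ K ∈ T.cells, Z K := by
    refine Finset.sum_le_sum fun K hK => ?_
    -- The gradient of the projection does not see the constant, so any face of `K` may be used.
    obtain ⟨γ, -, hγ, hγc⟩ := (T.isCell K hK).exists_face (Finset.empty_subset K) (by simp)
    exact (hloc K hK γ hγ hγc).1
  have hjump : T.jumpModular (fun x => phiShift p δ (frob (trA x))) w ≤
      (d + 1) * ∑ K ∈ T.cells, Z K := by
    refine le_trans ?_ (T.sum_faces_sum_cells_le Z)
    rw [jumpModular, Finset.mul_sum]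
    refine Finset.sum_le_sum fun γ hγ => ?_
    obtain ⟨K₀, hK₀, hγ₀, hγc⟩ := T.mem_faces.1 hγ
    refine (T.lintegral_jump_le hd hΩ hγc hp hδ (hc γ hγc).1 (htrm K₀ hK₀ γ hγ₀ hγc)
      (zero_le_one.trans hC₁) hm0 fun K hK hγK x hx =>
        (hbound K hK γ hγK hγc x (simplex_mono hγK hx)).2).trans ?_
    refine Finset.sum_le_sum fun K hK => ?_
    obtain ⟨hK, hγK⟩ := Finset.mem_filter.1 hK
    exact (hloc K hK γ hγK hγc).2
  have hsum : ∑ K ∈ T.cells, Z K ≤ C₂ *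
      ((∫⁻ x in Ω, ENNReal.ofReal (phiShift p δ (frob (A x)) (frob (Dz x)))) +
        ENNReal.ofReal T.meshSize ^ (2 : ℝ) * ∑ ij, gradEnergy Ω 2 (DV ij)) := by
    simp only [hZ]
    rw [← Finset.mul_sum, Finset.sum_add_distrib]
    refine mul_le_mul' le_rfl (add_le_add (T.sum_lintegral_simplex_le hd hΩ _) ?_)
    calc ∑ K ∈ T.cells, ENNReal.ofReal (Metric.diam (simplex K)) ^ (2 : ℝ) *
          ∑ ij, gradEnergy (simplex K) 2 (DV ij)
        ≤ ∑ K ∈ T.cells, ENNReal.ofReal T.meshSize ^ (2 : ℝ) *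
          ∑ ij, gradEnergy (simplex K) 2 (DV ij) := by
          refine Finset.sum_le_sum fun K hK => ?_
          have := T.diam_le_meshSize hK
          gcongr
      _ = ENNReal.ofReal T.meshSize ^ (2 : ℝ) *
          ∑ ij, ∑ K ∈ T.cells, gradEnergy (simplex K) 2 (DV ij) := by
          rw [← Finset.mul_sum, Finset.sum_comm]
      _ ≤ _ := by
          gcongr with ij
          simp only [gradEnergy]
          rw [← Finset.mul_sum, Finset.sum_comm]
          gcongr with j
          exact T.sum_lintegral_simplex_le hd hΩ _
  calc T.dgModular (fun x => phiShift p δ (frob (A x))) (fun x => phiShift p δ (frob (trA x))) w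
      ≤ (∑ K ∈ T.cells, Z K) + (d + 1) * ∑ K ∈ T.cells, Z K := add_le_add hvol hjump
    _ = (1 + (d + 1)) * ∑ K ∈ T.cells, Z K := by ring
    _ ≤ _ := by
        rw [mul_assoc]
        gcongr

end Triangulation

/-! ### Change of representatives and conclusion -/

lemma HasWeakPartial.congr {d : ℕ} {Ω : Set (Eu d)} {u u' g : Eu d → ℝ} {j : Fin d}
    (h : HasWeakPartial Ω u j g) (hu : u =ᵐ[volume.restrict Ω] u') : HasWeakPartial Ω u' j g := by
  intro η h1 h2 h3
  rw [← h η h1 h2 h3]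
  refine integral_congr_ae ?_
  filter_upwards [hu] with x hx
  rw [hx]

lemma MemW1.congr {d : ℕ} {Ω : Set (Eu d)} {q : ℝ≥0∞} {u u' : Eu d → ℝ} {Du : Eu d → Fin d → ℝ}
    (h : MemW1 Ω q u Du) (hu : u =ᵐ[volume.restrict Ω] u') : MemW1 Ω q u' Du :=
  ⟨h.1.ae_eq hu, fun j => ⟨(h.2 j).1, (h.2 j).2.congr hu⟩⟩

lemma HasTraceOn.congr {d : ℕ} {Ω S : Set (Eu d)} {u u' tr : Eu d → ℝ} {Du Du' : Eu d → Fin d → ℝ}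
    (h : HasTraceOn Ω S u Du tr) (hu : u =ᵐ[volume.restrict Ω] u')
    (hDu : ∀ j, (fun x => Du x j) =ᵐ[volume.restrict Ω] fun x => Du' x j) :
    HasTraceOn Ω S u' Du' tr := by
  obtain ⟨h0, g, hg, h1, h2, h3⟩ := h
  refine ⟨h0, g, hg, ?_, fun j => ?_, h3⟩
  · refine h1.congr fun n => lintegral_congr_ae ?_
    filter_upwards [hu] with x hx
    rw [hx]
  · refine (h2 j).congr fun n => lintegral_congr_ae ?_
    filter_upwards [hDu j] with x hx
    rw [hx]

/-- Identifies the energy carried through the local estimates with `‖∇F(A)‖²`, up to the dimensional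
factor that is later absorbed in the constant. -/
lemma sum_gradEnergy_eq {d : ℕ} {Ω : Set (Eu d)} {DF : Eu d → Fin d → Fin d → Fin d → ℝ}
    (hDF : ∀ i j l, AEMeasurable (fun x => DF x i j l) (volume.restrict Ω)) :
    ∑ ij : Fin d × Fin d, gradEnergy Ω 2 (fun x => DF x ij.1 ij.2) =
      (d : ℝ≥0∞) ^ (2 : ℝ) * ∫⁻ x in Ω, ENNReal.ofReal (∑ i, ∑ j, ∑ l, DF x i j l ^ 2) := by
  have hsq (a : ℝ) : ‖a‖ₑ ^ (2 : ℝ) = ENNReal.ofReal (a ^ 2) := by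
    rw [Real.enorm_eq_ofReal_abs, ENNReal.ofReal_rpow_of_nonneg (abs_nonneg _) zero_le_two,
      Real.rpow_two, sq_abs]
  have hm (i j l : Fin d) : AEMeasurable (fun x => ENNReal.ofReal (DF x i j l ^ 2))
      (volume.restrict Ω) := ((hDF i j l).pow_const 2).ennreal_ofReal
  have e (x : Eu d) : ENNReal.ofReal (∑ i, ∑ j, ∑ l, DF x i j l ^ 2) =
      ∑ ij : Fin d × Fin d, ∑ l, ENNReal.ofReal (DF x ij.1 ij.2 l ^ 2) := by
    rw [← Fintype.sum_prod_type' (f := fun i j => ∑ l, DF x i j l ^ 2),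
      ENNReal.ofReal_sum_of_nonneg fun _ _ => Finset.sum_nonneg fun _ _ => sq_nonneg _]
    exact Finset.sum_congr rfl fun ij _ => ENNReal.ofReal_sum_of_nonneg fun _ _ => sq_nonneg _
  simp only [gradEnergy, hsq, e]
  rw [← Finset.mul_sum, lintegral_finsetSum' _ fun ij _ =>
    Finset.aemeasurable_fun_sum _ fun l _ => hm ij.1 ij.2 l]
  congr 1
  exact Finset.sum_congr rfl fun ij _ => (lintegral_finsetSum' _ fun l _ => hm ij.1 ij.2 l).symm

end LDG

end

theorem lemma3p7 (d : ℕ) (hd : d = 2 ∨ d = 3) (Ω : Set (LDG.Eu d))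
    (hΩ : LDG.IsPolyhedralLipschitzDomain Ω) (k : ℕ) (ω₀ p : ℝ) (hp : 1 < p) :
    ∃ c : ℝ, 0 < c ∧ ∀ δ : ℝ, 0 ≤ δ →
      ∀ T : LDG.Triangulation Ω, (∀ K ∈ T.cells, LDG.chunkiness K ≤ ω₀) → T.meshSize ≤ 1 →
      ∀ (z : LDG.Eu d → LDG.Eu d) (Dz : LDG.Eu d → LDG.Ten d),
        LDG.MemW10 Ω (ENNReal.ofReal p) z Dz →
      ∀ (w : Finset (LDG.Eu d) → LDG.Eu d → LDG.Eu d), T.IsL2Projection k z w →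
      -- `A` with weak gradient `DA`, trace `trA` on `Γ_h`, and weak gradient `DF` of `F(A)`
      ∀ (A : LDG.Eu d → LDG.Ten d) (DA : LDG.Eu d → Fin d → Fin d → Fin d → ℝ)
        (trA : LDG.Eu d → LDG.Ten d) (DF : LDG.Eu d → Fin d → Fin d → Fin d → ℝ),
        (∀ᵐ x ∂(volume.restrict Ω), (A x).IsSymm) →
        (∀ i j, MemLp (fun x => A x i j) (ENNReal.ofReal p) (volume.restrict Ω)) →
        (∀ i j, LDG.MemW1 Ω 1 (fun x => A x i j) (fun x => DA x i j)) →
        (∀ i j, LDG.HasTraceOn Ω T.skeleton (fun x => A x i j) (fun x => DA x i j)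
          (fun x => trA x i j)) →
        (∀ i j, LDG.MemW1 Ω 2 (fun x => LDG.F p δ (A x) i j) (fun x => DF x i j)) →
        T.dgModular (fun x => LDG.phiShift p δ (LDG.frob (A x)))
            (fun x => LDG.phiShift p δ (LDG.frob (trA x))) w ≤
          ENNReal.ofReal c *
              (∫⁻ x in Ω, ENNReal.ofReal
                (LDG.phiShift p δ (LDG.frob (A x)) (LDG.frob (Dz x)))) +
            ENNReal.ofReal (c * T.meshSize ^ 2) *
              (∫⁻ x in Ω, ENNReal.ofReal (∑ i, ∑ j, ∑ l, DF x i j l ^ 2)) := by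
  have hd0 : 0 < d := by omega
  obtain ⟨C, hC, hmain⟩ := LDG.Triangulation.exists_dgModular_le d hd0 k ω₀ hp
  set B : ℝ≥0∞ := C * (1 + (d : ℝ≥0∞) ^ (2 : ℝ)) with hB
  have hBt : B ≠ ⊤ := by finiteness
  refine ⟨B.toReal + 1, by positivity, ?_⟩
  intro δ hδ T hT _ z Dz hz w hw A DA trA DF hsymm _ hA htr hF
  have hA' (i j : Fin d) := (hA i j).1.1
  have hDA' (i j l : Fin d) := ((hA i j).2 l).1.1
  -- The slices are null sets for the volume, so almost everywhere measurability of `A` says nothing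
  -- on an individual slice. Borel representatives of `A` and of its gradient are used, with the
  -- trace on the skeleton kept unchanged.
  set A' : LDG.Eu d → LDG.Ten d := fun x => Matrix.of fun i j => (hA' i j).mk _ x with hA'def
  set DA' : LDG.Eu d → Fin d → Fin d → Fin d → ℝ := fun x i j l => (hDA' i j l).mk _ x with hDA'def
  have hAij (i j : Fin d) : (fun x => A x i j) =ᵐ[volume.restrict Ω] fun x => A' x i j :=
    (hA' i j).ae_eq_mk
  have hDAij (i j l : Fin d) : (fun x => DA x i j l) =ᵐ[volume.restrict Ω] fun x => DA' x i j l :=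
    (hDA' i j l).ae_eq_mk
  have hAA : A =ᵐ[volume.restrict Ω] A' := by
    filter_upwards [ae_all_iff.2 fun i => ae_all_iff.2 (hAij i)] with x hx
    ext i j
    exact hx i j
  have h := hmain Ω hΩ δ hδ T hT z Dz hz w hw A' DA' trA DF
    (fun i j => (hA' i j).stronglyMeasurable_mk.measurable)
    (fun i j l => (hDA' i j l).stronglyMeasurable_mk.measurable)
    (by filter_upwards [hsymm, hAA] with x hx hxA using hxA ▸ hx)
    (fun i j l => Integrable.congr (memLp_one_iff_integrable.1 ((hA i j).2 l).1) (hDAij i j l))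
    (fun i j => (htr i j).congr (hAij i j) (hDAij i j))
    (fun i j => (hF i j).congr (by filter_upwards [hAA] with x hx; rw [hx]))
  have e1 : T.dgModular (fun x => LDG.phiShift p δ (LDG.frob (A' x)))
      (fun x => LDG.phiShift p δ (LDG.frob (trA x))) w =
      T.dgModular (fun x => LDG.phiShift p δ (LDG.frob (A x)))
      (fun x => LDG.phiShift p δ (LDG.frob (trA x))) w := by
    unfold LDG.Triangulation.dgModular
    congr 1
    refine Finset.sum_congr rfl fun K hK => lintegral_congr_ae ?_
    filter_upwards [ae_mono (T.restrict_simplex_le hΩ hK) hAA] with x hx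
    rw [hx]
  have e2 : ∫⁻ x in Ω, ENNReal.ofReal (LDG.phiShift p δ (LDG.frob (A' x)) (LDG.frob (Dz x))) =
      ∫⁻ x in Ω, ENNReal.ofReal (LDG.phiShift p δ (LDG.frob (A x)) (LDG.frob (Dz x))) := by
    refine lintegral_congr_ae ?_
    filter_upwards [hAA] with x hx
    rw [hx]
  rw [e1, e2, LDG.sum_gradEnergy_eq fun i j l => ((hF i j).2 l).1.1.aemeasurable] at h
  have hBc : B ≤ ENNReal.ofReal (B.toReal + 1) := by
    rw [ENNReal.ofReal_add ENNReal.toReal_nonneg zero_le_one, ENNReal.ofReal_toReal hBt]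
    exact le_self_add
  have hmesh : ENNReal.ofReal T.meshSize ^ (2 : ℝ) = ENNReal.ofReal (T.meshSize ^ 2) := by
    have : 0 ≤ T.meshSize := Real.iSup_nonneg fun _ => Metric.diam_nonneg
    rw [ENNReal.ofReal_rpow_of_nonneg this zero_le_two, Real.rpow_two]
  rw [ENNReal.ofReal_mul (by positivity), ← hmesh]
  set X := ∫⁻ x in Ω, ENNReal.ofReal (LDG.phiShift p δ (LDG.frob (A x)) (LDG.frob (Dz x)))
  set Y := ∫⁻ x in Ω, ENNReal.ofReal (∑ i, ∑ j, ∑ l, DF x i j l ^ 2)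
  set H := ENNReal.ofReal T.meshSize ^ (2 : ℝ)
  calc _ ≤ _ := h
    _ = C * X + C * (d : ℝ≥0∞) ^ (2 : ℝ) * (H * Y) := by ring
    _ ≤ B * X + B * (H * Y) := by
        rw [hB]
        gcongr
        · exact le_mul_of_one_le_right zero_le le_self_add
        · exact le_add_self
    _ ≤ ENNReal.ofReal (B.toReal + 1) * X + ENNReal.ofReal (B.toReal + 1) * (H * Y) := by gcongr
    _ = _ := by ring
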